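/- Conventions. For $\mathbb F\in\{\mathbb R,\mathbb C\}$, an $\mathbb F$-operator space is an $\mathbb F$-linear subspace $X\subseteq B(\mathcal H)$ for a Hilbert space $\mathcal H$ over $\mathbb F$; it is a unital operator space if it contains the identity operator, and an operator system if moreover it is closed under adjoints. For $(\mathbb F_1,\mathbb F_2)\in\{(\mathbb R,\mathbb R),(\mathbb C,\mathbb C),(\mathbb C,\mathbb R)\}$ (the real, complex and intermediate case), $\mathsf{OSp}_{(\mathbb F_1,\mathbb F_2)}$ (resp. $\mathsf{OSp}^{\mathbb 1}_{(\mathbb F_1,\mathbb F_2)}$, $\mathsf{OSy}_{(\mathbb F_1,\mathbb F_2)}$) is the category whose objects are the $\mathbb F_1$-operator spaces (resp. unital $\mathbb F_1$-operator spaces, $\mathbb F_1$-operator systems) and whose morphisms are the completely contractive (resp. unital completely contractive, unital completely positive) $\mathbb F_2$-linear maps. For a discrete group $G$, the categories $\mathsf{OSp}^{G}_{(\mathbb F_1,\mathbb F_2)}$, $\mathsf{OSp}^{\mathbb 1,G}_{(\mathbb F_1,\mathbb F_2)}$, $\mathsf{OSy}^{G}_{(\mathbb F_1,\mathbb F_2)}$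 have as objects the same spaces with an action of $G$ by $\mathbb F_1$-linear surjective complete isometries (resp. unital surjective complete isometries, unital complete order isomorphisms), and as morphisms the $G$-equivariant morphisms. The complexification functor $\mathcal F_c$ maps a real space $X\subseteq B(\mathcal H)$ to $X_c=X+iX\subseteq B(\mathcal H+i\mathcal H)$ (equivalently, $x+iy$ is normed and ordered as the matrix $\begin{bmatrix}x&-y\\y&x\end{bmatrix}$ over $X$), with the action $g(x+iy)=gx+i\,gy$ if $G$ acts on $X$, and a morphism $T$ to $T_c(x+iy)=T(x)+i\,T(y)$. On the intermediate categories, $\mathcal F_c(X)$ is the complexification of $X$ regarded as a real space. So for each of the six types $\mathsf{OSp}$, $\mathsf{OSp}^{\mathbb 1}$, $\mathsf{OSy}$, $\mathsf{OSp}^{G}$, $\mathsf{OSp}^{\mathbb 1,G}$, $\mathsf{OSy}^{G}$, there is one functor $\mathcal F_c$ from the real to the complex category and one from the intermediate to the complex category, twelve in all. The functors $\mathcal F_0$ forget structure. Theorem. Let $G$ be a discrete group. (1) Each of the twelve complexification functors $\mathcal F_c$ is faithful, is not full, and is not essentially surjective. (2) For each of the six types, the forgetful functor $\mathcal F_0$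 from the complex to the real category (which regards complex spaces and maps as real ones) is not essentially surjective. In fact the quaternions $\mathbb H$, acting on the real Hilbert space $\mathbb H$ by left multiplication, and with trivial $G$-action in the $G$-categories, are a real operator system which is not isomorphic in the real category (of operator spaces, unital operator spaces or operator systems, with or without $G$) to $\mathcal F_0(Z)$ for any object $Z$ of the complex category. (3) In each of the real, complex and intermediate cases, the forgetful functors $\mathcal F_0:\mathsf{OSp}^{\mathbb 1}_{(\mathbb F_1,\mathbb F_2)}\to\mathsf{OSp}_{(\mathbb F_1,\mathbb F_2)}$ and $\mathcal F_0:\mathsf{OSp}^{\mathbb 1,G}_{(\mathbb F_1,\mathbb F_2)}\to\mathsf{OSp}^{G}_{(\mathbb F_1,\mathbb F_2)}$ are not essentially surjective. -/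

import Mathlib

universe u v

namespace OpSp

open scoped InnerProductSpace

section Blocks

variable {𝔽 : Type*} [RCLike 𝔽]
variable {H : Type*} [NormedAddCommGroup H] [InnerProductSpace 𝔽 H]
variable {K : Type*} [NormedAddCommGroup K] [InnerProductSpace 𝔽 K]
variable {ι : Type*} [Fintype ι]

/-- The operator on the Hilbert space direct sum `H ⊕ ⋯ ⊕ H` given by a matrix of operators on `H`:
`(blockOp T v) i = ∑ j, T i j (v j)`. This is the usual identification `M_n(B(H)) = B(Hⁿ)`. -/
noncomputable def blockOp (T : Matrix ι ι (H →L[𝔽] H)) :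
    PiLp 2 (fun _ : ι => H) →L[𝔽] PiLp 2 (fun _ : ι => H) :=
  ((PiLp.continuousLinearEquiv 2 𝔽 (fun _ : ι => H)).symm :
      (ι → H) →L[𝔽] PiLp 2 (fun _ : ι => H)) ∘L
    (ContinuousLinearMap.pi fun i => ∑ j, (T i j) ∘L ContinuousLinearMap.proj j) ∘L
    ((PiLp.continuousLinearEquiv 2 𝔽 (fun _ : ι => H)) : PiLp 2 (fun _ : ι => H) →L[𝔽] (ι → H))

theorem blockOp_apply (T : Matrix ι ι (H →L[𝔽] H)) (v : PiLp 2 (fun _ : ι => H)) (i : ι) :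
    blockOp T v i = ∑ j, T i j (v j) := by
  simp [blockOp]

/-- The operator on `Hⁿ` given by a matrix with entries in a space `X` of operators on `H`. -/
noncomputable def matOp {X : Submodule 𝔽 (H →L[𝔽] H)} (x : Matrix ι ι X) :
    PiLp 2 (fun _ : ι => H) →L[𝔽] PiLp 2 (fun _ : ι => H) :=
  blockOp (x.map fun a => (a : H →L[𝔽] H))

theorem matOp_apply {X : Submodule 𝔽 (H →L[𝔽] H)} (x : Matrix ι ι X)
    (v : PiLp 2 (fun _ : ι => H)) (i : ι) :
    matOp x v i = ∑ j, (x i j : H →L[𝔽] H) (v j) := by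
  simp [matOp, blockOp_apply]

/-- The matrix `x` is positive, as an operator on `Hⁿ`. (Positive operators on a real or complex
Hilbert space are the self-adjoint ones with `0 ≤ ⟪T v, v⟫` for all `v`.) -/
def MatPos {X : Submodule 𝔽 (H →L[𝔽] H)} (x : Matrix ι ι X) : Prop := (matOp x).IsPositive

/-- `f` is completely contractive: `‖[f(x_ij)]‖ ≤ ‖[x_ij]‖` in every matrix size. -/
def CompletelyContractive {X : Submodule 𝔽 (H →L[𝔽] H)} {Y : Submodule 𝔽 (K →L[𝔽] K)}
    (f : X → Y) : Prop :=
  ∀ (n : ℕ) (x : Matrix (Fin n) (Fin n) X), ‖matOp (x.map f)‖ ≤ ‖matOp x‖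

/-- `f` is completely isometric: `‖[f(x_ij)]‖ = ‖[x_ij]‖` in every matrix size. -/
def CompletelyIsometric {X : Submodule 𝔽 (H →L[𝔽] H)} {Y : Submodule 𝔽 (K →L[𝔽] K)}
    (f : X → Y) : Prop :=
  ∀ (n : ℕ) (x : Matrix (Fin n) (Fin n) X), ‖matOp (x.map f)‖ = ‖matOp x‖

/-- `f` is completely positive: it maps positive matrices to positive matrices in every size. -/
def CompletelyPositive {X : Submodule 𝔽 (H →L[𝔽] H)} {Y : Submodule 𝔽 (K →L[𝔽] K)}
    (f : X → Y) : Prop :=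
  ∀ (n : ℕ) (x : Matrix (Fin n) (Fin n) X), MatPos x → MatPos (x.map f)

/-- `f` preserves and reflects positivity of matrices in every size. -/
def CompleteOrderEmbedding {X : Submodule 𝔽 (H →L[𝔽] H)} {Y : Submodule 𝔽 (K →L[𝔽] K)}
    (f : X → Y) : Prop :=
  ∀ (n : ℕ) (x : Matrix (Fin n) (Fin n) X), MatPos (x.map f) ↔ MatPos x

/-- `f` maps the identity operator to the identity operator. -/
def PreservesOne {X : Submodule 𝔽 (H →L[𝔽] H)} {Y : Submodule 𝔽 (K →L[𝔽] K)}
    (f : X → Y) : Prop :=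
  ∀ x : X, (x : H →L[𝔽] H) = 1 → (f x : K →L[𝔽] K) = 1

end Blocks

section Intertwine

variable {𝔽 𝔽' : Type*} [RCLike 𝔽] [RCLike 𝔽']
variable {E F : Type*} [NormedAddCommGroup E] [InnerProductSpace 𝔽 E]
  [NormedAddCommGroup F] [InnerProductSpace 𝔽' F]

theorem opNorm_eq_of_intertwine (A : E →L[𝔽] E) (B : F →L[𝔽'] F) (U : E → F)
    (hU : Function.Surjective U) (hn : ∀ v, ‖U v‖ = ‖v‖) (h : ∀ v, U (A v) = B (U v)) :
    ‖A‖ = ‖B‖ := by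
  apply le_antisymm
  · refine A.opNorm_le_bound (norm_nonneg _) fun v => ?_
    rw [← hn, h, ← hn v]
    exact B.le_opNorm _
  · refine B.opNorm_le_bound (norm_nonneg _) fun v => ?_
    obtain ⟨v, rfl⟩ := hU v
    rw [← h, hn, hn]
    exact A.le_opNorm _

theorem isPositive_iff_re (A : E →L[𝔽] E) : A.IsPositive ↔
    (∀ v w, RCLike.re ⟪A v, w⟫_𝔽 = RCLike.re ⟪v, A w⟫_𝔽) ∧ ∀ v, 0 ≤ RCLike.re ⟪A v, v⟫_𝔽 := by
  constructor
  · rintro ⟨h1, h2⟩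
    exact ⟨fun v w => congrArg RCLike.re (h1 v w), h2⟩
  · rintro ⟨h1, h2⟩
    refine ⟨fun v w => ?_, h2⟩
    apply RCLike.ext (h1 v w)
    have := h1 v ((RCLike.I : 𝔽) • w)
    simpa [inner_smul_right, map_smul] using this

theorem isPositive_iff_of_intertwine (A : E →L[𝔽] E) (B : F →L[𝔽'] F) (U : E → F)
    (hU : Function.Surjective U)
    (hi : ∀ v w, RCLike.re ⟪U v, U w⟫_𝔽' = RCLike.re ⟪v, w⟫_𝔽) (h : ∀ v, U (A v) = B (U v)) :
    A.IsPositive ↔ B.IsPositive := by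
  rw [isPositive_iff_re, isPositive_iff_re]
  constructor
  · rintro ⟨h1, h2⟩
    constructor
    · intro v w
      obtain ⟨v, rfl⟩ := hU v
      obtain ⟨w, rfl⟩ := hU w
      rw [← h, ← h, hi, hi, h1]
    · intro v
      obtain ⟨v, rfl⟩ := hU v
      rw [← h, hi]; exact h2 v
  · rintro ⟨h1, h2⟩
    constructor
    · intro v w
      rw [← hi, ← hi, h, h, h1]
    · intro v
      rw [← hi, h]; exact h2 _

end Intertwine

section Compare

variable {𝔽 𝔽' : Type*} [RCLike 𝔽] [RCLike 𝔽']
variable {H : Type*} [NormedAddCommGroup H] [InnerProductSpace 𝔽 H]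
variable {K : Type*} [NormedAddCommGroup K] [InnerProductSpace 𝔽' K]
variable {ι κ : Type*} [Fintype ι] [Fintype κ]

theorem matOp_compare {X : Submodule 𝔽 (H →L[𝔽] H)} {Y : Submodule 𝔽' (K →L[𝔽'] K)}
    (x : Matrix ι ι X) (y : Matrix κ κ Y)
    (U : PiLp 2 (fun _ : ι => H) → PiLp 2 (fun _ : κ => K)) (hU : Function.Surjective U)
    (hi : ∀ v w, ∑ i, RCLike.re ⟪U v i, U w i⟫_𝔽' = ∑ i, RCLike.re ⟪v i, w i⟫_𝔽)
    (h : ∀ v, U (matOp x v) = matOp y (U v)) :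
    ‖matOp x‖ = ‖matOp y‖ ∧ (MatPos x ↔ MatPos y) := by
  have hi' : ∀ v w, RCLike.re ⟪U v, U w⟫_𝔽' = RCLike.re ⟪v, w⟫_𝔽 := by
    intro v w
    rw [PiLp.inner_apply, PiLp.inner_apply, map_sum, map_sum, hi]
  have hn : ∀ v, ‖U v‖ = ‖v‖ := by
    intro v
    have h := hi' v v
    rw [inner_self_eq_norm_sq, inner_self_eq_norm_sq] at h
    exact (sq_eq_sq₀ (norm_nonneg _) (norm_nonneg _)).1 h
  exact ⟨opNorm_eq_of_intertwine _ _ U hU hn h, isPositive_iff_of_intertwine _ _ U hU hi' h⟩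

end Compare

section Reindex

variable {𝔽 : Type*} [RCLike 𝔽]
variable {H : Type*} [NormedAddCommGroup H] [InnerProductSpace 𝔽 H]
variable {ι κ : Type*} [Fintype ι] [Fintype κ]

theorem matOp_reindex {X : Submodule 𝔽 (H →L[𝔽] H)} (e : κ ≃ ι) (x : Matrix ι ι X) :
    ‖matOp (x.submatrix e e)‖ = ‖matOp x‖ ∧
      (MatPos (x.submatrix e e) ↔ MatPos x) := by
  have hU : Function.Surjective
      (LinearIsometryEquiv.piLpCongrLeft 2 𝔽 H e : PiLp 2 (fun _ : κ => H) → _) :=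
    (LinearIsometryEquiv.piLpCongrLeft 2 𝔽 H e).surjective
  have h : ∀ v, LinearIsometryEquiv.piLpCongrLeft 2 𝔽 H e (matOp (x.submatrix e e) v) =
      matOp x (LinearIsometryEquiv.piLpCongrLeft 2 𝔽 H e v) := by
    intro v
    ext i
    simp only [LinearIsometryEquiv.piLpCongrLeft_apply, Equiv.piCongrLeft'_apply, matOp_apply,
      Matrix.submatrix_apply, Equiv.apply_symm_apply]
    exact Fintype.sum_equiv e _ _ (by simp)
  exact ⟨opNorm_eq_of_intertwine _ _ _ hU (LinearIsometryEquiv.norm_map _) h,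
    isPositive_iff_of_intertwine _ _ _ hU (fun v w => by rw [LinearIsometryEquiv.inner_map_map]) h⟩

end Reindex

section HilbertComplexification

/-- The complexification `H + iH` of a real Hilbert space `H`. -/
@[ext]
structure HilbertC (H : Type*) where
  re : H
  im : H

namespace HilbertC

variable {H : Type*}

/-- The pair of real and imaginary parts. -/
def equivProd (H : Type*) : HilbertC H ≃ H × H where
  toFun v := (v.re, v.im)
  invFun p := ⟨p.1, p.2⟩

variable [NormedAddCommGroup H]

instance : AddCommGroup (HilbertC H) := (equivProd H).addCommGroup

@[simp] theorem re_add (v w : HilbertC H) : (v + w).re = v.re + w.re := rfl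
@[simp] theorem im_add (v w : HilbertC H) : (v + w).im = v.im + w.im := rfl
@[simp] theorem re_zero : (0 : HilbertC H).re = 0 := rfl
@[simp] theorem im_zero : (0 : HilbertC H).im = 0 := rfl

variable [InnerProductSpace ℝ H]

/-- `(a + ib)(x + iy) = (ax - by) + i(ay + bx)`. -/
instance : SMul ℂ (HilbertC H) :=
  ⟨fun c v => ⟨c.re • v.re - c.im • v.im, c.re • v.im + c.im • v.re⟩⟩

@[simp] theorem re_smul (c : ℂ) (v : HilbertC H) : (c • v).re = c.re • v.re - c.im • v.im := rfl
@[simp] theorem im_smul (c : ℂ) (v : HilbertC H) : (c • v).im = c.re • v.im + c.im • v.re := rfl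

instance : Module ℂ (HilbertC H) where
  one_smul v := by ext <;> simp
  mul_smul a b v := by ext <;> simp <;> module
  smul_zero a := by ext <;> simp
  smul_add a v w := by ext <;> simp <;> module
  add_smul a b v := by ext <;> simp <;> module
  zero_smul v := by ext <;> simp

/-- The sesquilinear extension of the real inner product (conjugate linear on the left). -/
noncomputable instance : Inner ℂ (HilbertC H) :=
  ⟨fun v w => ⟨inner ℝ v.re w.re + inner ℝ v.im w.im, inner ℝ v.re w.im - inner ℝ v.im w.re⟩⟩

theorem inner_re (v w : HilbertC H) :
    (inner ℂ v w).re = inner ℝ v.re w.re + inner ℝ v.im w.im := rfl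
theorem inner_im (v w : HilbertC H) :
    (inner ℂ v w).im = inner ℝ v.re w.im - inner ℝ v.im w.re := rfl

/-- The axioms of a complex inner product. -/
@[reducible] noncomputable def core : InnerProductSpace.Core ℂ (HilbertC H) where
  conj_inner_symm v w := by
    apply Complex.ext
    · simp [inner_re, real_inner_comm]
    · simp [inner_im, real_inner_comm]
  re_inner_nonneg v := by
    change 0 ≤ (inner ℂ v v).re
    rw [inner_re]
    exact add_nonneg real_inner_self_nonneg real_inner_self_nonneg
  add_left u v w := by
    apply Complex.ext
    · simp [inner_re, inner_add_left]; ring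
    · simp [inner_im, inner_add_left]; ring
  smul_left v w c := by
    apply Complex.ext
    · simp [inner_re, inner_im, inner_add_left, inner_sub_left, inner_smul_left]; ring
    · simp [inner_re, inner_im, inner_add_left, inner_sub_left, inner_smul_left]; ring
  definite v h := by
    have h' := congrArg Complex.re h
    rw [inner_re] at h'
    have h1 := real_inner_self_nonneg (x := v.re)
    have h2 := real_inner_self_nonneg (x := v.im)
    simp only [Complex.zero_re] at h'
    ext
    · exact inner_self_eq_zero.1 (le_antisymm (by linarith) h1)
    · exact inner_self_eq_zero.1 (le_antisymm (by linarith) h2)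

noncomputable instance : NormedAddCommGroup (HilbertC H) :=
  @InnerProductSpace.Core.toNormedAddCommGroup ℂ (HilbertC H) _ _ _ core

noncomputable instance : InnerProductSpace ℂ (HilbertC H) :=
  InnerProductSpace.ofCore core.toCore

theorem norm_sq (v : HilbertC H) : ‖v‖ ^ 2 = ‖v.re‖ ^ 2 + ‖v.im‖ ^ 2 := by
  rw [← inner_self_eq_norm_sq (𝕜 := ℂ), ← real_inner_self_eq_norm_sq, ← real_inner_self_eq_norm_sq]
  rfl

theorem norm_re_le (v : HilbertC H) : ‖v.re‖ ≤ ‖v‖ :=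
  abs_le_of_sq_le_sq' (by rw [norm_sq]; nlinarith [sq_nonneg ‖v.im‖]) (norm_nonneg _) |>.2

theorem norm_im_le (v : HilbertC H) : ‖v.im‖ ≤ ‖v‖ :=
  abs_le_of_sq_le_sq' (by rw [norm_sq]; nlinarith [sq_nonneg ‖v.re‖]) (norm_nonneg _) |>.2

theorem re_real_smul (r : ℝ) (v : HilbertC H) : (r • v).re = r • v.re := by
  change ((r : ℂ) • v).re = _
  rw [re_smul]; simp

theorem im_real_smul (r : ℝ) (v : HilbertC H) : (r • v).im = r • v.im := by
  change ((r : ℂ) • v).im = _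
  rw [im_smul]; simp

/-- The real part, as a continuous real linear map. -/
noncomputable def reL : HilbertC H →L[ℝ] H :=
  LinearMap.mkContinuous
    { toFun := HilbertC.re
      map_add' := fun _ _ => rfl
      map_smul' := re_real_smul } 1 (fun v => (norm_re_le v).trans_eq (one_mul _).symm)

/-- The imaginary part, as a continuous real linear map. -/
noncomputable def imL : HilbertC H →L[ℝ] H :=
  LinearMap.mkContinuous
    { toFun := HilbertC.im
      map_add' := fun _ _ => rfl
      map_smul' := im_real_smul } 1 (fun v => (norm_im_le v).trans_eq (one_mul _).symm)

theorem norm_mk_zero (x : H) : ‖(⟨x, 0⟩ : HilbertC H)‖ = ‖x‖ := by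
  have h := norm_sq (⟨x, 0⟩ : HilbertC H)
  simp only [norm_zero, ne_eq, OfNat.ofNat_ne_zero, not_false_eq_true, zero_pow, add_zero] at h
  exact (sq_eq_sq₀ (norm_nonneg _) (norm_nonneg _)).1 h

/-- The inclusion of `H` in `H + iH`, as a continuous real linear map. -/
noncomputable def inclL : H →L[ℝ] HilbertC H :=
  LinearMap.mkContinuous
    { toFun := fun x => ⟨x, 0⟩
      map_add' := fun x y => by ext <;> simp
      map_smul' := fun r x => by
        ext <;> simp [re_real_smul, im_real_smul] } 1 (fun x => by simp [norm_mk_zero])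

@[simp] theorem reL_apply (v : HilbertC H) : reL v = v.re := rfl
@[simp] theorem imL_apply (v : HilbertC H) : imL v = v.im := rfl
@[simp] theorem inclL_re (x : H) : (inclL x).re = x := rfl
@[simp] theorem inclL_im (x : H) : (inclL x).im = 0 := rfl

instance [CompleteSpace H] : CompleteSpace (HilbertC H) := by
  apply Metric.complete_of_cauchySeq_tendsto
  intro s hs
  obtain ⟨a, ha⟩ := cauchySeq_tendsto_of_complete (reL.uniformContinuous.comp_cauchySeq hs)
  obtain ⟨b, hb⟩ := cauchySeq_tendsto_of_complete (imL.uniformContinuous.comp_cauchySeq hs)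
  refine ⟨inclL a + Complex.I • inclL b, ?_⟩
  have h1 := (inclL.continuous.tendsto a).comp ha
  have h2 := ((inclL.continuous.tendsto b).comp hb).const_smul Complex.I
  refine (h1.add h2).congr fun n => ?_
  ext <;> simp

end HilbertC

end HilbertComplexification

section OperatorComplexification

variable {H : Type*} [NormedAddCommGroup H] [InnerProductSpace ℝ H]

/-- The complex linear extension `v + iw ↦ T v + i T w` of a bounded operator on `H`
to `H + iH`. -/
noncomputable def extendOp (T : H →L[ℝ] H) : HilbertC H →L[ℂ] HilbertC H :=
  LinearMap.mkContinuous
    { toFun := fun v => ⟨T v.re, T v.im⟩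
      map_add' := fun v w => by ext <;> simp
      map_smul' := fun c v => by ext <;> simp } ‖T‖ (fun v => by
        apply le_of_sq_le_sq _ (by positivity)
        rw [mul_pow, HilbertC.norm_sq, HilbertC.norm_sq]
        have h1 := pow_le_pow_left₀ (norm_nonneg _) (T.le_opNorm v.re) 2
        have h2 := pow_le_pow_left₀ (norm_nonneg _) (T.le_opNorm v.im) 2
        simp only [LinearMap.coe_mk, AddHom.coe_mk]
        rw [mul_pow] at h1 h2
        linarith)

@[simp] theorem extendOp_re (T : H →L[ℝ] H) (v : HilbertC H) : (extendOp T v).re = T v.re := rfl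
@[simp] theorem extendOp_im (T : H →L[ℝ] H) (v : HilbertC H) : (extendOp T v).im = T v.im := rfl

/-- The operator `x + iy` on `H + iH`, for operators `x`, `y` on `H`. -/
noncomputable def combine (x y : H →L[ℝ] H) : HilbertC H →L[ℂ] HilbertC H :=
  extendOp x + Complex.I • extendOp y

@[simp] theorem combine_re (x y : H →L[ℝ] H) (v : HilbertC H) :
    (combine x y v).re = x v.re - y v.im := by
  simp [combine, sub_eq_add_neg]
@[simp] theorem combine_im (x y : H →L[ℝ] H) (v : HilbertC H) :
    (combine x y v).im = x v.im + y v.re := by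
  simp [combine]

/-- The operator `x`, when the argument is `x + iy`. -/
noncomputable def rePart (S : HilbertC H →L[ℂ] HilbertC H) : H →L[ℝ] H :=
  HilbertC.reL ∘L (S.restrictScalars ℝ) ∘L HilbertC.inclL

/-- The operator `y`, when the argument is `x + iy`. -/
noncomputable def imPart (S : HilbertC H →L[ℂ] HilbertC H) : H →L[ℝ] H :=
  HilbertC.imL ∘L (S.restrictScalars ℝ) ∘L HilbertC.inclL

@[simp] theorem rePart_combine (x y : H →L[ℝ] H) : rePart (combine x y) = x := by
  ext v; simp [rePart]
@[simp] theorem imPart_combine (x y : H →L[ℝ] H) : imPart (combine x y) = y := by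
  ext v; simp [imPart]

theorem combine_add (x y x' y' : H →L[ℝ] H) :
    combine x y + combine x' y' = combine (x + x') (y + y') := by
  ext v <;> simp <;> abel

theorem smul_combine (c : ℂ) (x y : H →L[ℝ] H) :
    c • combine x y = combine (c.re • x - c.im • y) (c.re • y + c.im • x) := by
  ext v <;> simp <;> module

theorem combine_one_zero : combine (1 : H →L[ℝ] H) 0 = 1 := by
  ext v <;> simp

theorem combine_eq_one_iff (x y : H →L[ℝ] H) : combine x y = 1 ↔ x = 1 ∧ y = 0 := by
  constructor
  · intro h
    rw [← combine_one_zero] at h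
    exact ⟨by simpa using congrArg rePart h, by simpa using congrArg imPart h⟩
  · rintro ⟨rfl, rfl⟩; exact combine_one_zero

theorem star_combine [CompleteSpace H] (x y : H →L[ℝ] H) :
    star (combine x y) = combine (star x) (-star y) := by
  rw [ContinuousLinearMap.star_eq_adjoint (combine x y)]
  symm
  rw [ContinuousLinearMap.eq_adjoint_iff]
  intro v w
  apply Complex.ext
  · simp [HilbertC.inner_re, inner_add_left, inner_add_right, inner_sub_right,
      ContinuousLinearMap.star_eq_adjoint, ContinuousLinearMap.adjoint_inner_left]
    ring
  · simp [HilbertC.inner_im, inner_add_left, inner_add_right, inner_sub_right,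
      ContinuousLinearMap.star_eq_adjoint, ContinuousLinearMap.adjoint_inner_left]
    ring

/-- The complexification `X + iX` of a space `X` of operators on `H`, as a space of operators on
`H + iH`. As `x + iy` acts on `H + iH = H ⊕ H` by the matrix with rows `(x, -y)` and `(y, x)`,
this is the canonical operator space complexification of `X`. -/
def complexifySpace (X : Submodule ℝ (H →L[ℝ] H)) :
    Submodule ℂ (HilbertC H →L[ℂ] HilbertC H) where
  carrier := {S | ∃ x ∈ X, ∃ y ∈ X, S = combine x y}
  add_mem' := by
    rintro _ _ ⟨x, hx, y, hy, rfl⟩ ⟨x', hx', y', hy', rfl⟩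
    exact ⟨_, X.add_mem hx hx', _, X.add_mem hy hy', combine_add _ _ _ _⟩
  zero_mem' := ⟨0, X.zero_mem, 0, X.zero_mem, by ext v <;> simp⟩
  smul_mem' := by
    rintro c _ ⟨x, hx, y, hy, rfl⟩
    exact ⟨_, X.sub_mem (X.smul_mem _ hx) (X.smul_mem _ hy), _,
      X.add_mem (X.smul_mem _ hy) (X.smul_mem _ hx), smul_combine _ _ _⟩

variable {X : Submodule ℝ (H →L[ℝ] H)}

/-- The element `x` of `X`, for the element `x + iy` of `X + iX`. -/
noncomputable def reX (s : complexifySpace X) : X :=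
  ⟨rePart (s : HilbertC H →L[ℂ] HilbertC H), by
    obtain ⟨_, x, hx, y, hy, rfl⟩ := s; simpa using hx⟩

/-- The element `y` of `X`, for the element `x + iy` of `X + iX`. -/
noncomputable def imX (s : complexifySpace X) : X :=
  ⟨imPart (s : HilbertC H →L[ℂ] HilbertC H), by
    obtain ⟨_, x, hx, y, hy, rfl⟩ := s; simpa using hy⟩

/-- The element `x + iy` of `X + iX`, for `x` and `y` in `X`. -/
noncomputable def mkX (x y : X) : complexifySpace X :=
  ⟨combine x y, x, x.2, y, y.2, rfl⟩

@[simp] theorem reX_mkX (x y : X) : reX (mkX x y) = x := Subtype.ext (rePart_combine _ _)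
@[simp] theorem imX_mkX (x y : X) : imX (mkX x y) = y := Subtype.ext (imPart_combine _ _)
@[simp] theorem mkX_eta (s : complexifySpace X) : mkX (reX s) (imX s) = s := by
  obtain ⟨_, x, hx, y, hy, rfl⟩ := s
  apply Subtype.ext
  simp [mkX, reX, imX]

theorem mkX_add (x y x' y' : X) : mkX x y + mkX x' y' = mkX (x + x') (y + y') :=
  Subtype.ext (combine_add _ _ _ _)

theorem smul_mkX (c : ℂ) (x y : X) :
    c • mkX x y = mkX (c.re • x - c.im • y) (c.re • y + c.im • x) :=
  Subtype.ext (smul_combine _ _ _)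

theorem coe_eq_combine (s : complexifySpace X) :
    (s : HilbertC H →L[ℂ] HilbertC H) = combine (reX s) (imX s) :=
  congrArg Subtype.val (mkX_eta s).symm

variable {K : Type*} [NormedAddCommGroup K] [InnerProductSpace ℝ K]
variable {Y : Submodule ℝ (K →L[ℝ] K)}

/-- The complexification `f_c (x + iy) = f x + i f y` of a map `f`. -/
noncomputable def complexifyFun (f : X → Y) (s : complexifySpace X) : complexifySpace Y :=
  mkX (f (reX s)) (f (imX s))

/-- The real matrix with blocks `x`, `-y` / `y`, `x`, for a matrix `x + iy` over `X + iX`. -/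
noncomputable def realBlocks {ι : Type*} (s : Matrix ι ι (complexifySpace X)) :
    Matrix (ι ⊕ ι) (ι ⊕ ι) X :=
  Matrix.fromBlocks (s.map reX) (-(s.map imX)) (s.map imX) (s.map reX)

theorem matOp_realBlocks {ι : Type*} [Fintype ι] (s : Matrix ι ι (complexifySpace X)) :
    ‖matOp s‖ = ‖matOp (realBlocks s)‖ ∧
      (MatPos s ↔ MatPos (realBlocks s)) := by
  let U : PiLp 2 (fun _ : ι => HilbertC H) → PiLp 2 (fun _ : ι ⊕ ι => H) := fun v =>
    WithLp.toLp 2 (Sum.elim (fun i => (v i).re) (fun i => (v i).im))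
  have hU : Function.Surjective U := fun w =>
    ⟨WithLp.toLp 2 fun i => ⟨w (Sum.inl i), w (Sum.inr i)⟩, by ext (i | i) <;> rfl⟩
  have hi : ∀ v w, RCLike.re (inner ℝ (U v) (U w)) = RCLike.re (inner ℂ v w) := by
    intro v w
    simp [U, PiLp.inner_apply, HilbertC.inner_re, Finset.sum_add_distrib]
  have hn : ∀ v, ‖U v‖ = ‖v‖ := by
    intro v
    have h := hi v v
    rw [inner_self_eq_norm_sq, inner_self_eq_norm_sq] at h
    exact (sq_eq_sq₀ (norm_nonneg _) (norm_nonneg _)).1 h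
  have reL_eq : ∀ w : HilbertC H, HilbertC.reL w = w.re := fun _ => rfl
  have h : ∀ v, U (matOp s v) = matOp (realBlocks s) (U v) := by
    intro v
    ext (i | i)
    · simp only [U, matOp_apply, Sum.elim_inl, Fintype.sum_sum_type, realBlocks,
        Matrix.fromBlocks_apply₁₁, Matrix.fromBlocks_apply₁₂, Matrix.map_apply, Sum.elim_inr,
        Matrix.neg_apply]
      rw [← HilbertC.reL_apply, map_sum, ← Finset.sum_add_distrib]
      refine Finset.sum_congr rfl fun j _ => ?_
      rw [coe_eq_combine]
      simp [sub_eq_add_neg]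
    · simp only [U, matOp_apply, Sum.elim_inl, Fintype.sum_sum_type, realBlocks,
        Matrix.fromBlocks_apply₂₁, Matrix.fromBlocks_apply₂₂, Matrix.map_apply, Sum.elim_inr]
      rw [← HilbertC.imL_apply, map_sum, ← Finset.sum_add_distrib]
      refine Finset.sum_congr rfl fun j _ => ?_
      rw [coe_eq_combine]
      simp [add_comm]
  exact ⟨opNorm_eq_of_intertwine _ _ U hU hn h, isPositive_iff_of_intertwine _ _ U hU hi h⟩

theorem realBlocks_map {ι : Type*} (f : X →+ Y) (s : Matrix ι ι (complexifySpace X)) :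
    realBlocks (s.map (complexifyFun f)) = (realBlocks s).map f := by
  ext (i | i) (j | j) : 2 <;> simp [realBlocks, complexifyFun]

/-- Matrices over `X + iX` of size `n` are, compatibly with norm, positivity and with maps,
matrices over `X` of size `n + n`. -/
theorem exists_real_matrix (n : ℕ) (s : Matrix (Fin n) (Fin n) (complexifySpace X)) :
    ∃ x : Matrix (Fin (n + n)) (Fin (n + n)) X,
      (‖matOp s‖ = ‖matOp x‖ ∧ (MatPos s ↔ MatPos x)) ∧
      ∀ f : X →+ Y, ‖matOp (s.map (complexifyFun f))‖ = ‖matOp (x.map f)‖ ∧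
        (MatPos (s.map (complexifyFun f)) ↔ MatPos (x.map f)) := by
  have key : ∀ {L : Type _} [NormedAddCommGroup L] [InnerProductSpace ℝ L]
      {Z : Submodule ℝ (L →L[ℝ] L)} (t : Matrix (Fin n) (Fin n) (complexifySpace Z)),
      ‖matOp t‖ = ‖matOp ((realBlocks t).submatrix finSumFinEquiv.symm finSumFinEquiv.symm)‖ ∧
      (MatPos t ↔
        MatPos ((realBlocks t).submatrix finSumFinEquiv.symm finSumFinEquiv.symm)) := by
    intro L _ _ Z t
    have h1 := matOp_realBlocks t
    have h2 := matOp_reindex finSumFinEquiv.symm (realBlocks t)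
    exact ⟨h1.1.trans h2.1.symm, h1.2.trans h2.2.symm⟩
  refine ⟨(realBlocks s).submatrix finSumFinEquiv.symm finSumFinEquiv.symm, ?_, fun f => ?_⟩
  · have h1 := matOp_realBlocks s
    have h2 := matOp_reindex finSumFinEquiv.symm (realBlocks s)
    exact ⟨h1.1.trans h2.1.symm, h1.2.trans h2.2.symm⟩
  · have h := key (s.map (complexifyFun f))
    rw [realBlocks_map] at h
    exact h

end OperatorComplexification

section Realification

attribute [local instance] InnerProductSpace.complexToReal

variable {H : Type*} [NormedAddCommGroup H] [InnerProductSpace ℂ H]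
variable {K : Type*} [NormedAddCommGroup K] [InnerProductSpace ℂ K]

/-- A complex space `X` of operators on a complex Hilbert space `H`, as a real space of operators
on the underlying real Hilbert space of `H` (with inner product `re ⟪v, w⟫`). -/
def realSpace (X : Submodule ℂ (H →L[ℂ] H)) : Submodule ℝ (H →L[ℝ] H) where
  carrier := {T | ∃ x ∈ X, T = x.restrictScalars ℝ}
  add_mem' := by
    rintro _ _ ⟨x, hx, rfl⟩ ⟨y, hy, rfl⟩
    exact ⟨x + y, X.add_mem hx hy, rfl⟩
  zero_mem' := ⟨0, X.zero_mem, rfl⟩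
  smul_mem' := by
    rintro r _ ⟨x, hx, rfl⟩
    exact ⟨(r : ℂ) • x, X.smul_mem _ hx, by ext v; simp⟩

variable {X : Submodule ℂ (H →L[ℂ] H)} {Y : Submodule ℂ (K →L[ℂ] K)}

/-- The identity map from `X` to `X` regarded as a real operator space. -/
noncomputable def realEquiv (X : Submodule ℂ (H →L[ℂ] H)) : X ≃+ realSpace X :=
  { Equiv.ofBijective
      (fun x : X => (⟨(x : H →L[ℂ] H).restrictScalars ℝ, x, x.2, rfl⟩ : realSpace X))
      ⟨fun x y h => by
        apply Subtype.ext
        ext v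
        exact DFunLike.congr_fun (congrArg Subtype.val h) v,
      fun ⟨_, x, hx, h⟩ => ⟨⟨x, hx⟩, Subtype.ext h.symm⟩⟩ with
    map_add' := fun _ _ => rfl }

theorem realEquiv_coe_apply (x : X) (v : H) :
    (realEquiv X x : H →L[ℝ] H) v = (x : H →L[ℂ] H) v := rfl

theorem realEquiv_symm_coe_apply (x : realSpace X) (v : H) :
    ((realEquiv X).symm x : H →L[ℂ] H) v = (x : H →L[ℝ] H) v := by
  rw [← realEquiv_coe_apply, AddEquiv.apply_symm_apply]

theorem realEquiv_smul (r : ℝ) (x : X) : realEquiv X ((r : ℂ) • x) = r • realEquiv X x := by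
  apply Subtype.ext
  ext v
  rw [realEquiv_coe_apply]
  simp [realEquiv_coe_apply]

theorem realEquiv_symm_smul (r : ℝ) (x : realSpace X) :
    (realEquiv X).symm (r • x) = (r : ℂ) • (realEquiv X).symm x := by
  rw [AddEquiv.symm_apply_eq, realEquiv_smul, AddEquiv.apply_symm_apply]

theorem star_restrictScalars [CompleteSpace H] (T : H →L[ℂ] H) :
    star (T.restrictScalars ℝ) = (star T).restrictScalars ℝ := by
  rw [ContinuousLinearMap.star_eq_adjoint (T.restrictScalars ℝ)]
  symm
  rw [ContinuousLinearMap.eq_adjoint_iff]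
  intro v w
  change (inner ℂ ((star T) v) w).re = (inner ℂ v (T w)).re
  rw [ContinuousLinearMap.star_eq_adjoint, ContinuousLinearMap.adjoint_inner_left]

theorem matOp_real {ι : Type*} [Fintype ι] (x : Matrix ι ι (realSpace X)) :
    ‖matOp x‖ = ‖matOp (x.map (realEquiv X).symm)‖ ∧
      (MatPos x ↔ MatPos (x.map (realEquiv X).symm)) := by
  have h : ∀ v, id (matOp x v) = matOp (x.map (realEquiv X).symm) (id v) := by
    intro v
    ext i
    simp only [id, matOp_apply, Matrix.map_apply, realEquiv_symm_coe_apply]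
  exact matOp_compare _ _ id Function.surjective_id (fun _ _ => rfl) h

/-- A map between complex spaces, regarded as a map between real spaces. -/
noncomputable def realFun (f : X →+ Y) : realSpace X →+ realSpace Y :=
  (realEquiv Y).toAddMonoidHom.comp (f.comp (realEquiv X).symm.toAddMonoidHom)

theorem realFun_apply (f : X →+ Y) (x : realSpace X) :
    realFun f x = realEquiv Y (f ((realEquiv X).symm x)) := rfl

theorem realFun_map {ι : Type*} (f : X →+ Y) (x : Matrix ι ι (realSpace X)) :
    (x.map (realFun f)).map (realEquiv Y).symm = (x.map (realEquiv X).symm).map f := by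
  ext i j : 2
  simp [realFun_apply]

end Realification

/-- The three kinds of spaces. -/
inductive OpKind
  /-- operator spaces -/
  | space
  /-- unital operator spaces -/
  | unital
  /-- operator systems -/
  | system

section Kinds

variable {𝔽 : Type*} [RCLike 𝔽]
variable {H : Type*} [NormedAddCommGroup H] [InnerProductSpace 𝔽 H]
variable {K : Type*} [NormedAddCommGroup K] [InnerProductSpace 𝔽 K]

/-- The maps used as morphisms: completely contractive maps of operator spaces, unital completely
contractive maps of unital operator spaces, unital completely positive maps of operator systems. -/
def IsMorphism (k : OpKind) {X : Submodule 𝔽 (H →L[𝔽] H)} {Y : Submodule 𝔽 (K →L[𝔽] K)}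
    (f : X → Y) : Prop :=
  match k with
  | .space => CompletelyContractive f
  | .unital => PreservesOne f ∧ CompletelyContractive f
  | .system => PreservesOne f ∧ CompletelyPositive f

/-- The maps by which groups act: complete isometries of operator spaces, unital complete
isometries of unital operator spaces, unital complete order isomorphisms of operator systems
(surjectivity is automatic for the elements of a group action). -/
def IsSymmetry (k : OpKind) {X : Submodule 𝔽 (H →L[𝔽] H)} (f : X → X) : Prop :=
  match k with
  | .space => CompletelyIsometric f
  | .unital => PreservesOne f ∧ CompletelyIsometric f
  | .system => PreservesOne f ∧ CompleteOrderEmbedding f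

theorem IsMorphism.id (k : OpKind) (X : Submodule 𝔽 (H →L[𝔽] H)) :
    IsMorphism k (fun x : X => x) := by
  cases k
  · exact fun _ _ => le_rfl
  · exact ⟨fun _ h => h, fun _ _ => le_rfl⟩
  · exact ⟨fun _ h => h, fun _ _ h => h⟩

theorem IsMorphism.comp {L : Type*} [NormedAddCommGroup L] [InnerProductSpace 𝔽 L] {k : OpKind}
    {X : Submodule 𝔽 (H →L[𝔽] H)} {Y : Submodule 𝔽 (K →L[𝔽] K)} {Z : Submodule 𝔽 (L →L[𝔽] L)}
    {f : X → Y} {g : Y → Z} (hg : IsMorphism k g) (hf : IsMorphism k f) :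
    IsMorphism k (fun x => g (f x)) := by
  cases k
  · exact fun n x => (hg n (x.map f)).trans (hf n x)
  · exact ⟨fun x h => hg.1 _ (hf.1 x h), fun n x => (hg.2 n (x.map f)).trans (hf.2 n x)⟩
  · exact ⟨fun x h => hg.1 _ (hf.1 x h), fun n x h => hg.2 n (x.map f) (hf.2 n x h)⟩

theorem IsSymmetry.id (k : OpKind) (X : Submodule 𝔽 (H →L[𝔽] H)) :
    IsSymmetry k (fun x : X => x) := by
  cases k
  · exact fun _ _ => rfl
  · exact ⟨fun _ h => h, fun _ _ => rfl⟩
  · exact ⟨fun _ h => h, fun _ _ => Iff.rfl⟩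

end Kinds

section Transfer

theorem PreservesOne.complexify {H K : Type*} [NormedAddCommGroup H] [InnerProductSpace ℝ H]
    [NormedAddCommGroup K] [InnerProductSpace ℝ K] {X : Submodule ℝ (H →L[ℝ] H)}
    {Y : Submodule ℝ (K →L[ℝ] K)} {f : X →+ Y} (hf : PreservesOne f) :
    PreservesOne (complexifyFun f) := by
  intro s hs
  rw [coe_eq_combine, combine_eq_one_iff] at hs
  change combine _ _ = 1
  rw [combine_eq_one_iff]
  refine ⟨hf _ hs.1, ?_⟩
  have : imX s = 0 := Subtype.ext hs.2
  rw [this, map_zero]; rfl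

theorem IsMorphism.complexify {H K : Type*} [NormedAddCommGroup H] [InnerProductSpace ℝ H]
    [NormedAddCommGroup K] [InnerProductSpace ℝ K] {k : OpKind} {X : Submodule ℝ (H →L[ℝ] H)}
    {Y : Submodule ℝ (K →L[ℝ] K)} {f : X →+ Y} (hf : IsMorphism k f) :
    IsMorphism k (complexifyFun f) := by
  have hc (h : CompletelyContractive f) : CompletelyContractive (complexifyFun f) := by
    intro n s
    obtain ⟨x, h1, h2⟩ := exists_real_matrix (Y := Y) n s
    rw [h1.1, (h2 f).1]; exact h _ _
  cases k
  · exact hc hf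
  · exact ⟨hf.1.complexify, hc hf.2⟩
  · refine ⟨hf.1.complexify, fun n s => ?_⟩
    obtain ⟨x, h1, h2⟩ := exists_real_matrix (Y := Y) n s
    rw [h1.2, (h2 f).2]; exact hf.2 _ _

theorem IsSymmetry.complexify {H : Type*} [NormedAddCommGroup H] [InnerProductSpace ℝ H]
    {k : OpKind} {X : Submodule ℝ (H →L[ℝ] H)} {f : X →+ X} (hf : IsSymmetry k f) :
    IsSymmetry k (complexifyFun f) := by
  have hc (h : CompletelyIsometric f) : CompletelyIsometric (complexifyFun f) := by
    intro n s
    obtain ⟨x, h1, h2⟩ := exists_real_matrix (Y := X) n s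
    rw [h1.1, (h2 f).1]; exact h _ _
  cases k
  · exact hc hf
  · exact ⟨hf.1.complexify, hc hf.2⟩
  · refine ⟨hf.1.complexify, fun n s => ?_⟩
    obtain ⟨x, h1, h2⟩ := exists_real_matrix (Y := X) n s
    rw [h1.2, (h2 f).2]; exact hf.2 _ _

attribute [local instance] InnerProductSpace.complexToReal

theorem PreservesOne.real {H K : Type*} [NormedAddCommGroup H] [InnerProductSpace ℂ H]
    [NormedAddCommGroup K] [InnerProductSpace ℂ K] {X : Submodule ℂ (H →L[ℂ] H)}
    {Y : Submodule ℂ (K →L[ℂ] K)} {f : X →+ Y} (hf : PreservesOne f) :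
    PreservesOne (realFun f) := by
  intro x hx
  have h1 : ((realEquiv X).symm x : H →L[ℂ] H) = 1 := by
    ext v
    rw [realEquiv_symm_coe_apply, hx]; rfl
  ext v
  rw [realFun_apply, realEquiv_coe_apply, hf _ h1]; rfl

theorem IsMorphism.real {H K : Type*} [NormedAddCommGroup H] [InnerProductSpace ℂ H]
    [NormedAddCommGroup K] [InnerProductSpace ℂ K] {k : OpKind} {X : Submodule ℂ (H →L[ℂ] H)}
    {Y : Submodule ℂ (K →L[ℂ] K)} {f : X →+ Y} (hf : IsMorphism k f) :
    IsMorphism k (realFun f) := by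
  have hc (h : CompletelyContractive f) : CompletelyContractive (realFun f) := by
    intro n x
    rw [(matOp_real x).1, (matOp_real _).1, realFun_map]; exact h _ _
  cases k
  · exact hc hf
  · exact ⟨hf.1.real, hc hf.2⟩
  · refine ⟨hf.1.real, fun n x => ?_⟩
    rw [(matOp_real x).2, (matOp_real _).2, realFun_map]; exact hf.2 _ _

theorem IsSymmetry.real {H : Type*} [NormedAddCommGroup H] [InnerProductSpace ℂ H]
    {k : OpKind} {X : Submodule ℂ (H →L[ℂ] H)} {f : X →+ X} (hf : IsSymmetry k f) :
    IsSymmetry k (realFun f) := by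
  have hc (h : CompletelyIsometric f) : CompletelyIsometric (realFun f) := by
    intro n x
    rw [(matOp_real x).1, (matOp_real _).1, realFun_map]; exact h _ _
  cases k
  · exact hc hf
  · exact ⟨hf.1.real, hc hf.2⟩
  · refine ⟨hf.1.real, fun n x => ?_⟩
    rw [(matOp_real x).2, (matOp_real _).2, realFun_map]; exact hf.2 _ _

end Transfer

section Categories

open CategoryTheory

/-- The objects of `OSp_(𝔽₁,𝔽₂)` (`k = .space`), `OSp^𝟙_(𝔽₁,𝔽₂)` (`k = .unital`) and
`OSy_(𝔽₁,𝔽₂)` (`k = .system`): subspaces of `B(H)` for a Hilbert space `H` over `𝔽₁`, which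
contain the identity if `k` is not `.space`, and are self-adjoint if `k` is `.system`. The field
`𝔽₂` only enters the definition of the morphisms. -/
structure OpCat (k : OpKind) (𝔽₁ 𝔽₂ : Type) [RCLike 𝔽₁] : Type (u + 1) where
  /-- the Hilbert space -/
  H : Type u
  [normed : NormedAddCommGroup H]
  [innerProd : InnerProductSpace 𝔽₁ H]
  [complete : CompleteSpace H]
  /-- the space of operators -/
  X : Submodule 𝔽₁ (H →L[𝔽₁] H)
  one_mem : k ≠ .space → (1 : H →L[𝔽₁] H) ∈ X
  star_mem : k = .system → ∀ x ∈ X, star x ∈ X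

attribute [instance] OpCat.normed OpCat.innerProd OpCat.complete

/-- The objects of `OSp^G_(𝔽₁,𝔽₂)`, `OSp^{𝟙,G}_(𝔽₁,𝔽₂)` and `OSy^G_(𝔽₁,𝔽₂)`: objects as above,
on which the group `G` acts by `𝔽₁`-linear complete isometries, unital complete isometries,
or unital complete order isomorphisms, respectively. -/
structure GOpCat (G : Type v) [Group G] (k : OpKind) (𝔽₁ 𝔽₂ : Type) [RCLike 𝔽₁] extends
    OpCat.{u} k 𝔽₁ 𝔽₂ where
  /-- the action -/
  ρ : Representation 𝔽₁ G X
  isSymmetry : ∀ g, IsSymmetry k (ρ g)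

variable {k : OpKind} {𝔽₁ 𝔽₂ : Type} [RCLike 𝔽₁] [Field 𝔽₂] [Algebra 𝔽₂ 𝔽₁]

/-- The morphisms: `𝔽₂`-linear maps that are completely contractive, unital completely contractive,
or unital completely positive, respectively. -/
@[ext]
structure OpHom (A B : OpCat.{u} k 𝔽₁ 𝔽₂) where
  /-- the underlying additive map -/
  hom : A.X →+ B.X
  map_smul : ∀ (c : 𝔽₂) (x : A.X), hom (algebraMap 𝔽₂ 𝔽₁ c • x) = algebraMap 𝔽₂ 𝔽₁ c • hom x
  isMorphism : IsMorphism k hom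

instance : Category (OpCat.{u} k 𝔽₁ 𝔽₂) where
  Hom A B := OpHom A B
  id A := ⟨AddMonoidHom.id A.X, fun _ _ => rfl, IsMorphism.id k A.X⟩
  comp f g := ⟨g.hom.comp f.hom, fun c x =>
    (congrArg g.hom (f.map_smul c x)).trans (g.map_smul c (f.hom x)),
    g.isMorphism.comp f.isMorphism⟩

variable {G : Type v} [Group G]

/-- The morphisms of the `G`-categories: morphisms as above that are `G`-equivariant. -/
@[ext]
structure GOpHom (A B : GOpCat.{u} G k 𝔽₁ 𝔽₂) extends OpHom A.toOpCat B.toOpCat where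
  equivariant : ∀ (g : G) (x : A.X), hom (A.ρ g x) = B.ρ g (hom x)

instance : Category (GOpCat.{u} G k 𝔽₁ 𝔽₂) where
  Hom A B := GOpHom A B
  id A := ⟨⟨AddMonoidHom.id A.X, fun _ _ => rfl, IsMorphism.id k A.X⟩, fun _ _ => rfl⟩
  comp f g := ⟨⟨g.hom.comp f.hom, fun c x =>
    (congrArg g.hom (f.map_smul c x)).trans (g.map_smul c (f.hom x)),
    g.isMorphism.comp f.isMorphism⟩, fun a x =>
    (congrArg g.hom (f.equivariant a x)).trans (g.equivariant a (f.hom x))⟩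

/-- An object with the trivial action of `G`. -/
def OpCat.trivialAction (G : Type v) [Group G] (A : OpCat.{u} k 𝔽₁ 𝔽₂) :
    GOpCat.{u} G k 𝔽₁ 𝔽₂ where
  toOpCat := A
  ρ := Representation.trivial 𝔽₁ G A.X
  isSymmetry _ := IsSymmetry.id k A.X

end Categories

section ComplexifyFunctor

open CategoryTheory

section Maps

variable {H K : Type*} [NormedAddCommGroup H] [InnerProductSpace ℝ H]
  [NormedAddCommGroup K] [InnerProductSpace ℝ K]
  {X : Submodule ℝ (H →L[ℝ] H)} {Y : Submodule ℝ (K →L[ℝ] K)}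

theorem reX_add (s t : complexifySpace X) : reX (s + t) = reX s + reX t := by
  conv_lhs => rw [← mkX_eta s, ← mkX_eta t, mkX_add, reX_mkX]

theorem imX_add (s t : complexifySpace X) : imX (s + t) = imX s + imX t := by
  conv_lhs => rw [← mkX_eta s, ← mkX_eta t, mkX_add, imX_mkX]

theorem reX_smul (c : ℂ) (s : complexifySpace X) :
    reX (c • s) = c.re • reX s - c.im • imX s := by
  conv_lhs => rw [← mkX_eta s, smul_mkX, reX_mkX]

theorem imX_smul (c : ℂ) (s : complexifySpace X) :
    imX (c • s) = c.re • imX s + c.im • reX s := by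
  conv_lhs => rw [← mkX_eta s, smul_mkX, imX_mkX]

theorem complexifyFun_comp {L : Type*} [NormedAddCommGroup L] [InnerProductSpace ℝ L]
    {Z : Submodule ℝ (L →L[ℝ] L)} (g : Y → Z) (f : X → Y) (s : complexifySpace X) :
    complexifyFun (fun x => g (f x)) s = complexifyFun g (complexifyFun f s) := by
  simp only [complexifyFun, reX_mkX, imX_mkX]

/-- The complexification `x + iy ↦ f x + i f y` of an additive map. -/
noncomputable def complexifyAdd (f : X →+ Y) : complexifySpace X →+ complexifySpace Y :=
  AddMonoidHom.mk' (complexifyFun f) fun s t => by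
    simp only [complexifyFun, reX_add, imX_add, map_add, mkX_add]

theorem complexifyAdd_apply (f : X →+ Y) (s : complexifySpace X) :
    complexifyAdd f s = mkX (f (reX s)) (f (imX s)) := rfl

theorem complexifyAdd_smul (f : X →+ Y) (hf : ∀ (r : ℝ) (x : X), f (r • x) = r • f x) (c : ℂ)
    (s : complexifySpace X) : complexifyAdd f (c • s) = c • complexifyAdd f s := by
  simp only [complexifyAdd_apply, reX_smul, imX_smul, map_sub, map_add, hf, smul_mkX]

/-- The complexification `x + iy ↦ f x + i f y` of a linear map. -/
noncomputable def complexifyLin (f : X →ₗ[ℝ] Y) : complexifySpace X →ₗ[ℂ] complexifySpace Y where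
  toFun := complexifyAdd f.toAddMonoidHom
  map_add' := (complexifyAdd f.toAddMonoidHom).map_add
  map_smul' := complexifyAdd_smul f.toAddMonoidHom f.map_smul

end Maps

variable {k : OpKind}

/-- The complexification `X + iX` of a real object `X`. -/
noncomputable def OpCat.complexify (A : OpCat.{u} k ℝ ℝ) : OpCat.{u} k ℂ ℂ where
  H := HilbertC A.H
  X := complexifySpace A.X
  one_mem h := ⟨1, A.one_mem h, 0, A.X.zero_mem, combine_one_zero.symm⟩
  star_mem h := by
    rintro _ ⟨x, hx, y, hy, rfl⟩
    exact ⟨_, A.star_mem h x hx, _, A.X.neg_mem (A.star_mem h y hy), star_combine x y⟩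

/-- The complexification `f_c (x + iy) = f x + i f y` of a morphism `f`. -/
noncomputable def OpHom.complexify {A B : OpCat.{u} k ℝ ℝ} (f : OpHom A B) :
    OpHom A.complexify B.complexify where
  hom := complexifyAdd f.hom
  map_smul := complexifyAdd_smul f.hom f.map_smul
  isMorphism := f.isMorphism.complexify

/-- The complexification functor from the real to the complex category (of the given kind). -/
noncomputable def complexification (k : OpKind) : OpCat.{u} k ℝ ℝ ⥤ OpCat.{u} k ℂ ℂ where
  obj A := A.complexify
  map f := OpHom.complexify f
  map_id A := by
    apply OpHom.ext
    ext s : 1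
    exact mkX_eta s
  map_comp f g := by
    apply OpHom.ext
    ext s : 1
    exact complexifyFun_comp g.hom f.hom s

variable {G : Type v} [Group G]

/-- The complexification `X + iX` of a real `G`-object `X`, with `g (x + iy) = gx + i gy`. -/
noncomputable def GOpCat.complexify (A : GOpCat.{u} G k ℝ ℝ) : GOpCat.{u} G k ℂ ℂ where
  toOpCat := A.toOpCat.complexify
  ρ :=
    { toFun := fun g => complexifyLin (A.ρ g)
      map_one' := by
        ext s : 1
        rw [map_one]
        exact mkX_eta s
      map_mul' := fun g h => by
        ext s : 1
        rw [map_mul]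
        exact complexifyFun_comp (A.ρ g) (A.ρ h) s }
  isSymmetry g := (A.isSymmetry g).complexify (f := (A.ρ g).toAddMonoidHom)

/-- The complexification functor from the real to the complex `G`-category
(of the given kind). -/
noncomputable def complexificationG (G : Type v) [Group G] (k : OpKind) :
    GOpCat.{u} G k ℝ ℝ ⥤ GOpCat.{u} G k ℂ ℂ where
  obj A := A.complexify
  map {A B} f := ⟨f.toOpHom.complexify, fun g s =>
    (complexifyFun_comp f.hom (A.ρ g) s).symm.trans <|
      (congrArg (fun F => complexifyFun F s) (funext (f.equivariant g))).trans
        (complexifyFun_comp (B.ρ g) f.hom s)⟩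
  map_id A := by
    apply GOpHom.ext
    ext s : 1
    exact mkX_eta s
  map_comp f g := by
    apply GOpHom.ext
    ext s : 1
    exact complexifyFun_comp g.hom f.hom s

end ComplexifyFunctor

section ForgetfulFunctors

open CategoryTheory

section Maps

variable {H : Type*} [NormedAddCommGroup H] [InnerProductSpace ℂ H]
  {K : Type*} [NormedAddCommGroup K] [InnerProductSpace ℂ K]
  {L : Type*} [NormedAddCommGroup L] [InnerProductSpace ℂ L]
  {X : Submodule ℂ (H →L[ℂ] H)} {Y : Submodule ℂ (K →L[ℂ] K)} {Z : Submodule ℂ (L →L[ℂ] L)}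

theorem realFun_smul (f : X →+ Y) (hf : ∀ (r : ℝ) (x : X), f ((r : ℂ) • x) = (r : ℂ) • f x)
    (r : ℝ) (x : realSpace X) : realFun f (r • x) = r • realFun f x := by
  rw [realFun_apply, realFun_apply, realEquiv_symm_smul, hf, realEquiv_smul]

theorem realFun_id (x : realSpace X) : realFun (AddMonoidHom.id X) x = x :=
  (realEquiv X).apply_symm_apply x

theorem realFun_comp (g : Y →+ Z) (f : X →+ Y) (x : realSpace X) :
    realFun (g.comp f) x = realFun g (realFun f x) := by
  simp only [realFun_apply, AddEquiv.symm_apply_apply, AddMonoidHom.comp_apply]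

/-- A complex linear map, regarded as a real linear map between real spaces. -/
noncomputable def realLin (f : X →ₗ[ℂ] Y) : realSpace X →ₗ[ℝ] realSpace Y where
  toFun := realFun f.toAddMonoidHom
  map_add' := (realFun f.toAddMonoidHom).map_add
  map_smul' := realFun_smul f.toAddMonoidHom fun r x => f.map_smul (r : ℂ) x

end Maps

variable {k : OpKind} {𝔽 : Type} [Field 𝔽] [Algebra 𝔽 ℂ]

/-- A complex object, regarded as a real object: the Hilbert space is regarded as a real Hilbert
space, and the space of operators is regarded as a real space of operators on it. -/
noncomputable def OpCat.toReal (A : OpCat.{u} k ℂ 𝔽) : OpCat.{u} k ℝ ℝ where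
  H := A.H
  innerProd := InnerProductSpace.complexToReal
  X := realSpace A.X
  one_mem h := ⟨1, A.one_mem h, rfl⟩
  star_mem := by
    rintro h _ ⟨x, hx, rfl⟩
    exact ⟨star x, A.star_mem h x hx, star_restrictScalars x⟩

variable [Algebra ℝ 𝔽] [IsScalarTower ℝ 𝔽 ℂ]

/-- A morphism between complex objects, regarded as a morphism between real objects. -/
noncomputable def OpHom.toReal {A B : OpCat.{u} k ℂ 𝔽} (f : OpHom A B) :
    OpHom A.toReal B.toReal where
  hom := (realFun f.hom : realSpace A.X →+ realSpace B.X)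
  map_smul := realFun_smul f.hom fun r x => by
    have h := f.map_smul (algebraMap ℝ 𝔽 r) x
    rw [← IsScalarTower.algebraMap_apply] at h
    exact h
  isMorphism := f.isMorphism.real

/-- The forgetful functor from the complex (`𝔽 = ℂ`) or the intermediate (`𝔽 = ℝ`) category to the
real category (of the given kind). -/
noncomputable def forgetToReal (k : OpKind) (𝔽 : Type) [Field 𝔽] [Algebra 𝔽 ℂ] [Algebra ℝ 𝔽]
    [IsScalarTower ℝ 𝔽 ℂ] : OpCat.{u} k ℂ 𝔽 ⥤ OpCat.{u} k ℝ ℝ where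
  obj A := A.toReal
  map f := OpHom.toReal f
  map_id A := by
    apply OpHom.ext
    ext x : 1
    exact realFun_id (X := A.X) x
  map_comp {A B C} f g := by
    apply OpHom.ext
    ext x : 1
    exact realFun_comp (X := A.X) (Y := B.X) (Z := C.X) g.hom f.hom x

/-- The complexification functor from the intermediate to the complex category (of the given
kind): a complex space is regarded as a real space, and then complexified. -/
noncomputable def intermediateComplexification (k : OpKind) :
    OpCat.{u} k ℂ ℝ ⥤ OpCat.{u} k ℂ ℂ :=
  forgetToReal k ℝ ⋙ complexification k

variable {G : Type v} [Group G]

/-- A complex `G`-object, regarded as a real `G`-object. -/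
noncomputable def GOpCat.toReal (A : GOpCat.{u} G k ℂ 𝔽) : GOpCat.{u} G k ℝ ℝ where
  toOpCat := A.toOpCat.toReal
  ρ :=
    { toFun := fun g => (realLin (A.ρ g) : realSpace A.X →ₗ[ℝ] realSpace A.X)
      map_one' := by
        ext x : 1
        rw [map_one]
        exact realFun_id (X := A.X) x
      map_mul' := fun g h => by
        ext x : 1
        rw [map_mul]
        exact realFun_comp (X := A.X) (Y := A.X) (Z := A.X) (A.ρ g).toAddMonoidHom
          (A.ρ h).toAddMonoidHom x }
  isSymmetry g := (A.isSymmetry g).real (f := (A.ρ g).toAddMonoidHom)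

/-- The forgetful functor from the complex (`𝔽 = ℂ`) or the intermediate (`𝔽 = ℝ`) `G`-category to
the real `G`-category (of the given kind). -/
noncomputable def forgetToRealG (G : Type v) [Group G] (k : OpKind) (𝔽 : Type) [Field 𝔽]
    [Algebra 𝔽 ℂ] [Algebra ℝ 𝔽] [IsScalarTower ℝ 𝔽 ℂ] :
    GOpCat.{u} G k ℂ 𝔽 ⥤ GOpCat.{u} G k ℝ ℝ where
  obj A := A.toReal
  map {A B} f := ⟨f.toOpHom.toReal, fun g x =>
    (realFun_comp (X := A.X) (Y := A.X) (Z := B.X) f.hom (A.ρ g).toAddMonoidHom x).symm.trans <|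
      (congrArg (realEquiv B.X) (f.equivariant g _)).trans
        (realFun_comp (X := A.X) (Y := B.X) (Z := B.X) (B.ρ g).toAddMonoidHom f.hom x)⟩
  map_id A := by
    apply GOpHom.ext
    ext x : 1
    exact realFun_id (X := A.X) x
  map_comp {A B C} f g := by
    apply GOpHom.ext
    ext x : 1
    exact realFun_comp (X := A.X) (Y := B.X) (Z := C.X) g.hom f.hom x

/-- The complexification functor from the intermediate to the complex `G`-category (of the given
kind): a complex space is regarded as a real space, and then complexified. -/
noncomputable def intermediateComplexificationG (G : Type v) [Group G] (k : OpKind) :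
    GOpCat.{u} G k ℂ ℝ ⥤ GOpCat.{u} G k ℂ ℂ :=
  forgetToRealG G k ℝ ⋙ complexificationG G k

section Unit

variable {𝔽₁ 𝔽₂ : Type} [RCLike 𝔽₁] [Field 𝔽₂] [Algebra 𝔽₂ 𝔽₁]

/-- A unital operator space, regarded as an operator space. -/
def OpCat.toSpace (A : OpCat.{u} .unital 𝔽₁ 𝔽₂) : OpCat.{u} .space 𝔽₁ 𝔽₂ where
  H := A.H
  X := A.X
  one_mem h := absurd rfl h
  star_mem := nofun

/-- A unital completely contractive map, regarded as a completely contractive map. -/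
def OpHom.toSpace {A B : OpCat.{u} .unital 𝔽₁ 𝔽₂} (f : OpHom A B) :
    OpHom A.toSpace B.toSpace where
  hom := (f.hom : A.X →+ B.X)
  map_smul := f.map_smul
  isMorphism := f.isMorphism.2

/-- A unital `G`-operator space, regarded as a `G`-operator space. -/
def GOpCat.toSpace {G : Type v} [Group G] (A : GOpCat.{u} G .unital 𝔽₁ 𝔽₂) :
    GOpCat.{u} G .space 𝔽₁ 𝔽₂ where
  toOpCat := A.toOpCat.toSpace
  ρ := (A.ρ : Representation 𝔽₁ G A.X)
  isSymmetry g := (A.isSymmetry g).2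

variable (𝔽₁ 𝔽₂)

/-- The forgetful functor from unital operator spaces to operator spaces. -/
def forgetUnit : OpCat.{u} .unital 𝔽₁ 𝔽₂ ⥤ OpCat.{u} .space 𝔽₁ 𝔽₂ where
  obj A := A.toSpace
  map f := OpHom.toSpace f
  map_id _ := rfl
  map_comp _ _ := rfl

/-- The forgetful functor from unital `G`-operator spaces to `G`-operator spaces. -/
def forgetUnitG (G : Type v) [Group G] :
    GOpCat.{u} G .unital 𝔽₁ 𝔽₂ ⥤ GOpCat.{u} G .space 𝔽₁ 𝔽₂ where
  obj A := A.toSpace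
  map f := ⟨OpHom.toSpace f.toOpHom, f.equivariant⟩
  map_id _ := rfl
  map_comp _ _ := rfl

end Unit

end ForgetfulFunctors

section Quaternions

open scoped Quaternion

/-- Left multiplication by a quaternion, on the real Hilbert space of quaternions (regarded as a
direct sum with one summand, in order to have one such space in each universe). -/
noncomputable def quaternionOp :
    ℍ[ℝ] →ₗ[ℝ] (PiLp 2 (fun _ : PUnit.{u + 1} => ℍ[ℝ]) →L[ℝ]
      PiLp 2 (fun _ : PUnit.{u + 1} => ℍ[ℝ])) where
  toFun a := blockOp (Matrix.of fun _ _ => ContinuousLinearMap.mul ℝ ℍ[ℝ] a)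
  map_add' a b := by
    ext v i : 2
    rw [add_apply, PiLp.add_apply, blockOp_apply, blockOp_apply, blockOp_apply]
    simp
  map_smul' r a := by
    ext v i : 2
    rw [smul_apply, PiLp.smul_apply, blockOp_apply, blockOp_apply]
    simp

theorem quaternionOp_apply (a : ℍ[ℝ]) (v : PiLp 2 (fun _ : PUnit.{u + 1} => ℍ[ℝ]))
    (i : PUnit.{u + 1}) : quaternionOp a v i = a * v i := by
  change blockOp _ v i = _
  rw [blockOp_apply]
  simp

/-- The algebra of quaternions, as a real operator system (and so as a real unital operator space
and as a real operator space), acting on itself by left multiplication. -/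
noncomputable def quaternionSpace (k : OpKind) : OpCat.{u} k ℝ ℝ where
  H := PiLp 2 (fun _ : PUnit.{u + 1} => ℍ[ℝ])
  X := LinearMap.range quaternionOp
  one_mem _ := ⟨1, by ext v i : 2; simp [quaternionOp_apply]⟩
  star_mem := by
    rintro - _ ⟨a, rfl⟩
    refine ⟨star a, ?_⟩
    rw [ContinuousLinearMap.star_eq_adjoint, ContinuousLinearMap.eq_adjoint_iff]
    intro v w
    simp only [PiLp.inner_apply, quaternionOp_apply, Quaternion.inner_def]
    simp [Quaternion.re_mul]
    ring

end Quaternions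

end OpSp

/-! Faithfulness is clear, since `T` is recovered from `T_c` on elements `x + i0`. Each negative
claim needs one example. In the `G`-categories it carries the trivial action, and an isomorphism of
`G`-objects is in particular one of the underlying objects. Unital completely positive maps are
completely contractive, so norm arguments serve all three kinds.

Not full. The complexification of ℂ, regarded as a real space, is ℂ ⊕ ℂ, with characters `x + iy`
and `x̄ + iȳ` computed in ℂ. If `χ` is the first one, then `s ↦ χ(s) 1` is a morphism of every kind,
being restriction to a space of eigenvectors (`IsMorphism.of_intertwine`). It maps the real element
`i` to an element with nonzero imaginary part, so it is no `T_c`.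

Not essentially surjective. A complexification carries the conjugation `x + iy ↦ x - iy`, so an
object isomorphic to one has a conjugate linear isometric involution `θ`, which for systems is
unital and completely positive (`exists_conjugation`). For spaces and unital spaces, take the span
of `1` and `z` in the functions on four points of ℂ. As every point is a strict peak point, `θ`
permutes the evaluations up to scalars. This gives a Möbius map between the points, permuted, and
their conjugates, which the cross-ratio excludes (`no_affine_conjugation`). For systems the adjoint
is always a unital positive conjugate linear involution, so matrices must enter. Take the span of
`1, h₁, h₂, h₃`, where `hᵢ` is the direct sum of the `i`-th coordinate on the vertices of an
octahedron and of the Pauli matrix `σᵢ`. The octahedron contains the unit ball, so it alone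
determines the positive elements. It has no symmetry of order two, so `θ` is the adjoint. But the
entrywise adjoint takes the positive matrix `5 + 2 ∑ σᵢᵀ ⊗ hᵢ` to `5 + 2 ∑ σᵢ ⊗ hᵢ`, which is not
positive.

Quaternions. In a complex space, conjugating 2 × 2 matrices by the unitary `diag(1, i)` preserves
norms. For unit quaternions, `[1, b; c, d]` has norm 2 only if `d = cb`. So multiplication by `i`,
transported to ℍ as `J`, satisfies `(Jc)(-Jb) = cb`, which is impossible
(`no_complex_structure_quaternion`).

Units. In a unital space a contractive row `(1, x)` has `x = 0`, whereas in the two-dimensional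
column space every vector of norm at most 1 is completed to a contractive row by an orthogonal
vector of equal norm. -/

namespace OpSp

open scoped InnerProductSpace
open CategoryTheory

/-! ### Matrix norms and positivity; unital completely positive maps are completely contractive. -/

section Matrices

variable {𝔽 : Type*} [RCLike 𝔽]
variable {H : Type*} [NormedAddCommGroup H] [InnerProductSpace 𝔽 H]
variable {K : Type*} [NormedAddCommGroup K] [InnerProductSpace 𝔽 K]
variable {X : Submodule 𝔽 (H →L[𝔽] H)} {Y : Submodule 𝔽 (K →L[𝔽] K)}

/-- A matrix of size one is normed and ordered as its entry. -/
theorem matOp_one_by_one (x : X) :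
    ‖matOp (Matrix.of fun _ _ : Fin 1 => x)‖ = ‖(x : H →L[𝔽] H)‖ ∧
      (MatPos (Matrix.of fun _ _ : Fin 1 => x) ↔ (x : H →L[𝔽] H).IsPositive) := by
  let U : PiLp 2 (fun _ : Fin 1 => H) → H := fun v => v 0
  have hU : Function.Surjective U := fun w => ⟨WithLp.toLp 2 fun _ => w, rfl⟩
  have hi : ∀ v w, RCLike.re ⟪U v, U w⟫_𝔽 = RCLike.re ⟪v, w⟫_𝔽 := by
    intro v w
    simp [U, PiLp.inner_apply]
  have hn : ∀ v, ‖U v‖ = ‖v‖ := by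
    intro v
    have h := hi v v
    rw [inner_self_eq_norm_sq, inner_self_eq_norm_sq] at h
    exact (sq_eq_sq₀ (norm_nonneg _) (norm_nonneg _)).1 h
  have h : ∀ v, U (matOp (Matrix.of fun _ _ : Fin 1 => x) v) = (x : H →L[𝔽] H) (U v) := by
    intro v
    simp [U, matOp_apply]
  exact ⟨opNorm_eq_of_intertwine _ _ U hU hn h, isPositive_iff_of_intertwine _ _ U hU hi h⟩

/-- If an isometry `V` satisfies `V f(x) = x V` for all `x`, then `f` is a morphism of each kind. -/
theorem IsMorphism.of_intertwine (k : OpKind) (f : X → Y) (V : K →ₗᵢ[𝔽] H)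
    (h : ∀ x w, V ((f x : K →L[𝔽] K) w) = (x : H →L[𝔽] H) (V w)) : IsMorphism k f := by
  -- In every size the direct sum of copies of `V` identifies `[f(x_ij)]` with the restriction of
  -- `[x_ij]` to an invariant subspace, so norms do not grow and positivity is inherited.
  let W (n : ℕ) : PiLp 2 (fun _ : Fin n => K) → PiLp 2 (fun _ : Fin n => H) :=
    fun w => WithLp.toLp 2 fun i => V (w i)
  have hi : ∀ n (v w : PiLp 2 (fun _ : Fin n => K)), ⟪W n v, W n w⟫_𝔽 = ⟪v, w⟫_𝔽 := by
    intro n v w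
    simp [W, PiLp.inner_apply]
  have hn : ∀ n (v : PiLp 2 (fun _ : Fin n => K)), ‖W n v‖ = ‖v‖ := by
    intro n v
    have h := congrArg RCLike.re (hi n v v)
    rw [inner_self_eq_norm_sq, inner_self_eq_norm_sq] at h
    exact (sq_eq_sq₀ (norm_nonneg _) (norm_nonneg _)).1 h
  have hW : ∀ n (x : Matrix (Fin n) (Fin n) X) v, W n (matOp (x.map f) v) = matOp x (W n v) := by
    intro n x v
    ext i
    simp [W, matOp_apply, h]
  have hc : CompletelyContractive f := by
    intro n x
    refine ContinuousLinearMap.opNorm_le_bound _ (norm_nonneg _) fun v => ?_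
    rw [← hn, hW, ← hn n v]
    exact (matOp x).le_opNorm _
  have h1 : PreservesOne f := by
    intro x hx
    ext w
    apply V.injective
    rw [h, hx]
    rfl
  cases k
  · exact hc
  · exact ⟨h1, hc⟩
  · refine ⟨h1, fun n x hx => ?_⟩
    unfold MatPos at *
    rw [isPositive_iff_re] at *
    refine ⟨fun v w => ?_, fun v => ?_⟩
    · rw [← hi, ← hi, hW, hW, hx.1]
    · rw [← hi, hW]; exact hx.2 _

/-- The vector of `Eⁿ ⊕ Eⁿ` with components `a` and `b`. -/
def sumVec {E ι : Type*} (a b : PiLp 2 (fun _ : ι => E)) : PiLp 2 (fun _ : ι ⊕ ι => E) :=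
  WithLp.toLp 2 (Sum.elim a b)

theorem exists_eq_sumVec {E ι : Type*} (v : PiLp 2 (fun _ : ι ⊕ ι => E)) :
    ∃ a b, v = sumVec a b :=
  ⟨WithLp.toLp 2 fun i => v (Sum.inl i), WithLp.toLp 2 fun i => v (Sum.inr i), by
    ext (i | i) <;> rfl⟩

theorem inner_matOp_fromBlocks {ι : Type*} [Fintype ι] [DecidableEq ι] {t : ℝ} (e : X)
    (he : (e : H →L[𝔽] H) = (t : 𝔽) • 1) (x y : Matrix ι ι X)
    (a b c d : PiLp 2 (fun _ : ι => H)) :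
    ⟪matOp (Matrix.fromBlocks (Matrix.diagonal fun _ => e) x y (Matrix.diagonal fun _ => e))
      (sumVec a b), sumVec c d⟫_𝔽 =
    t * ⟪a, c⟫_𝔽 + ⟪matOp x b, c⟫_𝔽 + ⟪matOp y a, d⟫_𝔽 + t * ⟪b, d⟫_𝔽 := by
  have hd : ∀ (w : PiLp 2 (fun _ : ι => H)) i,
      ∑ j, ((Matrix.diagonal (fun _ => e) : Matrix ι ι X) i j : H →L[𝔽] H) (w j) =
        (t : 𝔽) • w i := by
    intro w i
    rw [Finset.sum_eq_single i]
    · simp [he]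
    · intro j _ hj
      rw [Matrix.diagonal_apply_ne _ hj.symm]; rfl
    · simp
  simp only [PiLp.inner_apply, Fintype.sum_sum_type, matOp_apply, Matrix.fromBlocks_apply₁₁,
    Matrix.fromBlocks_apply₁₂, Matrix.fromBlocks_apply₂₁, Matrix.fromBlocks_apply₂₂, sumVec,
    Sum.elim_inl, Sum.elim_inr, hd, inner_add_left, inner_smul_left, RCLike.conj_ofReal,
    Finset.sum_add_distrib, Finset.mul_sum]
  ring

/-- The operator `x` has norm at most `t` if the block matrix with rows `(t, x)`, `(y, t)` is
positive. -/
theorem norm_matOp_le_of_matPos {ι : Type*} [Fintype ι] [DecidableEq ι] {t : ℝ} (ht : 0 ≤ t)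
    (e : X) (he : (e : H →L[𝔽] H) = (t : 𝔽) • 1) (x y : Matrix ι ι X)
    (h : MatPos (Matrix.fromBlocks (Matrix.diagonal fun _ => e) x y
      (Matrix.diagonal fun _ => e))) : ‖matOp x‖ ≤ t := by
  obtain ⟨h1, h2⟩ := h
  -- Self-adjointness of the block matrix forces `y = x*`.
  have hadj : ∀ a b, ⟪matOp y a, b⟫_𝔽 = ⟪a, matOp x b⟫_𝔽 := by
    intro a b
    have h := h1 (sumVec a 0) (sumVec 0 b)
    rw [ContinuousLinearMap.coe_coe] at h
    rw [inner_matOp_fromBlocks e he, ← inner_conj_symm (sumVec a 0),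
      inner_matOp_fromBlocks e he] at h
    simpa using h
  refine ContinuousLinearMap.opNorm_le_bound _ ht fun b => ?_
  set p := matOp x b with hp
  -- Positivity at the vector `(-s p, b)`. Taking `s = 1/t` gives `‖p‖ ≤ t ‖b‖`; for `t = 0` any
  -- positive `s` gives `p = 0`.
  have key : ∀ s : ℝ, 0 ≤ t * (s ^ 2 * ‖p‖ ^ 2) - 2 * s * ‖p‖ ^ 2 + t * ‖b‖ ^ 2 := by
    intro s
    have h := h2 (sumVec (-(s : 𝔽) • p) b)
    rw [ContinuousLinearMap.reApplyInnerSelf_apply, inner_matOp_fromBlocks e he, hadj, ← hp] at h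
    simp only [map_add, inner_smul_left, inner_smul_right, inner_self_eq_norm_sq_to_K, map_neg,
      RCLike.conj_ofReal] at h
    norm_cast at h
    rw [norm_smul, RCLike.norm_ofReal, mul_pow, sq_abs] at h
    linarith
  rcases ht.eq_or_lt with rfl | ht
  · have := key 1
    have h0 : ‖p‖ = 0 := by nlinarith [norm_nonneg p]
    simp [h0]
  · have := key t⁻¹
    have h3 : t * (t⁻¹ ^ 2 * ‖p‖ ^ 2) = t⁻¹ * ‖p‖ ^ 2 := by field_simp
    rw [h3] at this
    have h4 : t * (t⁻¹ * ‖p‖ ^ 2) = ‖p‖ ^ 2 := by field_simp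
    apply le_of_sq_le_sq _ (by positivity)
    nlinarith [mul_nonneg ht.le this]

/-- If `‖x‖ ≤ t` then the block matrix with rows `(t, x)`, `(x*, t)` is positive. -/
theorem matPos_of_norm_matOp_le [CompleteSpace H] {ι : Type*} [Fintype ι] [DecidableEq ι] {t : ℝ}
    (e : X) (he : (e : H →L[𝔽] H) = (t : 𝔽) • 1) (x y : Matrix ι ι X)
    (hy : ∀ i j, (y i j : H →L[𝔽] H) = star (x j i : H →L[𝔽] H)) (h : ‖matOp x‖ ≤ t) :
    MatPos (Matrix.fromBlocks (Matrix.diagonal fun _ => e) x y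
      (Matrix.diagonal fun _ => e)) := by
  have hadj : ∀ a b, ⟪matOp y a, b⟫_𝔽 = ⟪a, matOp x b⟫_𝔽 := by
    intro a b
    simp only [PiLp.inner_apply, matOp_apply, sum_inner, inner_sum, hy,
      ContinuousLinearMap.star_eq_adjoint, ContinuousLinearMap.adjoint_inner_left]
    exact Finset.sum_comm
  have hadj' : ∀ a b, ⟪matOp x b, a⟫_𝔽 = ⟪b, matOp y a⟫_𝔽 := by
    intro a b
    rw [← inner_conj_symm, ← hadj, inner_conj_symm]
  refine ⟨fun v w => ?_, fun v => ?_⟩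
  · obtain ⟨a, b, rfl⟩ := exists_eq_sumVec v
    obtain ⟨c, d, rfl⟩ := exists_eq_sumVec w
    rw [ContinuousLinearMap.coe_coe, inner_matOp_fromBlocks e he,
      ← inner_conj_symm (sumVec a b), inner_matOp_fromBlocks e he, hadj, hadj']
    simp only [map_add, map_mul, inner_conj_symm, RCLike.conj_ofReal]
    ring
  · obtain ⟨a, b, rfl⟩ := exists_eq_sumVec v
    rw [ContinuousLinearMap.reApplyInnerSelf_apply, inner_matOp_fromBlocks e he, hadj]
    have h1 : RCLike.re ⟪a, matOp x b⟫_𝔽 = RCLike.re ⟪matOp x b, a⟫_𝔽 := inner_re_symm ..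
    have h2 : |RCLike.re ⟪matOp x b, a⟫_𝔽| ≤ t * ‖b‖ * ‖a‖ :=
      (RCLike.abs_re_le_norm _).trans <| (norm_inner_le_norm _ _).trans <| by
        gcongr; exact (matOp x).le_of_opNorm_le h b
    have ht : 0 ≤ t := (norm_nonneg _).trans h
    simp only [map_add, inner_self_eq_norm_sq_to_K, h1]
    norm_cast
    -- The form is at least `t (‖a‖ - ‖b‖)²`.
    nlinarith [neg_abs_le (RCLike.re ⟪matOp x b, a⟫_𝔽), mul_nonneg ht (sq_nonneg (‖a‖ - ‖b‖))]

/-- A unital completely positive map of operator systems is completely contractive. -/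
theorem CompletelyPositive.completelyContractive [CompleteSpace H] (one_mem : (1 : H →L[𝔽] H) ∈ X)
    (star_mem : ∀ x ∈ X, star x ∈ X) (f : X →+ Y)
    (hs : ∀ (r : ℝ) (x : X), f ((r : 𝔽) • x) = (r : 𝔽) • f x) (h1 : PreservesOne f)
    (hf : CompletelyPositive f) : CompletelyContractive f := by
  intro n x
  -- The block matrix with diagonal `‖x‖` and corners `x`, `x*` is positive, and its image keeps the
  -- diagonal because `f` is unital. That `f` commutes with adjoints is not needed: positivity of
  -- the image contains it.
  let e : X := ((‖matOp x‖ : ℝ) : 𝔽) • ⟨1, one_mem⟩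
  let y : Matrix (Fin n) (Fin n) X := Matrix.of fun i j => ⟨star (x j i : H →L[𝔽] H),
    star_mem _ (x j i).2⟩
  have h := matPos_of_norm_matOp_le e rfl x y (fun _ _ => rfl) le_rfl
  rw [← (matOp_reindex finSumFinEquiv.symm _).2] at h
  have h' := hf _ _ h
  rw [← Matrix.submatrix_map, (matOp_reindex finSumFinEquiv.symm _).2, Matrix.fromBlocks_map,
    Matrix.diagonal_map (map_zero f)] at h'
  refine norm_matOp_le_of_matPos (norm_nonneg _) (f e) ?_ (x.map f) (y.map f) h'
  rw [hs, Submodule.coe_smul, h1 _ rfl]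

end Matrices

/-! ### The conjugation of a complexification. -/

section Conj

variable {H : Type*} [NormedAddCommGroup H] [InnerProductSpace ℝ H]
variable {X : Submodule ℝ (H →L[ℝ] H)}

/-- The conjugation `x + iy ↦ x - iy` of a complexification. -/
noncomputable def conjX (s : complexifySpace X) : complexifySpace X := mkX (reX s) (-imX s)

theorem conjX_conjX (s : complexifySpace X) : conjX (conjX s) = s := by
  simp [conjX]

theorem conjX_add (s t : complexifySpace X) : conjX (s + t) = conjX s + conjX t := by
  simp [conjX, reX_add, imX_add, mkX_add, add_comm]

theorem conjX_smul (c : ℂ) (s : complexifySpace X) :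
    conjX (c • s) = (starRingEnd ℂ) c • conjX s := by
  simp only [conjX, reX_smul, imX_smul, smul_mkX, Complex.conj_re, Complex.conj_im]
  congr 1 <;> module

/-- The conjugation of `H + iH` is a surjective real linear isometry, and it intertwines `x + iy`
with `x - iy`. -/
theorem matOp_conjX {n : ℕ} (s : Matrix (Fin n) (Fin n) (complexifySpace X)) :
    ‖matOp s‖ = ‖matOp (s.map conjX)‖ ∧ (MatPos s ↔ MatPos (s.map conjX)) := by
  let U : PiLp 2 (fun _ : Fin n => HilbertC H) → PiLp 2 (fun _ : Fin n => HilbertC H) :=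
    fun v => WithLp.toLp 2 fun i => ⟨(v i).re, -(v i).im⟩
  refine matOp_compare s (s.map conjX) U (fun w => ⟨U w, ?_⟩) (fun v w => ?_) (fun v => ?_)
  · ext i <;> simp [U]
  · simp [U, HilbertC.inner_re]
  · ext i
    · simp only [U, matOp_apply, Matrix.map_apply]
      rw [← HilbertC.reL_apply, ← HilbertC.reL_apply, map_sum, map_sum]
      refine Finset.sum_congr rfl fun j _ => ?_
      rw [coe_eq_combine, coe_eq_combine]
      simp [conjX]
    · simp only [U, matOp_apply, Matrix.map_apply]
      rw [← HilbertC.imL_apply, ← HilbertC.imL_apply, map_sum, map_sum, ← Finset.sum_neg_distrib]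
      refine Finset.sum_congr rfl fun j _ => ?_
      rw [coe_eq_combine, coe_eq_combine]
      simp [conjX, add_comm]

end Conj

/-! ### Faithfulness. -/

section Faithful

theorem complexifyAdd_injective {H K : Type*} [NormedAddCommGroup H] [InnerProductSpace ℝ H]
    [NormedAddCommGroup K] [InnerProductSpace ℝ K] {X : Submodule ℝ (H →L[ℝ] H)}
    {Y : Submodule ℝ (K →L[ℝ] K)} {f g : X →+ Y} (h : complexifyAdd f = complexifyAdd g) :
    f = g := by
  ext x : 1
  have h := congrArg reX (DFunLike.congr_fun h (mkX x 0))
  simpa [complexifyAdd_apply] using h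

theorem realFun_injective {H K : Type*} [NormedAddCommGroup H] [InnerProductSpace ℂ H]
    [NormedAddCommGroup K] [InnerProductSpace ℂ K] {X : Submodule ℂ (H →L[ℂ] H)}
    {Y : Submodule ℂ (K →L[ℂ] K)} {f g : X →+ Y} (h : realFun f = realFun g) : f = g := by
  ext x : 1
  have h := DFunLike.congr_fun h (realEquiv X x)
  simpa [realFun_apply] using h

instance (k : OpKind) : (complexification.{u} k).Faithful where
  map_injective h := OpHom.ext (complexifyAdd_injective (congrArg OpHom.hom h))

instance (G : Type v) [Group G] (k : OpKind) : (complexificationG.{u} G k).Faithful where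
  map_injective h := GOpHom.ext (complexifyAdd_injective (congrArg (fun f => f.toOpHom.hom) h))

variable (𝔽 : Type) [Field 𝔽] [Algebra 𝔽 ℂ] [Algebra ℝ 𝔽] [IsScalarTower ℝ 𝔽 ℂ]

instance (k : OpKind) : (forgetToReal.{u} k 𝔽).Faithful where
  map_injective h := OpHom.ext (realFun_injective (congrArg OpHom.hom h))

instance (G : Type v) [Group G] (k : OpKind) : (forgetToRealG.{u} G k 𝔽).Faithful where
  map_injective h := GOpHom.ext (realFun_injective (congrArg (fun f => f.toOpHom.hom) h))

instance (k : OpKind) : (intermediateComplexification.{u} k).Faithful :=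
  inferInstanceAs (forgetToReal.{u} k ℝ ⋙ complexification k).Faithful

instance (G : Type v) [Group G] (k : OpKind) : (intermediateComplexificationG.{u} G k).Faithful :=
  inferInstanceAs (forgetToRealG.{u} G k ℝ ⋙ complexificationG G k).Faithful

end Faithful

/-! ### Isomorphisms and complete contractivity. -/

section Isomorphisms

variable {k : OpKind} {𝔽₁ 𝔽₂ : Type} [RCLike 𝔽₁] [Field 𝔽₂] [Algebra 𝔽₂ 𝔽₁]

theorem iso_inv_hom_apply {A B : OpCat.{u} k 𝔽₁ 𝔽₂} (φ : A ≅ B) (x : A.X) :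
    OpHom.hom φ.inv (OpHom.hom φ.hom x) = x :=
  DFunLike.congr_fun (congrArg OpHom.hom φ.hom_inv_id) x

theorem iso_hom_inv_apply {A B : OpCat.{u} k 𝔽₁ 𝔽₂} (φ : A ≅ B) (y : B.X) :
    OpHom.hom φ.hom (OpHom.hom φ.inv y) = y :=
  DFunLike.congr_fun (congrArg OpHom.hom φ.inv_hom_id) y

/-- The underlying isomorphism of an isomorphism of `G`-objects. -/
def underlyingIso {G : Type v} [Group G] {A B : GOpCat.{u} G k 𝔽₁ 𝔽₂} (φ : A ≅ B) :
    A.toOpCat ≅ B.toOpCat where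
  hom := GOpHom.toOpHom φ.hom
  inv := GOpHom.toOpHom φ.inv
  hom_inv_id := congrArg GOpHom.toOpHom φ.hom_inv_id
  inv_hom_id := congrArg GOpHom.toOpHom φ.inv_hom_id

/-- A morphism of any kind between real or complex objects is completely contractive. -/
theorem OpHom.completelyContractive [Algebra ℝ 𝔽₂] (hr : ∀ r : ℝ,
    algebraMap 𝔽₂ 𝔽₁ (algebraMap ℝ 𝔽₂ r) = (r : 𝔽₁)) {A B : OpCat.{u} k 𝔽₁ 𝔽₂} (f : OpHom A B) :
    CompletelyContractive f.hom := by
  obtain ⟨f, hs, hf⟩ := f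
  cases k
  · exact hf
  · exact hf.2
  · refine CompletelyPositive.completelyContractive (A.one_mem nofun) (A.star_mem rfl) f
      (fun r x => ?_) hf.1 hf.2
    have := hs (algebraMap ℝ 𝔽₂ r) x
    rwa [hr] at this

end Isomorphisms

/-! ### The column Hilbert space is not a unital operator space. -/

section ColumnSpace

variable (𝔽₁ 𝔽₂ : Type) [RCLike 𝔽₁] [Field 𝔽₂] [Algebra 𝔽₂ 𝔽₁]

/-- The Hilbert space of dimension two. -/
abbrev Plane (𝔽 : Type) : Type u := EuclideanSpace 𝔽 (ULift.{u} (Fin 2))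

/-- The operator `v ↦ v₀ c` on the Hilbert space of dimension two. -/
noncomputable def columnOp : Plane.{u} 𝔽₁ →ₗ[𝔽₁] (Plane.{u} 𝔽₁ →L[𝔽₁] Plane.{u} 𝔽₁) where
  toFun c := (EuclideanSpace.proj (⟨0⟩ : ULift.{u} (Fin 2))).smulRight c
  map_add' a b := by ext v i; simp
  map_smul' r a := by ext v i; simp; ring

theorem columnOp_apply (c v : Plane.{u} 𝔽₁) : columnOp 𝔽₁ c v = v ⟨0⟩ • c := rfl

/-- The column Hilbert space of dimension two, as an operator space. -/
noncomputable def columnSpace : OpCat.{u} .space 𝔽₁ 𝔽₂ where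
  H := Plane.{u} 𝔽₁
  X := LinearMap.range (columnOp 𝔽₁)
  one_mem h := absurd rfl h
  star_mem := nofun

/-- In an operator space with unit, `‖(1, x)‖ ≤ 1` only if `x = 0`. -/
theorem eq_zero_of_norm_row_le {𝔽 H : Type*} [RCLike 𝔽] [NormedAddCommGroup H]
    [InnerProductSpace 𝔽 H] {X : Submodule 𝔽 (H →L[𝔽] H)} (e x : X)
    (he : (e : H →L[𝔽] H) = 1) (h : ‖matOp !![e, x; 0, 0]‖ ≤ 1) : x = 0 := by
  apply Subtype.ext
  ext w
  set p := (x : H →L[𝔽] H) w with hp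
  change p = 0
  -- Contractivity at the vector `(s p, w)`. The left side exceeds `s² ‖p‖²` by `(2s + 1) ‖p‖²`,
  -- which for `s = ‖w‖² / ‖p‖²` is more than `‖w‖²`.
  have key : ∀ s : ℝ, (s + 1) ^ 2 * ‖p‖ ^ 2 ≤ s ^ 2 * ‖p‖ ^ 2 + ‖w‖ ^ 2 := by
    intro s
    have h1 := (matOp !![e, x; 0, 0]).le_of_opNorm_le h (WithLp.toLp 2 ![(s : 𝔽) • p, w])
    have h2 := pow_le_pow_left₀ (norm_nonneg _) h1 2
    rw [one_mul, PiLp.norm_sq_eq_of_L2, PiLp.norm_sq_eq_of_L2] at h2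
    simp [matOp_apply, he, ← hp] at h2
    have h3 : (s : 𝔽) • p + p = ((s + 1 : ℝ) : 𝔽) • p := by
      push_cast; module
    rw [h3] at h2
    simp only [norm_smul, RCLike.norm_ofReal, mul_pow, sq_abs] at h2
    exact h2
  by_contra hne
  have hpos : 0 < ‖p‖ ^ 2 := by positivity
  have := key (‖w‖ ^ 2 / ‖p‖ ^ 2)
  have h4 : ‖w‖ ^ 2 / ‖p‖ ^ 2 * ‖p‖ ^ 2 = ‖w‖ ^ 2 := by field_simp
  nlinarith

/-- Only first coordinates of the two input vectors enter, as coefficients of the orthogonal vectors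
`c` and `d`, so Pythagoras applies. -/
theorem norm_row_columnOp_le (a b : LinearMap.range (columnOp.{u} 𝔽₁)) (c d : Plane.{u} 𝔽₁)
    (ha : (a : Plane.{u} 𝔽₁ →L[𝔽₁] Plane.{u} 𝔽₁) = columnOp 𝔽₁ c)
    (hb : (b : Plane.{u} 𝔽₁ →L[𝔽₁] Plane.{u} 𝔽₁) = columnOp 𝔽₁ d)
    (hc : ‖c‖ ≤ 1) (hd : ‖d‖ ≤ 1) (hcd : ⟪c, d⟫_𝔽₁ = 0) :
    ‖matOp !![a, b; 0, 0]‖ ≤ 1 := by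
  refine ContinuousLinearMap.opNorm_le_bound _ zero_le_one fun v => ?_
  apply le_of_sq_le_sq _ (by positivity)
  rw [one_mul, PiLp.norm_sq_eq_of_L2, PiLp.norm_sq_eq_of_L2]
  simp [matOp_apply, ha, hb, columnOp_apply]
  have h1 : ‖v 0 ⟨0⟩ • c + v 1 ⟨0⟩ • d‖ ^ 2 = ‖v 0 ⟨0⟩ • c‖ ^ 2 + ‖v 1 ⟨0⟩ • d‖ ^ 2 := by
    rw [@norm_add_sq 𝔽₁]
    simp [inner_smul_left, inner_smul_right, hcd]
  have h2 : ∀ (i : Fin 2) (c : Plane.{u} 𝔽₁), ‖c‖ ≤ 1 → ‖v i ⟨0⟩ • c‖ ^ 2 ≤ ‖v i‖ ^ 2 := by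
    intro i c hc
    gcongr
    rw [norm_smul]
    exact (mul_le_of_le_one_right (norm_nonneg _) hc).trans (PiLp.norm_apply_le (v i) _)
  rw [h1]
  exact add_le_add (h2 0 c hc) (h2 1 d hd)

theorem norm_le_norm_columnOp (c : Plane.{u} 𝔽₁) : ‖c‖ ≤ ‖columnOp 𝔽₁ c‖ := by
  have h := (columnOp 𝔽₁ c).le_opNorm (EuclideanSpace.single ⟨0⟩ 1)
  simpa [columnOp_apply] using h

/-- Let `c` be the image of the unit, and `d` orthogonal to `c` with the same norm. The row `(c, d)`
is contractive, and it pulls back to a contractive row with first entry `1`. Hence `d = 0`, so `c =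
0` and the unit vanishes. -/
theorem isEmpty_iso_columnSpace (A : OpCat.{u} .unital 𝔽₁ 𝔽₂) :
    IsEmpty ((forgetUnit 𝔽₁ 𝔽₂).obj A ≅ columnSpace 𝔽₁ 𝔽₂) := by
  refine ⟨fun φ => ?_⟩
  let f : A.X →+ LinearMap.range (columnOp.{u} 𝔽₁) := OpHom.hom φ.hom
  let g : LinearMap.range (columnOp.{u} 𝔽₁) →+ A.X := OpHom.hom φ.inv
  have hgf : ∀ x, g (f x) = x := iso_inv_hom_apply φ
  have hfg : ∀ y, f (g y) = y := iso_hom_inv_apply φ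
  have hf : CompletelyContractive f := OpHom.isMorphism φ.hom
  have hg : CompletelyContractive g := OpHom.isMorphism φ.inv
  let e : A.X := ⟨1, A.one_mem nofun⟩
  obtain ⟨c, hc⟩ := (f e).2
  have hc1 : ‖c‖ ≤ 1 := by
    have h := hf 1 (Matrix.of fun _ _ => e)
    rw [(matOp_one_by_one e).1] at h
    have h2 : ‖matOp ((Matrix.of fun _ _ : Fin 1 => e).map f)‖ = _ := (matOp_one_by_one (f e)).1
    rw [h2, ← hc] at h
    exact (norm_le_norm_columnOp 𝔽₁ c).trans (h.trans ContinuousLinearMap.norm_id_le)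
  let d : Plane.{u} 𝔽₁ := WithLp.toLp 2 fun i =>
    if i.down = 0 then -(starRingEnd 𝔽₁) (c ⟨1⟩) else (starRingEnd 𝔽₁) (c ⟨0⟩)
  have sum2 : ∀ a : ULift.{u} (Fin 2) → 𝔽₁, ∑ i, a i = a ⟨0⟩ + a ⟨1⟩ := fun a => by
    rw [← Equiv.ulift.symm.sum_comp, Fin.sum_univ_two]; rfl
  have sum2' : ∀ a : ULift.{u} (Fin 2) → ℝ, ∑ i, a i = a ⟨0⟩ + a ⟨1⟩ := fun a => by
    rw [← Equiv.ulift.symm.sum_comp, Fin.sum_univ_two]; rfl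
  have hcd : ⟪c, d⟫_𝔽₁ = 0 := by
    rw [PiLp.inner_apply, sum2]
    simp [d]; ring
  have hd : ‖d‖ = ‖c‖ := by
    rw [← sq_eq_sq₀ (norm_nonneg _) (norm_nonneg _), EuclideanSpace.norm_sq_eq,
      EuclideanSpace.norm_sq_eq, sum2', sum2']
    simp [d, add_comm]
  let b : LinearMap.range (columnOp.{u} 𝔽₁) := ⟨columnOp 𝔽₁ d, d, rfl⟩
  have hrow := norm_row_columnOp_le 𝔽₁ (f e) b c d hc.symm rfl hc1 (hd.trans_le hc1) hcd
  have hmap : (!![f e, b; 0, 0] : Matrix _ _ (LinearMap.range (columnOp.{u} 𝔽₁))).map g =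
      !![e, g b; 0, 0] := by
    ext i j : 2
    fin_cases i <;> fin_cases j <;> simp [hgf]
  have hgb := eq_zero_of_norm_row_le e (g b) rfl (hmap ▸ (hg 2 _).trans hrow)
  have hb : b = 0 := by rw [← hfg b, hgb, map_zero]
  have hd0 : d = 0 := by
    rw [← norm_le_zero_iff]
    refine (norm_le_norm_columnOp 𝔽₁ d).trans_eq ?_
    rw [show columnOp 𝔽₁ d = 0 from congrArg Subtype.val hb, norm_zero]
  have hc0 : c = 0 := by rw [← norm_eq_zero, ← hd, hd0, norm_zero]
  have he : e = 0 := by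
    rw [← hgf e, show f e = 0 from Subtype.ext (by rw [← hc, hc0, map_zero]; rfl), map_zero]
  -- If the identity is zero then so is the Hilbert space, and with it every operator; but the
  -- column space is not zero.
  have hA : ∀ x : A.X, x = 0 := by
    intro x
    apply Subtype.ext
    ext w
    have h : w = 0 := DFunLike.congr_fun (congrArg Subtype.val he) w
    rw [h, map_zero, map_zero]
  let s : LinearMap.range (columnOp.{u} 𝔽₁) := ⟨_, EuclideanSpace.single ⟨0⟩ 1, rfl⟩
  have hs : s = 0 := by rw [← hfg s, hA (g s), map_zero]
  have h := norm_le_norm_columnOp 𝔽₁ (EuclideanSpace.single (⟨0⟩ : ULift.{u} (Fin 2)) 1)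
  rw [show columnOp 𝔽₁ _ = 0 from congrArg Subtype.val hs] at h
  simp at h
  linarith

theorem not_essSurj_forgetUnit : ¬ (forgetUnit.{u} 𝔽₁ 𝔽₂).EssSurj := fun _ =>
  (isEmpty_iso_columnSpace 𝔽₁ 𝔽₂ _).false ((forgetUnit 𝔽₁ 𝔽₂).objObjPreimageIso (columnSpace 𝔽₁ 𝔽₂))

theorem not_essSurj_forgetUnitG (G : Type v) [Group G] :
    ¬ (forgetUnitG.{u} 𝔽₁ 𝔽₂ G).EssSurj := fun _ =>
  (isEmpty_iso_columnSpace 𝔽₁ 𝔽₂ _).false (underlyingIso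
    ((forgetUnitG 𝔽₁ 𝔽₂ G).objObjPreimageIso ((columnSpace 𝔽₁ 𝔽₂).trivialAction G)))

end ColumnSpace

/-! ### A morphism between complexifications that is not a complexification. -/

section Full

attribute [local instance] InnerProductSpace.complexToReal

/-- The scalar multiples of the identity. -/
noncomputable def scalars (H : Type*) [NormedAddCommGroup H] [InnerProductSpace ℂ H] :
    Submodule ℂ (H →L[ℂ] H) := Submodule.span ℂ {1}

/-- The scalar operators, as an object of each kind. -/
noncomputable def scalarSpace (k : OpKind) (𝔽 : Type) (H : Type u) [NormedAddCommGroup H]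
    [InnerProductSpace ℂ H] [CompleteSpace H] : OpCat.{u} k ℂ 𝔽 where
  H := H
  X := scalars H
  one_mem _ := Submodule.mem_span_singleton_self 1
  star_mem := by
    rintro - _ hx
    obtain ⟨c, rfl⟩ := Submodule.mem_span_singleton.1 hx
    rw [star_smul, star_one]
    exact Submodule.smul_mem _ _ (Submodule.mem_span_singleton_self 1)

/-- The complex line. -/
abbrev Line : Type u := EuclideanSpace ℂ PUnit.{u + 1}

/-- The scalar by which a scalar operator on the plane acts. -/
noncomputable def scalarValue : realSpace (scalars (Plane.{u} ℂ)) →+ ℂ where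
  toFun x := (x : Plane.{u} ℂ →L[ℝ] Plane.{u} ℂ) (EuclideanSpace.single ⟨0⟩ 1) ⟨0⟩
  map_zero' := rfl
  map_add' _ _ := rfl

theorem apply_eq_scalarValue_smul (x : realSpace (scalars (Plane.{u} ℂ))) (v : Plane.{u} ℂ) :
    (x : Plane.{u} ℂ →L[ℝ] Plane.{u} ℂ) v = scalarValue x • v := by
  obtain ⟨_, x, hx, rfl⟩ := x
  obtain ⟨c, rfl⟩ := Submodule.mem_span_singleton.1 hx
  have : scalarValue (⟨_, c • 1, hx, rfl⟩ : realSpace (scalars (Plane.{u} ℂ))) = c := by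
    change (c • (EuclideanSpace.single (⟨0⟩ : ULift.{u} (Fin 2)) (1 : ℂ))) ⟨0⟩ = c
    simp
  rw [this]
  rfl

/-- The character `x + iy ↦ x + iy ∈ ℂ` of the complexification of the scalar operators. -/
noncomputable def character : complexifySpace (realSpace (scalars (Plane.{u} ℂ))) →+ ℂ where
  toFun s := scalarValue (reX s) + Complex.I * scalarValue (imX s)
  map_zero' := by
    have h : (0 : complexifySpace (realSpace (scalars (Plane.{u} ℂ)))) = mkX 0 0 := by
      rw [← zero_smul ℂ (mkX 0 0), smul_mkX]; simp
    rw [h]; simp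
  map_add' s t := by
    rw [reX_add, imX_add, map_add, map_add]; ring

theorem character_smul (c : ℂ) (s : complexifySpace (realSpace (scalars (Plane.{u} ℂ)))) :
    character (c • s) = c * character s := by
  have h : ∀ (r : ℝ) (x : realSpace (scalars (Plane.{u} ℂ))),
      scalarValue (r • x) = r * scalarValue x := by
    intro r x
    change (r • (x : Plane.{u} ℂ →L[ℝ] Plane.{u} ℂ) (EuclideanSpace.single ⟨0⟩ 1) :
      Plane.{u} ℂ) ⟨0⟩ = _
    simp only [PiLp.smul_apply, Complex.real_smul]
    rfl
  change scalarValue (reX (c • s)) + Complex.I * scalarValue (imX (c • s)) =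
    c * (scalarValue (reX s) + Complex.I * scalarValue (imX s))
  rw [reX_smul, imX_smul, map_sub, map_add, h, h, h, h]
  conv_rhs => rw [← Complex.re_add_im c]
  linear_combination (-c.im * scalarValue (imX s)) * Complex.I_mul_I

/-- The identity operator of the line, in the real space of scalar operators. -/
noncomputable def lineOne : realSpace (scalars Line.{u}) :=
  ⟨1, 1, Submodule.mem_span_singleton_self 1, rfl⟩

/-- The map `s ↦ χ(s) 1` given by the character `χ`. -/
noncomputable def characterMap : complexifySpace (realSpace (scalars (Plane.{u} ℂ))) →+
    complexifySpace (realSpace (scalars Line.{u})) where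
  toFun s := character s • mkX lineOne 0
  map_zero' := by rw [map_zero, zero_smul]
  map_add' s t := by rw [map_add, add_smul]

/-- Half of `x + iy` and `x̄ + iȳ`, for the element `x + iy` of the complexification of the line. -/
noncomputable def eigenvector (w : HilbertC Line.{u}) : Plane.{u} ℂ :=
  WithLp.toLp 2 fun i => if i.down = 0
    then (w.re ⟨⟩ + Complex.I * w.im ⟨⟩) / 2
    else ((starRingEnd ℂ) (w.re ⟨⟩) + Complex.I * (starRingEnd ℂ) (w.im ⟨⟩)) / 2

theorem eigenvector_add (v w : HilbertC Line.{u}) :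
    eigenvector (v + w) = eigenvector v + eigenvector w := by
  ext ⟨i⟩
  fin_cases i <;> simp [eigenvector] <;> ring

theorem eigenvector_smul (c : ℂ) (w : HilbertC Line.{u}) :
    eigenvector (c • w) = c • eigenvector w := by
  ext ⟨i⟩
  fin_cases i <;> simp [eigenvector] <;> apply Complex.ext <;> simp <;> ring

/-- The cross terms `± 2 Im(a b̄)` of `|a + ib|²` and `|ā + i b̄|²` cancel. -/
theorem norm_sq_eigenvector (w : HilbertC Line.{u}) : 2 * ‖eigenvector w‖ ^ 2 = ‖w‖ ^ 2 := by
  have sum2 : ∀ a : ULift.{u} (Fin 2) → ℝ, ∑ i, a i = a ⟨0⟩ + a ⟨1⟩ := fun a => by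
    rw [← Equiv.ulift.symm.sum_comp, Fin.sum_univ_two]; rfl
  rw [HilbertC.norm_sq, EuclideanSpace.norm_sq_eq, EuclideanSpace.norm_sq_eq,
    EuclideanSpace.norm_sq_eq, sum2]
  simp [eigenvector]
  simp only [div_pow, Complex.sq_norm, Complex.normSq_apply]
  simp
  ring

/-- The isometry of the complexification of the line onto eigenvectors of the complexification
of the scalar operators on the plane. -/
noncomputable def eigenIsometry : HilbertC Line.{u} →ₗᵢ[ℂ] HilbertC (Plane.{u} ℂ) where
  -- On the vectors with parts `v` and `-iv` the operator `i` of the plane acts as the scalar `i` of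
  -- the complexification, so these are eigenvectors for `χ`. They form a space of dimension two,
  -- like the complexified line; this is why the source consists of scalars on a plane.
  toFun w := ⟨eigenvector w, -Complex.I • eigenvector w⟩
  map_add' v w := by
    ext : 1 <;> simp only [eigenvector_add, smul_add, HilbertC.re_add, HilbertC.im_add]
  map_smul' c w := by
    ext : 1
    · simp only [eigenvector_smul, HilbertC.re_smul, RingHom.id_apply]
      ext i
      simp
      conv_lhs => rw [← Complex.re_add_im c]
      ring
    · simp only [eigenvector_smul, HilbertC.im_smul, RingHom.id_apply]
      ext i
      simp
      conv_lhs => rw [← Complex.re_add_im c]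
      linear_combination (-(c.im : ℂ) * eigenvector w i) * Complex.I_mul_I
  norm_map' w := by
    rw [← sq_eq_sq₀ (norm_nonneg _) (norm_nonneg _), ← norm_sq_eigenvector, HilbertC.norm_sq]
    simp [norm_smul]
    ring

/-- The hypothesis of `IsMorphism.of_intertwine`: `x + iy` maps the pair `(v, -iv)` to the pair of
`(x + iy) v`, with the sum computed in ℂ. -/
theorem eigenIsometry_characterMap (s : complexifySpace (realSpace (scalars (Plane.{u} ℂ))))
    (w : HilbertC Line.{u}) :
    eigenIsometry ((characterMap s : HilbertC Line.{u} →L[ℂ] HilbertC Line.{u}) w) =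
      (s : HilbertC (Plane.{u} ℂ) →L[ℂ] HilbertC (Plane.{u} ℂ)) (eigenIsometry w) := by
  have h1 : (characterMap s : HilbertC Line.{u} →L[ℂ] HilbertC Line.{u}) w = character s • w := by
    change (character s • combine (1 : Line.{u} →L[ℝ] Line.{u}) 0) w = _
    rw [combine_one_zero]; rfl
  rw [h1, coe_eq_combine]
  change (⟨eigenvector (character s • w), -Complex.I • eigenvector (character s • w)⟩ :
    HilbertC (Plane.{u} ℂ)) = combine _ _ ⟨eigenvector w, -Complex.I • eigenvector w⟩
  rw [eigenvector_smul]
  change (⟨(scalarValue (reX s) + Complex.I * scalarValue (imX s)) • eigenvector w,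
    -Complex.I • (scalarValue (reX s) + Complex.I * scalarValue (imX s)) • eigenvector w⟩ :
    HilbertC (Plane.{u} ℂ)) = _
  ext i
  · simp only [combine_re, apply_eq_scalarValue_smul]
    simp
    ring
  · simp only [combine_im, apply_eq_scalarValue_smul]
    simp
    linear_combination
      (-scalarValue (imX s) * eigenvector w i) * Complex.I_mul_I

/-- A complexified map sends elements without imaginary part to such elements. The operator `i` is
sent by `characterMap` to `i` times the unit, which is purely imaginary and nonzero. -/
theorem characterMap_ne_complexifyAdd
    (f : realSpace (scalars (Plane.{u} ℂ)) →+ realSpace (scalars Line.{u})) :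
    characterMap ≠ complexifyAdd f := by
  intro h
  let J : realSpace (scalars (Plane.{u} ℂ)) := ⟨_, Complex.I • 1,
    Submodule.smul_mem _ _ (Submodule.mem_span_singleton_self 1), rfl⟩
  have hJ : scalarValue J = Complex.I := by
    change (Complex.I • (EuclideanSpace.single (⟨0⟩ : ULift.{u} (Fin 2)) (1 : ℂ))) ⟨0⟩ = _
    simp
  have h1 := congrArg imX (DFunLike.congr_fun h (mkX J 0))
  rw [complexifyAdd_apply, imX_mkX, imX_mkX, map_zero] at h1
  change imX ((scalarValue (reX (mkX J 0)) + Complex.I * scalarValue (imX (mkX J 0))) • _) = _ at h1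
  rw [reX_mkX, imX_mkX, hJ, imX_smul, reX_mkX, imX_mkX] at h1
  simp at h1
  have h2 := DFunLike.congr_fun (congrArg Subtype.val h1) (EuclideanSpace.single PUnit.unit 1)
  have h3 : (EuclideanSpace.single PUnit.unit 1 : Line.{u}) = 0 := h2
  simpa using congrArg (fun v : Line.{u} => v PUnit.unit) h3

/-- A morphism between complexifications which is not the complexification of a morphism. -/
noncomputable def characterHom (k : OpKind) :
    (intermediateComplexification.{u} k).obj (scalarSpace k ℝ (Plane.{u} ℂ)) ⟶
      (intermediateComplexification.{u} k).obj (scalarSpace k ℝ Line.{u}) :=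
  OpHom.mk (characterMap :
      complexifySpace (realSpace (scalars (Plane.{u} ℂ))) →+
        complexifySpace (realSpace (scalars Line.{u})))
    (fun c (s : complexifySpace (realSpace (scalars (Plane.{u} ℂ)))) => by
      change character (c • s) • mkX lineOne 0 = c • (character s • mkX lineOne 0)
      rw [character_smul, mul_smul])
    (IsMorphism.of_intertwine k _ eigenIsometry eigenIsometry_characterMap)

/-- The same morphism serves here, because the intermediate functor makes its objects real before
complexifying them. -/
theorem not_full_complexification (k : OpKind) : ¬ (complexification.{u} k).Full := by
  intro h
  obtain ⟨f, hf⟩ := h.map_surjective (characterHom.{u} k)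
  exact characterMap_ne_complexifyAdd _ (congrArg OpHom.hom hf).symm

theorem not_full_intermediateComplexification (k : OpKind) :
    ¬ (intermediateComplexification.{u} k).Full := by
  intro h
  obtain ⟨f, hf⟩ := h.map_surjective (characterHom.{u} k)
  exact characterMap_ne_complexifyAdd _ (congrArg OpHom.hom hf).symm

variable (G : Type v) [Group G]

theorem complexify_trivialAction_apply {k : OpKind} (A : OpCat.{u} k ℂ ℝ) (g : G)
    (s : complexifySpace (realSpace A.X)) :
    ((intermediateComplexificationG.{u} G k).obj (A.trivialAction G)).ρ g s = s := by
  change mkX (realFun (AddMonoidHom.id A.X) (reX s)) (realFun (AddMonoidHom.id A.X) (imX s)) = s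
  rw [realFun_id, realFun_id, mkX_eta]

/-- The morphism `characterHom`, for trivial actions. -/
noncomputable def characterHomG (k : OpKind) :
    (intermediateComplexificationG.{u} G k).obj
        ((scalarSpace k ℝ (Plane.{u} ℂ)).trivialAction G) ⟶
      (intermediateComplexificationG.{u} G k).obj
        ((scalarSpace k ℝ Line.{u}).trivialAction G) :=
  GOpHom.mk (characterHom k) fun g s =>
    (congrArg (OpHom.hom (characterHom k)) (complexify_trivialAction_apply G _ g s)).trans
      (complexify_trivialAction_apply G _ g _).symm

theorem not_full_complexificationG (k : OpKind) : ¬ (complexificationG.{u} G k).Full := by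
  intro h
  obtain ⟨f, hf⟩ := h.map_surjective (characterHomG.{u} G k)
  exact characterMap_ne_complexifyAdd _ (congrArg (fun f => f.toOpHom.hom) hf).symm

theorem not_full_intermediateComplexificationG (k : OpKind) :
    ¬ (intermediateComplexificationG.{u} G k).Full := by
  intro h
  obtain ⟨f, hf⟩ := h.map_surjective (characterHomG.{u} G k)
  exact characterMap_ne_complexifyAdd _ (congrArg (fun f => f.toOpHom.hom) hf).symm

end Full

/-! ### Norms of single elements, and of matrices conjugated by `diag(1, i)`. -/

theorem CompletelyContractive.norm_le {𝔽 : Type*} [RCLike 𝔽] {H : Type*} [NormedAddCommGroup H]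
    [InnerProductSpace 𝔽 H] {K : Type*} [NormedAddCommGroup K] [InnerProductSpace 𝔽 K]
    {X : Submodule 𝔽 (H →L[𝔽] H)} {Y : Submodule 𝔽 (K →L[𝔽] K)} {f : X → Y}
    (hf : CompletelyContractive f) (x : X) : ‖(f x : K →L[𝔽] K)‖ ≤ ‖(x : H →L[𝔽] H)‖ := by
  have h := hf 1 (Matrix.of fun _ _ => x)
  rwa [(matOp_one_by_one x).1, show ‖matOp ((Matrix.of fun _ _ : Fin 1 => x).map f)‖ = _ from
    (matOp_one_by_one (f x)).1] at h

/-- Conjugation by the unitary matrix with diagonal entries `1` and `i` preserves norms. -/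
theorem norm_matOp_conj_I {H : Type*} [NormedAddCommGroup H] [InnerProductSpace ℂ H]
    {X : Submodule ℂ (H →L[ℂ] H)} (a b c d : X) :
    ‖matOp !![a, b; c, d]‖ = ‖matOp !![a, -(Complex.I • b); Complex.I • c, d]‖ := by
  let U : PiLp 2 (fun _ : Fin 2 => H) → PiLp 2 (fun _ : Fin 2 => H) :=
    fun v => WithLp.toLp 2 ![v 0, Complex.I • v 1]
  refine opNorm_eq_of_intertwine _ _ U (fun v => ⟨WithLp.toLp 2 ![v 0, -Complex.I • v 1], ?_⟩)
    (fun v => ?_) (fun v => ?_)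
  · ext i
    fin_cases i <;> simp [U, smul_smul]
  · rw [← sq_eq_sq₀ (norm_nonneg _) (norm_nonneg _), PiLp.norm_sq_eq_of_L2, PiLp.norm_sq_eq_of_L2]
    simp [U, norm_smul]
  · ext i
    fin_cases i <;> simp [U, matOp_apply, smul_smul, map_smul]

/-! ### The quaternions are not a complex operator space. -/

section Quaternions

open scoped Quaternion

/-- A quaternion, as an operator. -/
noncomputable def quat (a : ℍ[ℝ]) : LinearMap.range quaternionOp.{u} := ⟨quaternionOp a, a, rfl⟩

theorem exists_eq_quat (x : LinearMap.range quaternionOp.{u}) : ∃ a, x = quat a := by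
  obtain ⟨_, a, rfl⟩ := x
  exact ⟨a, rfl⟩

theorem norm_sq_piLp_punit (v : PiLp 2 (fun _ : PUnit.{u + 1} => ℍ[ℝ])) : ‖v‖ ^ 2 = ‖v ⟨⟩‖ ^ 2 := by
  rw [PiLp.norm_sq_eq_of_L2]; simp

theorem norm_quaternionOp (a : ℍ[ℝ]) : ‖quaternionOp.{u} a‖ = ‖a‖ := by
  have hn : ∀ v : PiLp 2 (fun _ : PUnit.{u + 1} => ℍ[ℝ]), ‖quaternionOp.{u} a v‖ = ‖a‖ * ‖v‖ := by
    intro v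
    rw [← sq_eq_sq₀ (norm_nonneg _) (by positivity), mul_pow, norm_sq_piLp_punit,
      norm_sq_piLp_punit, quaternionOp_apply, norm_mul, mul_pow]
  apply le_antisymm
  · exact ContinuousLinearMap.opNorm_le_bound _ (norm_nonneg _) fun v => (hn v).le
  · have h := (quaternionOp.{u} a).le_opNorm (WithLp.toLp 2 fun _ => 1)
    have h1 : ‖(WithLp.toLp 2 fun _ => 1 : PiLp 2 (fun _ : PUnit.{u + 1} => ℍ[ℝ]))‖ = 1 := by
      rw [← sq_eq_sq₀ (norm_nonneg _) zero_le_one, norm_sq_piLp_punit]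
      simp
    rwa [hn, h1, mul_one, mul_one] at h

theorem norm_sq_matOp_quat (a b c d : ℍ[ℝ])
    (v : PiLp 2 (fun _ : Fin 2 => PiLp 2 (fun _ : PUnit.{u + 1} => ℍ[ℝ]))) :
    ‖matOp !![quat.{u} a, quat b; quat c, quat d] v‖ ^ 2 =
      ‖a * v 0 ⟨⟩ + b * v 1 ⟨⟩‖ ^ 2 + ‖c * v 0 ⟨⟩ + d * v 1 ⟨⟩‖ ^ 2 := by
  rw [PiLp.norm_sq_eq_of_L2]
  simp [matOp_apply, norm_sq_piLp_punit, quat, quaternionOp_apply]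

/-- The matrix is the column `(1, c)` times the row `(1, b)`. It maps `(1, b*)`, of squared norm 2,
to `(2, 2c)`, of squared norm 8. -/
theorem two_le_norm_matOp_quat {b c : ℍ[ℝ]} (hb : ‖b‖ = 1) (hc : ‖c‖ = 1) :
    2 ≤ ‖matOp !![quat.{u} 1, quat b; quat c, quat (c * b)]‖ := by
  have hb' : b * star b = 1 := by
    rw [Quaternion.self_mul_star, Quaternion.normSq_eq_norm_mul_self, hb]; simp
  let v : PiLp 2 (fun _ : Fin 2 => PiLp 2 (fun _ : PUnit.{u + 1} => ℍ[ℝ])) :=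
    WithLp.toLp 2 ![WithLp.toLp 2 fun _ => 1, WithLp.toLp 2 fun _ => star b]
  have hv : ‖v‖ ^ 2 = 2 := by
    rw [PiLp.norm_sq_eq_of_L2]
    simp [v, norm_sq_piLp_punit, hb]
    norm_num
  have h := pow_le_pow_left₀ (norm_nonneg _)
    ((matOp !![quat.{u} 1, quat b; quat c, quat (c * b)]).le_opNorm v) 2
  rw [norm_sq_matOp_quat, mul_pow, hv] at h
  have h2 : ‖(1 + 1 : ℍ[ℝ])‖ = 2 := by
    rw [one_add_one_eq_two]
    exact (Quaternion.norm_coe (2 : ℝ)).trans (by norm_num)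
  have h3 : ‖c + c‖ = 2 := by
    rw [← mul_two, ← one_add_one_eq_two, norm_mul, h2, hc, one_mul]
  simp only [v, Matrix.cons_val_zero, Matrix.cons_val_one, mul_one, mul_assoc, hb', h2, h3] at h
  by_contra! hlt
  nlinarith [norm_nonneg (matOp !![quat.{u} 1, quat b; quat c, quat (c * b)])]

/-- With `r = c* d`, the squared norm of the image of `(u, v)` is `2‖u‖² + 2‖v‖² + 2⟪u, (b + r) v⟫`.
Norm 2 therefore requires `‖b + r‖ ≥ 2`, and the parallelogram law for the unit vectors `b` and `r`
gives `b = r`. -/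
theorem eq_of_two_le_norm_matOp_quat {b c d : ℍ[ℝ]} (hb : ‖b‖ = 1) (hc : ‖c‖ = 1) (hd : ‖d‖ = 1)
    (h : 2 ≤ ‖matOp !![quat.{u} 1, quat b; quat c, quat d]‖) : b = star c * d := by
  have hc' : c * star c = 1 := by
    rw [Quaternion.self_mul_star, Quaternion.normSq_eq_norm_mul_self, hc]; simp
  set r := star c * d with hr
  have hr1 : ‖r‖ = 1 := by rw [hr, norm_mul, norm_star, hc, hd, one_mul]
  have hdr : d = c * r := by rw [hr, ← mul_assoc, hc', one_mul]
  have hbound : ‖matOp !![quat.{u} 1, quat b; quat c, quat d]‖ ≤ √(2 + ‖b + r‖) := by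
    refine ContinuousLinearMap.opNorm_le_bound _ (Real.sqrt_nonneg _) fun v => ?_
    apply le_of_sq_le_sq _ (by positivity)
    rw [mul_pow, Real.sq_sqrt (by positivity), norm_sq_matOp_quat, PiLp.norm_sq_eq_of_L2,
      Fin.sum_univ_two, norm_sq_piLp_punit, norm_sq_piLp_punit, hdr, mul_assoc, ← mul_add,
      norm_mul, hc, one_mul, one_mul, norm_add_sq_real, norm_add_sq_real, norm_mul, norm_mul, hb,
      hr1]
    have h1 := real_inner_le_norm (v 0 ⟨⟩) ((b + r) * v 1 ⟨⟩)
    rw [norm_mul, add_mul, inner_add_right] at h1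
    nlinarith [mul_nonneg (norm_nonneg (b + r)) (sq_nonneg (‖v 0 ⟨⟩‖ - ‖v 1 ⟨⟩‖))]
  have h4 : (2 : ℝ) ^ 2 ≤ 2 + ‖b + r‖ := by
    rw [← Real.sq_sqrt (x := 2 + ‖b + r‖) (by positivity)]
    exact pow_le_pow_left₀ zero_le_two (h.trans hbound) 2
  have h5 := parallelogram_law_with_norm ℝ b r
  rw [hb, hr1] at h5
  have h6 : ‖b - r‖ = 0 := by nlinarith [norm_nonneg (b - r)]
  exact sub_eq_zero.1 (norm_eq_zero.1 h6)

/-- There is no complex structure `J` on the quaternions for which the conjugations of `2 × 2`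
matrices by the unitary with diagonal entries `1` and `i` are isometric. -/
theorem no_complex_structure_quaternion (J : ℍ[ℝ] → ℍ[ℝ]) (hJ : ∀ a, ‖J a‖ = ‖a‖)
    (h : ∀ b c d : ℍ[ℝ], ‖matOp !![quat.{u} 1, quat b; quat c, quat d]‖ ≤
      ‖matOp !![quat.{u} 1, quat (-J b); quat (J c), quat d]‖) : False := by
  -- The matrix `[1, b; c, cb]` has norm at least 2, hence so does `[1, -Jb; Jc, cb]`, which forces
  -- `(Jc)(-Jb) = cb`.
  have key : ∀ b c : ℍ[ℝ], ‖b‖ = 1 → ‖c‖ = 1 → -J b = star (J c) * (c * b) := by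
    intro b c hb hc
    exact eq_of_two_le_norm_matOp_quat (by rw [norm_neg, hJ, hb]) (by rw [hJ, hc])
      (by rw [norm_mul, hb, hc, one_mul]) ((two_le_norm_matOp_quat.{u} hb hc).trans (h _ _ _))
  have h1 : ∀ b : ℍ[ℝ], ‖b‖ = 1 → -J b = star (J 1) * b := by
    intro b hb
    rw [key b 1 hb norm_one, one_mul]
  have h2 : ∀ c : ℍ[ℝ], ‖c‖ = 1 → -J c = c * star (J 1) := by
    intro c hc
    have h := congrArg star (key 1 c norm_one hc)
    have hc' : c * star c = 1 := by
      rw [Quaternion.self_mul_star, Quaternion.normSq_eq_norm_mul_self, hc]; simp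
    rw [mul_one, star_mul, star_star, star_neg] at h
    rw [← neg_neg (star (J 1)), h, mul_neg, ← mul_assoc, hc', one_mul]
  set w := star (J 1) with hw
  have hnorm : ∀ a : ℍ[ℝ], ‖a‖ * ‖a‖ = a.re ^ 2 + a.imI ^ 2 + a.imJ ^ 2 + a.imK ^ 2 := by
    intro a
    rw [← Quaternion.normSq_eq_norm_mul_self, Quaternion.normSq_def']
  have hone : ∀ a : ℍ[ℝ], a.re ^ 2 + a.imI ^ 2 + a.imJ ^ 2 + a.imK ^ 2 = 1 → ‖a‖ = 1 := by
    intro a ha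
    rw [← hnorm] at ha
    nlinarith [norm_nonneg a]
  -- Since `wb = -Jb = bw` for unit `b`, the quaternion `w` commutes with `i` and `j` and is real.
  -- By `e1` also `w = -w*`, so `w` has real part zero, although `‖w‖ = 1`.
  let unitI : ℍ[ℝ] := ⟨0, 1, 0, 0⟩
  let unitJ : ℍ[ℝ] := ⟨0, 0, 1, 0⟩
  have hi : ‖unitI‖ = 1 := hone _ (by simp [unitI])
  have hj : ‖unitJ‖ = 1 := hone _ (by simp [unitJ])
  have ei := (h1 _ hi).symm.trans (h2 _ hi)
  have ej := (h1 _ hj).symm.trans (h2 _ hj)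
  have e1 := h1 1 norm_one
  have hJ1 : J 1 = star w := by rw [hw, star_star]
  have hw1 : ‖w‖ = 1 := by rw [hw, norm_star, hJ, norm_one]
  rw [hJ1, mul_one] at e1
  have r0 := congrArg QuaternionAlgebra.re e1
  have i1 := congrArg QuaternionAlgebra.imI ej
  have i2 := congrArg QuaternionAlgebra.imJ ei
  have i3 := congrArg QuaternionAlgebra.imK ei
  simp at r0 i1 i2 i3
  have := hnorm w
  rw [hw1] at this
  have hk := congrArg QuaternionAlgebra.imK ej
  have hI : w.imI = 0 := by simp at hk; linarith
  have hJ' : w.imJ = 0 := by linarith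
  have hK : w.imK = 0 := by linarith
  have hR : w.re = 0 := by linarith
  rw [hI, hJ', hK, hR] at this
  norm_num at this

attribute [local instance] InnerProductSpace.complexToReal

section Multiplication

variable {H : Type*} [NormedAddCommGroup H] [InnerProductSpace ℂ H] {X : Submodule ℂ (H →L[ℂ] H)}

/-- Multiplication by `i` on a complex space, regarded as a real space. -/
noncomputable def mulI (x : realSpace X) : realSpace X :=
  realEquiv X (Complex.I • (realEquiv X).symm x)

theorem norm_realEquiv (x : X) : ‖(realEquiv X x : H →L[ℝ] H)‖ = ‖(x : H →L[ℂ] H)‖ :=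
  ContinuousLinearMap.norm_restrictScalars (x : H →L[ℂ] H)

theorem norm_mulI (x : realSpace X) : ‖(mulI x : H →L[ℝ] H)‖ = ‖(x : H →L[ℝ] H)‖ := by
  rw [mulI, norm_realEquiv, Submodule.coe_smul, norm_smul, Complex.norm_I, one_mul,
    ← norm_realEquiv, AddEquiv.apply_symm_apply]

theorem norm_matOp_conj_mulI (a b c d : realSpace X) :
    ‖matOp !![a, b; c, d]‖ = ‖matOp !![a, -mulI b; mulI c, d]‖ := by
  have hneg : ∀ y, (realEquiv X).symm (-y) = -(realEquiv X).symm y :=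
    AddMonoidHom.map_neg (realEquiv X).symm.toAddMonoidHom
  have hI : ∀ y, (realEquiv X).symm (mulI y) = Complex.I • (realEquiv X).symm y :=
    fun y => (realEquiv X).symm_apply_apply _
  have h1 : (!![a, b; c, d] : Matrix _ _ (realSpace X)).map (realEquiv X).symm =
      !![(realEquiv X).symm a, (realEquiv X).symm b;
        (realEquiv X).symm c, (realEquiv X).symm d] := by
    refine Matrix.ext fun i j => ?_
    fin_cases i <;> fin_cases j <;> rfl
  have h2 : (!![a, -mulI b; mulI c, d] : Matrix _ _ (realSpace X)).map (realEquiv X).symm =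
      !![(realEquiv X).symm a, -(Complex.I • (realEquiv X).symm b);
        Complex.I • (realEquiv X).symm c, (realEquiv X).symm d] := by
    rw [← hI, ← hI, ← hneg]
    refine Matrix.ext fun i j => ?_
    fin_cases i <;> fin_cases j <;> rfl
  rw [(matOp_real _).1, (matOp_real !![a, -mulI b; mulI c, d]).1, h1, h2, norm_matOp_conj_I]

end Multiplication

/-- No complex space of operators is, as a real space, completely isometric to the quaternions. -/
theorem no_completeIsometry_quaternion {H : Type*} [NormedAddCommGroup H] [InnerProductSpace ℂ H]
    {X : Submodule ℂ (H →L[ℂ] H)} (f : realSpace X →+ LinearMap.range quaternionOp.{u})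
    (g : LinearMap.range quaternionOp.{u} →+ realSpace X) (hgf : ∀ x, g (f x) = x)
    (hfg : ∀ y, f (g y) = y) (hf : CompletelyContractive f) (hg : CompletelyContractive g) :
    False := by
  have hgneg : ∀ y, g (-y) = -g y := AddMonoidHom.map_neg g
  -- `J` is multiplication by `i`, transported to the quaternions.
  choose J hJ using fun a => exists_eq_quat.{u} (f (mulI (g (quat a))))
  have hgJ : ∀ a, g (quat (J a)) = mulI (g (quat a)) := fun a => by rw [← hJ, hgf]
  have hq : ∀ a, ‖a‖ = ‖(quat.{u} a).1‖ := fun a => (norm_quaternionOp a).symm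
  refine no_complex_structure_quaternion.{u} J (fun a => le_antisymm ?_ ?_) fun b c d => ?_
  · rw [hq, hq, ← hJ]
    exact (hf.norm_le _).trans ((norm_mulI _).trans_le (hg.norm_le _))
  · rw [hq, hq]
    calc ‖(quat.{u} a).1‖ = ‖(f (g (quat a))).1‖ := by rw [hfg]
      _ ≤ ‖(g (quat a)).1‖ := hf.norm_le _
      _ = ‖(g (quat (J a))).1‖ := by rw [hgJ, norm_mulI]
      _ ≤ ‖(quat (J a)).1‖ := hg.norm_le _
  · have h1 := hf 2 !![g (quat 1), g (quat b); g (quat c), g (quat d)]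
    have h2 := hg 2 !![quat 1, quat (-J b); quat (J c), quat d]
    have h3 : (!![g (quat 1), g (quat b); g (quat c), g (quat d)] : Matrix _ _ _).map f =
        !![quat 1, quat b; quat c, quat d] := by
      refine Matrix.ext fun i j => ?_
      fin_cases i <;> fin_cases j <;> exact hfg _
    have h4 : (!![quat 1, quat (-J b); quat (J c), quat d] : Matrix _ _ _).map g =
        !![g (quat 1), -mulI (g (quat b)); mulI (g (quat c)), g (quat d)] := by
      rw [← hgJ, ← hgJ, ← hgneg, ← show quat.{u} (-J b) = -quat (J b) from
        Subtype.ext (map_neg quaternionOp (J b))]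
      refine Matrix.ext fun i j => ?_
      fin_cases i <;> fin_cases j <;> rfl
    rw [h3] at h1
    rw [h4] at h2
    exact h1.trans ((norm_matOp_conj_mulI _ _ _ _).trans_le h2)

theorem isEmpty_iso_quaternionSpace (k : OpKind) (Z : OpCat.{u} k ℂ ℂ) :
    IsEmpty ((forgetToReal.{u} k ℂ).obj Z ≅ quaternionSpace.{u} k) :=
  ⟨fun φ => no_completeIsometry_quaternion (X := Z.X) (OpHom.hom φ.hom) (OpHom.hom φ.inv)
    (iso_inv_hom_apply φ) (iso_hom_inv_apply φ)
    (OpHom.completelyContractive (fun _ => rfl) φ.hom)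
    (OpHom.completelyContractive (fun _ => rfl) φ.inv)⟩

theorem not_essSurj_forgetToReal (k : OpKind) : ¬ (forgetToReal.{u} k ℂ).EssSurj := fun _ =>
  (isEmpty_iso_quaternionSpace k _).false ((forgetToReal k ℂ).objObjPreimageIso (quaternionSpace k))

variable (G : Type v) [Group G]

theorem isEmpty_iso_quaternionSpaceG (k : OpKind) (Z : GOpCat.{u} G k ℂ ℂ) :
    IsEmpty ((forgetToRealG.{u} G k ℂ).obj Z ≅ (quaternionSpace.{u} k).trivialAction G) :=
  ⟨fun φ => (isEmpty_iso_quaternionSpace k Z.toOpCat).false (underlyingIso φ)⟩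

theorem not_essSurj_forgetToRealG (k : OpKind) : ¬ (forgetToRealG.{u} G k ℂ).EssSurj := fun _ =>
  (isEmpty_iso_quaternionSpaceG G k _).false
    ((forgetToRealG G k ℂ).objObjPreimageIso ((quaternionSpace k).trivialAction G))

end Quaternions

/-! ### Objects isomorphic to complexifications have conjugations. -/

/-- A complex space of operators completely isometric to a complexification has a conjugation. -/
theorem exists_conjugation_of_completelyContractive {H L : Type*} [NormedAddCommGroup H]
    [InnerProductSpace ℝ H] [NormedAddCommGroup L] [InnerProductSpace ℂ L]
    {X : Submodule ℝ (H →L[ℝ] H)} {Z : Submodule ℂ (L →L[ℂ] L)} (f : complexifySpace X →+ Z)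
    (g : Z →+ complexifySpace X) (hgf : ∀ x, g (f x) = x) (hfg : ∀ y, f (g y) = y)
    (hfs : ∀ (c : ℂ) x, f (c • x) = c • f x) (hgs : ∀ (c : ℂ) x, g (c • x) = c • g x)
    (hf : CompletelyContractive f) (hg : CompletelyContractive g) : ∃ θ : Z →+ Z,
      (∀ (c : ℂ) x, θ (c • x) = (starRingEnd ℂ) c • θ x) ∧ (∀ x, θ (θ x) = x) ∧
      (∀ x, ‖(θ x : L →L[ℂ] L)‖ = ‖(x : L →L[ℂ] L)‖) ∧
      (PreservesOne f → PreservesOne g → PreservesOne θ) ∧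
      (CompletelyPositive f → CompletelyPositive g → CompletelyPositive θ) := by
  let θ : Z →+ Z := AddMonoidHom.mk' (fun x => f (conjX (g x))) fun x y => by
    rw [map_add, conjX_add, map_add]
  have hθ : ∀ x, θ x = f (conjX (g x)) := fun _ => rfl
  have hθθ : ∀ x, θ (θ x) = x := fun x => by rw [hθ, hθ, hgf, conjX_conjX, hfg]
  have hconj : ∀ s : complexifySpace X, ‖(s : HilbertC H →L[ℂ] HilbertC H)‖ =
      ‖(conjX s : HilbertC H →L[ℂ] HilbertC H)‖ := by
    intro s
    rw [← (matOp_one_by_one s).1, ← (matOp_one_by_one (conjX s)).1]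
    exact (matOp_conjX _).1
  have hle : ∀ x, ‖(θ x : L →L[ℂ] L)‖ ≤ ‖(x : L →L[ℂ] L)‖ := fun x =>
    (hf.norm_le _).trans ((hconj _).symm.trans_le (hg.norm_le x))
  refine ⟨θ, fun c x => ?_, hθθ, fun x => le_antisymm (hle x) ?_, fun hf' hg' x hx => hf' _ ?_,
    fun hf' hg' n x hx => hf' n _ ((matOp_conjX _).2.1 (hg' n x hx))⟩
  · rw [hθ, hgs, conjX_smul, hfs, hθ]
  · conv_lhs => rw [← hθθ x]
    exact hle _
  · have h := hg' x hx
    rw [coe_eq_combine, combine_eq_one_iff] at h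
    change combine _ _ = 1
    rw [combine_eq_one_iff, h.1]
    exact ⟨rfl, by rw [Submodule.coe_neg, h.2, neg_zero]⟩

/-- A complex object isomorphic to a complexification has a conjugation. -/
theorem exists_conjugation {k : OpKind} {A : OpCat.{u} k ℝ ℝ} {Z : OpCat.{u} k ℂ ℂ}
    (φ : A.complexify ≅ Z) : ∃ θ : Z.X →+ Z.X,
      (∀ (c : ℂ) x, θ (c • x) = (starRingEnd ℂ) c • θ x) ∧ (∀ x, θ (θ x) = x) ∧
      (∀ x, ‖(θ x : Z.H →L[ℂ] Z.H)‖ = ‖(x : Z.H →L[ℂ] Z.H)‖) ∧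
      (k = .system → PreservesOne θ ∧ CompletelyPositive θ) := by
  obtain ⟨θ, h1, h2, h3, h4, h5⟩ := exists_conjugation_of_completelyContractive (X := A.X)
    (Z := Z.X) (OpHom.hom φ.hom) (OpHom.hom φ.inv) (iso_inv_hom_apply φ) (iso_hom_inv_apply φ)
    (OpHom.map_smul φ.hom) (OpHom.map_smul φ.inv)
    (by exact OpHom.completelyContractive (𝔽₁ := ℂ) (𝔽₂ := ℂ) (fun _ => rfl) φ.hom)
    (by exact OpHom.completelyContractive (𝔽₁ := ℂ) (𝔽₂ := ℂ) (fun _ => rfl) φ.inv)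
  refine ⟨θ, h1, h2, h3, ?_⟩
  rintro rfl
  exact ⟨h4 (OpHom.isMorphism φ.hom).1 (OpHom.isMorphism φ.inv).1,
    h5 (OpHom.isMorphism φ.hom).2 (OpHom.isMorphism φ.inv).2⟩

/-! ### A unital operator space without conjugation: affine functions on four points of ℂ. -/

section Quadrilateral

/-- The vertices of a quadrilateral without symmetries. -/
def vertex : Fin 4 → GaussianInt := ![0, 2, ⟨0, 1⟩, ⟨3, 2⟩]

/-- For each vertex, a point from which it is farther away than the other vertices. -/
def center : Fin 4 → GaussianInt := ![⟨3, 3⟩, ⟨0, 3⟩, 3, 0]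

theorem vertex_injective : Function.Injective vertex := by
  decide

/-- The value at a vertex of the affine function `z ↦ p + q z`. -/
noncomputable def affineEval (i : Fin 4) : ℂ × ℂ →ₗ[ℂ] ℂ where
  toFun p := p.1 + vertex i * p.2
  map_add' p q := by simp; ring
  map_smul' c p := by simp; ring

theorem affineEval_apply (i : Fin 4) (p : ℂ × ℂ) : affineEval i p = p.1 + vertex i * p.2 := rfl

/-- The pair `(-center j, 1)` is the function `z ↦ z - center j`; its modulus has a strict peak at
vertex `j`, by comparing integer norms. -/
theorem norm_affineEval_center_lt {i j : Fin 4} (h : i ≠ j) :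
    ‖affineEval i (-(center j : ℂ), 1)‖ < ‖affineEval j (-(center j : ℂ), 1)‖ := by
  have key : ∀ i j : Fin 4, i ≠ j →
      (vertex i - center j).norm < (vertex j - center j).norm := by decide
  have h1 : ∀ i, ‖affineEval i (-(center j : ℂ), 1)‖ ^ 2 = (vertex i - center j).norm := by
    intro i
    rw [affineEval_apply, Complex.sq_norm, GaussianInt.intCast_real_norm]
    congr 1
    simp [sub_eq_neg_add]
  apply lt_of_pow_lt_pow_left₀ 2 (norm_nonneg _)
  rw [h1, h1]
  exact_mod_cast key i j h

/-- With denominators cleared: the conjugate of the cross-ratio of the vertices is not their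
cross-ratio in any order. So no Möbius map takes the vertices to their conjugates. -/
theorem vertex_crossRatio : ∀ a b c d : Fin 4, a ≠ b → a ≠ c → a ≠ d → b ≠ c → b ≠ d → c ≠ d →
    star ((vertex 0 - vertex 1) * (vertex 2 - vertex 3)) *
      ((vertex a - vertex c) * (vertex b - vertex d)) ≠
    star ((vertex 0 - vertex 2) * (vertex 1 - vertex 3)) *
      ((vertex a - vertex b) * (vertex c - vertex d)) := by
  decide

/-- A conjugate linear isometry permutes the evaluations at the vertices, up to scalars. -/
theorem exists_affineEval_comp {N : ℂ × ℂ → ℝ} (hle : ∀ i p, ‖affineEval i p‖ ≤ N p)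
    (hN : ∀ p, ∃ i, N p = ‖affineEval i p‖) {T : ℂ × ℂ →+ ℂ × ℂ}
    (hT : ∀ (c : ℂ) p, T (c • p) = (starRingEnd ℂ) c • T p) (hNT : ∀ p, N (T p) = N p)
    (j : Fin 4) : ∃ i, ∀ p,
    affineEval i (T p) = affineEval i (T (1, 0)) * (starRingEnd ℂ) (affineEval j p) := by
  -- `x` peaks at `j`, and `i` is a vertex where `T x` attains its norm.
  set x : ℂ × ℂ := (-(center j : ℂ), 1) with hx
  have hxj : N x = ‖affineEval j x‖ := by
    obtain ⟨i, hi⟩ := hN x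
    by_cases hij : i = j
    · rw [hi, hij]
    · exact le_antisymm (hi.trans_le (norm_affineEval_center_lt hij).le) (hle _ _)
  obtain ⟨i, hi⟩ := hN (T x)
  have hw : ‖affineEval i (T x)‖ = ‖affineEval j x‖ := by rw [← hi, hNT, hxj]
  have hw0 : 0 < ‖affineEval i (T x)‖ := by
    rw [hw]
    obtain ⟨l, hl⟩ : ∃ l : Fin 4, l ≠ j := exists_ne j
    exact (norm_nonneg _).trans_lt (norm_affineEval_center_lt hl)
  have hker : ∀ y, affineEval j y = 0 → affineEval i (T y) = 0 := by
    intro y hy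
    by_contra hz
    set w := affineEval i (T x) with hwdef
    set z := affineEval i (T y) with hzdef
    -- Chosen so that `c̄ z = |z|² w`. Adding `ε c y` to `x` leaves the value at `j` unchanged and,
    -- for small `ε`, keeps the other values below it. But it multiplies the value of the image at
    -- `i` by `1 + ε |z|²`, against isometry.
    let c : ℂ := (starRingEnd ℂ) (w * (starRingEnd ℂ) z)
    have hev : ∀ᶠ ε : ℝ in nhds 0, ∀ l, l ≠ j →
        ‖affineEval l x + ((ε : ℂ) * c) * affineEval l y‖ < ‖affineEval j x‖ := by
      rw [Filter.eventually_all]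
      intro l
      by_cases hl : l = j
      · exact Filter.Eventually.of_forall fun _ h => absurd hl h
      · have hcont : Continuous fun ε : ℝ =>
            ‖affineEval l x + ((ε : ℂ) * c) * affineEval l y‖ := by fun_prop
        have h0 : ‖affineEval l x + (((0 : ℝ) : ℂ) * c) * affineEval l y‖ < ‖affineEval j x‖ := by
          simpa using norm_affineEval_center_lt hl
        filter_upwards [hcont.continuousAt.eventually_lt continuousAt_const h0] with ε hε _
        exact hε
    obtain ⟨ε, hε, hpos⟩ := ((hev.filter_mono nhdsWithin_le_nhds).and
      (self_mem_nhdsWithin : Set.Ioi (0 : ℝ) ∈ nhdsWithin 0 (Set.Ioi 0))).exists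
    have hpos : 0 < ε := hpos
    have hbound : N (x + ((ε : ℂ) * c) • y) ≤ ‖affineEval j x‖ := by
      obtain ⟨l, hl⟩ := hN (x + ((ε : ℂ) * c) • y)
      rw [hl, map_add, map_smul, smul_eq_mul]
      by_cases hlj : l = j
      · rw [hlj, hy, mul_zero, add_zero]
      · exact (hε l hlj).le
    have h1 := (hle i _).trans ((hNT _).trans_le hbound)
    rw [map_add, hT, map_add, map_smul, ← hw, ← hwdef, ← hzdef, smul_eq_mul] at h1
    have h2 : w + (starRingEnd ℂ) (ε * c) * z = ((1 + ε * ‖z‖ ^ 2 : ℝ) : ℂ) * w := by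
      have := Complex.conj_mul' z
      simp only [c, map_mul, Complex.conj_ofReal, Complex.conj_conj]
      push_cast
      linear_combination (ε * w) * this
    rw [h2, norm_mul, Complex.norm_real, Real.norm_of_nonneg (by positivity)] at h1
    have hz2 : 0 < ‖z‖ := norm_pos_iff.2 hz
    nlinarith [mul_pos (mul_pos hpos (pow_pos hz2 2)) hw0]
  refine ⟨i, fun p => ?_⟩
  -- The pair `(1, 0)` is the constant function 1; subtracting a multiple of it yields a function
  -- vanishing at `j`, so the factor is read off there.
  have h := hker (p - affineEval j p • (1, 0)) (by
    rw [map_sub, map_smul, affineEval_apply j (1, 0)]; simp)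
  rw [map_sub, hT, map_sub, map_smul, sub_eq_zero, smul_eq_mul] at h
  rw [h, mul_comm]

/-- With `T 1 = p₁ + p₂ z` and `T z = r₁ + r₂ z`, the conjugate of vertex `j` is `(r₁ + r₂ z) / (p₁
+ p₂ z)` at vertex `σ j`. Such a map preserves cross-ratios. -/
theorem no_affine_conjugation {N : ℂ × ℂ → ℝ} (hle : ∀ i p, ‖affineEval i p‖ ≤ N p)
    (hN : ∀ p, ∃ i, N p = ‖affineEval i p‖) {T : ℂ × ℂ →+ ℂ × ℂ}
    (hT : ∀ (c : ℂ) p, T (c • p) = (starRingEnd ℂ) c • T p) (hNT : ∀ p, N (T p) = N p)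
    (hTT : ∀ p, T (T p) = p) : False := by
  choose σ hσ using exists_affineEval_comp hle hN hT hNT
  have hcast : ∀ {x y : GaussianInt}, (x : ℂ) = y → x = y := fun h => GaussianInt.toComplex_inj.1 h
  let w (j : Fin 4) : ℂ := affineEval (σ j) (T (1, 0))
  have hw0 : ∀ j, w j ≠ 0 := by
    intro j h
    have h1 := hσ j (T (1, 0))
    rw [hTT, show affineEval (σ j) (T (1, 0)) = 0 from h, zero_mul, affineEval_apply] at h1
    simp at h1
  set p := T (1, 0) with hp
  set r := T (0, 1) with hr
  have hw : ∀ j, w j = p.1 + vertex (σ j) * p.2 := fun j => rfl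
  have hs : ∀ j, r.1 + vertex (σ j) * r.2 = w j * (starRingEnd ℂ) (vertex j) := by
    intro j
    have h := hσ j (0, 1)
    rw [affineEval_apply, affineEval_apply j] at h
    simpa using h
  have hinj : ∀ j l, j ≠ l → σ j ≠ σ l := by
    intro j l hjl h
    have h1 := hs j
    rw [h, hs l, show w j = w l by rw [hw, hw, h]] at h1
    have h2 := mul_left_cancel₀ (hw0 l) h1
    exact hjl (vertex_injective (hcast ((starRingEnd ℂ).injective h2))).symm
  -- The difference formula for a Möbius map. In the cross-ratio each `w j` and the determinant
  -- occur equally often in numerator and denominator.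
  have hd : ∀ j l, (starRingEnd ℂ) ((vertex j : ℂ) - vertex l) * (w j * w l) =
      (p.1 * r.2 - r.1 * p.2) * (vertex (σ j) - vertex (σ l)) := by
    intro j l
    have h1 := hs j
    have h2 := hs l
    have h3 := hw j
    have h4 := hw l
    rw [map_sub]
    calc _ = (w j * (starRingEnd ℂ) (vertex j)) * w l -
          (w l * (starRingEnd ℂ) (vertex l)) * w j := by ring
      _ = _ := by rw [← h1, ← h2, h3, h4]; ring
  have hΔ : p.1 * r.2 - r.1 * p.2 ≠ 0 := by
    intro h
    have h1 := hd 0 1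
    rw [h, zero_mul, mul_eq_zero, or_iff_left (mul_ne_zero (hw0 0) (hw0 1))] at h1
    have h2 := (map_eq_zero (starRingEnd ℂ)).1 h1
    exact absurd (vertex_injective (hcast (sub_eq_zero.1 h2))) (by decide)
  refine vertex_crossRatio (σ 0) (σ 1) (σ 2) (σ 3) (hinj _ _ (by decide)) (hinj _ _ (by decide))
    (hinj _ _ (by decide)) (hinj _ _ (by decide)) (hinj _ _ (by decide)) (hinj _ _ (by decide))
    (hcast ?_)
  have hstar : ∀ x : GaussianInt, ((star x : GaussianInt) : ℂ) = (starRingEnd ℂ) x :=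
    GaussianInt.toComplex_star
  simp only [hstar, GaussianInt.toComplex_sub, map_mul]
  apply mul_left_cancel₀ (mul_ne_zero (pow_ne_zero 2 hΔ)
    (mul_ne_zero (mul_ne_zero (hw0 0) (hw0 1)) (mul_ne_zero (hw0 2) (hw0 3))))
  set Δ := p.1 * r.2 - r.1 * p.2
  calc
    _ = Δ ^ 2 * ((starRingEnd ℂ) ((vertex 0 : ℂ) - vertex 1) * (w 0 * w 1)) *
        ((starRingEnd ℂ) ((vertex 2 : ℂ) - vertex 3) * (w 2 * w 3)) *
        (((vertex (σ 0) : ℂ) - vertex (σ 2)) * (vertex (σ 1) - vertex (σ 3))) := by ring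
    _ = Δ ^ 2 * ((starRingEnd ℂ) ((vertex 0 : ℂ) - vertex 2) * (w 0 * w 2)) *
        ((starRingEnd ℂ) ((vertex 1 : ℂ) - vertex 3) * (w 1 * w 3)) *
        (((vertex (σ 0) : ℂ) - vertex (σ 1)) * (vertex (σ 2) - vertex (σ 3))) := by
      rw [hd, hd, hd, hd]; ring
    _ = _ := by ring

/-- The Hilbert space of dimension four. -/
abbrev FourSpace : Type u := EuclideanSpace ℂ (ULift.{u} (Fin 4))

/-- The diagonal operator given by the values of an affine function at the vertices. -/
noncomputable def affineOp : ℂ × ℂ →ₗ[ℂ] (FourSpace.{u} →L[ℂ] FourSpace.{u}) where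
  toFun p := LinearMap.toContinuousLinearMap
    { toFun := fun v => WithLp.toLp 2 fun i => affineEval i.down p * v i
      map_add' := fun v w => by ext i; simp [mul_add]
      map_smul' := fun c v => by ext i; simp; ring }
  map_add' p q := by ext v i; simp [add_mul]
  map_smul' c p := by ext v i; simp [mul_assoc]

theorem affineOp_apply (p : ℂ × ℂ) (v : FourSpace.{u}) (i : ULift.{u} (Fin 4)) :
    affineOp p v i = affineEval i.down p * v i := rfl

theorem norm_affineEval_le (i : Fin 4) (p : ℂ × ℂ) : ‖affineEval i p‖ ≤ ‖affineOp.{u} p‖ := by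
  have h := (affineOp.{u} p).le_opNorm (EuclideanSpace.single ⟨i⟩ 1)
  have h1 : affineOp.{u} p (EuclideanSpace.single ⟨i⟩ 1) =
      affineEval i p • EuclideanSpace.single ⟨i⟩ 1 := by
    ext j
    rw [affineOp_apply, PiLp.smul_apply, smul_eq_mul]
    by_cases hj : j = ⟨i⟩
    · rw [hj]
    · simp [hj]
  rw [h1, norm_smul] at h
  simpa using h

theorem exists_norm_affineOp_eq (p : ℂ × ℂ) : ∃ i, ‖affineOp.{u} p‖ = ‖affineEval i p‖ := by
  obtain ⟨i, hi⟩ := Finite.exists_max fun i => ‖affineEval i p‖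
  refine ⟨i, le_antisymm ?_ (norm_affineEval_le i p)⟩
  refine ContinuousLinearMap.opNorm_le_bound _ (norm_nonneg _) fun v => ?_
  apply le_of_sq_le_sq _ (by positivity)
  rw [mul_pow, EuclideanSpace.norm_sq_eq, EuclideanSpace.norm_sq_eq, Finset.mul_sum]
  refine Finset.sum_le_sum fun j _ => ?_
  rw [affineOp_apply, norm_mul, mul_pow]
  gcongr
  exact hi _

/-- The affine functions on the vertices of the quadrilateral, as a (unital) operator space. -/
noncomputable def affineSpace (k : OpKind) (hk : k ≠ .system) : OpCat.{u} k ℂ ℂ where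
  H := FourSpace.{u}
  X := LinearMap.range affineOp.{u}
  one_mem _ := ⟨(1, 0), by ext v i; simp [affineOp_apply, affineEval_apply]⟩
  star_mem h := absurd h hk

/-- Only the norms of single elements are used, so one argument covers operator spaces and unital
ones. -/
theorem isEmpty_iso_affineSpace (k : OpKind) (hk : k ≠ .system) (A : OpCat.{u} k ℝ ℝ) :
    IsEmpty (A.complexify ≅ affineSpace k hk) := by
  refine ⟨fun φ => ?_⟩
  obtain ⟨θ, h1, h2, h3, -⟩ : ∃ θ : LinearMap.range affineOp.{u} →+ LinearMap.range affineOp.{u},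
    (∀ (c : ℂ) x, θ (c • x) = (starRingEnd ℂ) c • θ x) ∧ (∀ x, θ (θ x) = x) ∧
      (∀ x, ‖(θ x).1‖ = ‖x.1‖) ∧ _ := exists_conjugation φ
  have hinj : Function.Injective affineOp.{u} := by
    rw [injective_iff_map_eq_zero]
    intro p hp
    have h : ∀ i, affineEval i p = 0 := fun i => by
      have := norm_affineEval_le.{u} i p
      rwa [hp, norm_zero, norm_le_zero_iff] at this
    have ha := h 0
    have hb := h 1
    simp [affineEval_apply, vertex] at ha hb
    rw [ha, zero_add] at hb
    exact Prod.ext ha (by simpa using hb)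
  let e := LinearEquiv.ofInjective affineOp.{u} hinj
  have he : ∀ p, (e p).1 = affineOp p := fun _ => rfl
  have he' : ∀ x, affineOp (e.symm x) = x.1 := fun x => by rw [← he, e.apply_symm_apply]
  refine no_affine_conjugation (N := fun p => ‖affineOp.{u} p‖) norm_affineEval_le
    exists_norm_affineOp_eq
    (T := (e.symm.toLinearMap.toAddMonoidHom.comp θ).comp e.toLinearMap.toAddMonoidHom)
    (fun c p => ?_) (fun p => ?_) (fun p => ?_)
  · change e.symm (θ (e (c • p))) = _ • e.symm (θ (e p))
    rw [map_smul, h1, map_smul]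
  · change ‖affineOp (e.symm (θ (e p)))‖ = _
    rw [he', h3, he]
  · change e.symm (θ (e (e.symm (θ (e p))))) = p
    rw [e.apply_symm_apply, h2, e.symm_apply_apply]

end Quadrilateral

/-! ### Rigidity of an asymmetric octahedron. -/

section Octahedron

/-- The vertices of an octahedron without symmetries, multiplied by four. -/
def octVertex : Fin 6 → Fin 3 → ℤ :=
  ![![7, 0, 0], ![-8, 0, 0], ![0, 7, 0], ![0, -9, 0], ![0, 0, 7], ![0, 0, -10]]

/-- The value at a vertex of the octahedron of an affine function. -/
noncomputable def octEval (i : Fin 6) : (Fin 4 → ℝ) →ₗ[ℝ] ℝ where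
  toFun y := y 0 + ((octVertex i 0 : ℝ) * y 1 + octVertex i 1 * y 2 + octVertex i 2 * y 3) / 4
  map_add' x y := by simp; ring
  map_smul' c y := by simp; ring

theorem octEval_apply (i : Fin 6) (y : Fin 4 → ℝ) : octEval i y =
    y 0 + ((octVertex i 0 : ℝ) * y 1 + octVertex i 1 * y 2 + octVertex i 2 * y 3) / 4 := rfl

/-- An affine function which vanishes at one vertex and is positive at the others. -/
def octPoint : Fin 6 → Fin 4 → ℝ :=
  ![![7, -4, 0, 0], ![8, 4, 0, 0], ![7, 0, -4, 0], ![9, 0, 4, 0], ![7, 0, 0, -4], ![10, 0, 0, 4]]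

theorem octEval_octPoint_self (j : Fin 6) : octEval j (octPoint j) = 0 := by
  fin_cases j <;> simp [octEval_apply, octVertex, octPoint] <;> norm_num

theorem octEval_octPoint_pos {i j : Fin 6} (h : i ≠ j) : 0 < octEval i (octPoint j) := by
  fin_cases j <;> fin_cases i <;> first | exact absurd rfl h | skip
  all_goals simp [octEval_apply, octVertex, octPoint]
  all_goals norm_num

-- Opposite vertices satisfy `8 v₀ + 7 v₁ = 0` and `9 v₂ + 7 v₃ = 0`. The factors 16 and 15 equalize
-- the total weights, which makes this an affine relation; among distinct vertices it holds in one
-- order only.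
set_option synthInstance.maxSize 1000 in
set_option synthInstance.maxHeartbeats 200000 in
theorem octVertex_relation₁ : ∀ a b c d : Fin 6, [a, b, c, d].Nodup →
    (∀ m, 16 * (8 * octVertex a m + 7 * octVertex b m) =
      15 * (9 * octVertex c m + 7 * octVertex d m)) → a = 0 ∧ b = 1 ∧ c = 2 ∧ d = 3 := by
  decide +kernel

/-- The unequal ratio 10 : 7 singles out the third diagonal and its direction. -/
theorem octVertex_relation₂ : ∀ c d : Fin 6, c ≠ d →
    (∀ m, 0 = 10 * octVertex c m + 7 * octVertex d m) → c = 4 ∧ d = 5 := by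
  decide +kernel

theorem exists_pos_forall_mul_lt {ι : Type*} [Finite ι] (f g : ι → ℝ) :
    ∃ ε > 0, ∀ i, 0 < f i → ε * |g i| < f i := by
  have h : ∀ᶠ ε : ℝ in nhds 0, ∀ i, 0 < f i → ε * |g i| < f i := by
    rw [Filter.eventually_all]
    intro i
    by_cases hi : 0 < f i
    · have hc : Continuous fun ε : ℝ => ε * |g i| := by fun_prop
      filter_upwards [hc.continuousAt.eventually_lt continuousAt_const
        (by simpa using hi : (0 : ℝ) * |g i| < f i)] with ε hε _
      exact hε
    · exact Filter.Eventually.of_forall fun _ h => absurd h hi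
  obtain ⟨ε, h1, h2⟩ := ((h.filter_mono nhdsWithin_le_nhds).and
    (self_mem_nhdsWithin : Set.Ioi (0 : ℝ) ∈ nhdsWithin 0 (Set.Ioi 0))).exists
  exact ⟨ε, h2, h1⟩

/-- The constant function with value one. -/
def octOne : Fin 4 → ℝ := ![1, 0, 0, 0]

theorem octEval_octOne (i : Fin 6) : octEval i octOne = 1 := by
  simp [octEval_apply, octOne]

/-- A unital positive involution permutes the evaluations at the vertices. -/
theorem exists_octEval_comp {S : (Fin 4 → ℝ) →ₗ[ℝ] (Fin 4 → ℝ)}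
    (hS : ∀ y, (∀ i, 0 ≤ octEval i y) → ∀ i, 0 ≤ octEval i (S y)) (h1 : S octOne = octOne)
    (hSS : ∀ y, S (S y) = y) (j : Fin 6) : ∃ i, ∀ y, octEval i (S y) = octEval j y := by
  have hx : ∀ k, 0 ≤ octEval k (octPoint j) := by
    intro k
    by_cases hk : k = j
    · rw [hk, octEval_octPoint_self]
    · exact (octEval_octPoint_pos hk).le
  -- Otherwise `S x ≥ ε` for some `ε > 0`, and applying `S` again gives `x ≥ ε`, although `x`
  -- vanishes at `j`.
  obtain ⟨i, hi⟩ : ∃ i, octEval i (S (octPoint j)) = 0 := by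
    by_contra! hne
    obtain ⟨ε, hε, h⟩ := exists_pos_forall_mul_lt (fun i => octEval i (S (octPoint j)))
      (fun _ => 1)
    have h2 := hS (S (octPoint j) - ε • octOne) (fun i => by
      have := h i ((hS _ hx i).lt_of_ne' (hne i))
      rw [abs_one] at this
      rw [map_sub, map_smul, octEval_octOne, smul_eq_mul]
      linarith) j
    rw [map_sub, hSS, map_smul, h1, map_sub, octEval_octPoint_self, map_smul, octEval_octOne,
      smul_eq_mul] at h2
    linarith
  have hker : ∀ y, octEval j y = 0 → octEval i (S y) = 0 := by
    intro y hy
    obtain ⟨ε, hε, h⟩ := exists_pos_forall_mul_lt (fun k => octEval k (octPoint j))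
      (fun k => octEval k y)
    -- If `y` vanishes at `j` then `x ± ε y` are both positive; as `S x` vanishes at `i`, the value
    -- of `S y` there has both signs.
    have hs : ∀ s : ℝ, |s| = ε → 0 ≤ s * octEval i (S y) := by
      intro s hs
      have h2 := hS (octPoint j + s • y) (fun k => by
        rw [map_add, map_smul, smul_eq_mul]
        by_cases hk : k = j
        · rw [hk, octEval_octPoint_self, hy]; simp
        · have := h k (octEval_octPoint_pos hk)
          have h3 := neg_abs_le (s * octEval k y)
          rw [abs_mul, hs] at h3
          linarith) i
      rwa [map_add, map_add, hi, map_smul, map_smul, zero_add, smul_eq_mul] at h2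
    have h3 := hs ε (abs_of_pos hε)
    have h4 := hs (-ε) (by rw [abs_neg, abs_of_pos hε])
    have h5 : ε * octEval i (S y) = 0 := by linarith
    exact (mul_eq_zero.1 h5).resolve_left hε.ne'
  refine ⟨i, fun y => ?_⟩
  have h := hker (y - octEval j y • octOne) (by
    rw [map_sub, map_smul, octEval_octOne, smul_eq_mul, mul_one, sub_self])
  rwa [map_sub, map_smul, h1, map_sub, map_smul, octEval_octOne, smul_eq_mul, mul_one,
    sub_eq_zero] at h

/-- The octahedron has no symmetry of order two. -/
theorem octahedron_rigid {S : (Fin 4 → ℝ) →ₗ[ℝ] (Fin 4 → ℝ)}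
    (hS : ∀ y, (∀ i, 0 ≤ octEval i y) → ∀ i, 0 ≤ octEval i (S y)) (h1 : S octOne = octOne)
    (hSS : ∀ y, S (S y) = y) (y : Fin 4 → ℝ) : S y = y := by
  choose σ hσ using exists_octEval_comp hS h1 hSS
  have hinj : ∀ i j, i ≠ j → σ i ≠ σ j := by
    intro i j hij h
    have h2 := octEval_octPoint_pos hij
    rw [← hσ, h, hσ, octEval_octPoint_self] at h2
    exact h2.false
  have hev : ∀ j u, octEval (σ j) u = octEval j (S u) := fun j u => by rw [← hσ j (S u), hSS]
  -- The affine relations between the vertices pass through `S` to the permuted vertices, and so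
  -- determine `σ`.
  have hr1 : ∀ u, 16 * (8 * octEval (σ 0) u + 7 * octEval (σ 1) u) =
      15 * (9 * octEval (σ 2) u + 7 * octEval (σ 3) u) := by
    intro u
    simp only [hev, octEval_apply]
    simp [octVertex]
    ring
  have hr2 : ∀ u, 17 * (8 * octEval (σ 0) u + 7 * octEval (σ 1) u) =
      15 * (10 * octEval (σ 4) u + 7 * octEval (σ 5) u) := by
    intro u
    simp only [hev, octEval_apply]
    simp [octVertex]
    ring
  have hb : ∀ m : Fin 3, ∃ u, ∀ i, octEval i u = octVertex i m := by
    intro m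
    fin_cases m
    · exact ⟨![0, 4, 0, 0], fun i => by simp [octEval_apply]⟩
    · exact ⟨![0, 0, 4, 0], fun i => by simp [octEval_apply]⟩
    · exact ⟨![0, 0, 0, 4], fun i => by simp [octEval_apply]⟩
  obtain ⟨s0, s1, s2, s3⟩ := octVertex_relation₁ (σ 0) (σ 1) (σ 2) (σ 3)
    (List.Nodup.map (f := σ) (l := [0, 1, 2, 3]) (fun i j h => by_contra fun h' => hinj i j h' h)
      (by decide)) (fun m => by
      obtain ⟨u, hu⟩ := hb m
      have := hr1 u
      simp only [hu] at this
      exact_mod_cast this)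
  obtain ⟨s4, s5⟩ := octVertex_relation₂ (σ 4) (σ 5) (hinj _ _ (by decide)) (fun m => by
    obtain ⟨u, hu⟩ := hb m
    have := hr2 u
    have h01 : ∀ m, 8 * octVertex 0 m + 7 * octVertex 1 m = 0 := by decide
    have h01 := h01 m
    simp only [hu, s0, s1] at this
    have h3 : 17 * (8 * octVertex 0 m + 7 * octVertex 1 m) =
      15 * (10 * octVertex (σ 4) m + 7 * octVertex (σ 5) m) := by exact_mod_cast this
    omega)
  have e0 := hσ 0 y
  have e1 := hσ 1 y
  have e2 := hσ 2 y
  have e4 := hσ 4 y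
  rw [s0] at e0
  rw [s1] at e1
  rw [s2] at e2
  rw [s4] at e4
  simp [octEval_apply, octVertex] at e0 e1 e2 e4
  ext m
  fin_cases m <;> simp <;> linarith

end Octahedron

/-! ### An operator system without conjugation: the octahedron together with the Pauli matrices. -/

section Octahedron

/-- The Hilbert space of dimension eight, as a direct sum of `ℂ⁶` and `ℂ²`. -/
abbrev EightSpace : Type u := EuclideanSpace ℂ (ULift.{u} (Fin 6 ⊕ Fin 2))

/-- The complex linear extension of `octEval`. -/
noncomputable def octEvalC (i : Fin 6) (z : Fin 4 → ℂ) : ℂ :=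
  z 0 + ((octVertex i 0 : ℂ) * z 1 + octVertex i 1 * z 2 + octVertex i 2 * z 3) / 4

/-- The Pauli matrix `z₀ + z₁ σ₁ + z₂ σ₂ + z₃ σ₃`. -/
noncomputable def pauli (z : Fin 4 → ℂ) : Matrix (Fin 2) (Fin 2) ℂ :=
  !![z 0 + z 3, z 1 - Complex.I * z 2; z 1 + Complex.I * z 2, z 0 - z 3]

/-- The values of `z` at the vertices of the octahedron, and its Pauli matrix. -/
noncomputable def octOp : (Fin 4 → ℂ) →ₗ[ℂ] (EightSpace.{u} →L[ℂ] EightSpace.{u}) where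
  toFun z := LinearMap.toContinuousLinearMap
    { toFun := fun v => WithLp.toLp 2 fun i => Sum.elim (fun i => octEvalC i z * v ⟨.inl i⟩)
        (fun a => pauli z a 0 * v ⟨.inr 0⟩ + pauli z a 1 * v ⟨.inr 1⟩) i.down
      map_add' := fun v w => by
        ext ⟨i | i⟩
        · simp [mul_add]
        · simp; ring
      map_smul' := fun c v => by
        ext ⟨i | i⟩
        · simp; ring
        · simp; ring }
  map_add' z w := by
    ext v ⟨i | i⟩
    · simp [octEvalC]; ring
    · fin_cases i <;> simp [pauli] <;> ring
  map_smul' c z := by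
    ext v ⟨i | i⟩
    · simp [octEvalC]; ring
    · fin_cases i <;> simp [pauli] <;> ring

theorem octOp_apply_inl (z : Fin 4 → ℂ) (v : EightSpace.{u}) (i : Fin 6) :
    octOp z v ⟨.inl i⟩ = octEvalC i z * v ⟨.inl i⟩ := rfl

theorem octOp_apply_inr (z : Fin 4 → ℂ) (v : EightSpace.{u}) (a : Fin 2) :
    octOp z v ⟨.inr a⟩ = pauli z a 0 * v ⟨.inr 0⟩ + pauli z a 1 * v ⟨.inr 1⟩ := rfl

theorem inner_eightSpace (v w : EightSpace.{u}) : ⟪v, w⟫_ℂ =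
    ∑ i : Fin 6, w ⟨.inl i⟩ * (starRingEnd ℂ) (v ⟨.inl i⟩) +
      (w ⟨.inr 0⟩ * (starRingEnd ℂ) (v ⟨.inr 0⟩) + w ⟨.inr 1⟩ * (starRingEnd ℂ) (v ⟨.inr 1⟩)) := by
  rw [PiLp.inner_apply, ← Equiv.ulift.symm.sum_comp, Fintype.sum_sum_type, Fin.sum_univ_two]
  rfl

theorem star_octOp (z : Fin 4 → ℂ) :
    star (octOp.{u} z) = octOp fun i => (starRingEnd ℂ) (z i) := by
  rw [ContinuousLinearMap.star_eq_adjoint]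
  symm
  rw [ContinuousLinearMap.eq_adjoint_iff]
  intro v w
  rw [inner_eightSpace, inner_eightSpace]
  congr 1
  · refine Finset.sum_congr rfl fun i _ => ?_
    have h4 : (starRingEnd ℂ) 4 = 4 := map_ofNat _ 4
    simp only [octOp_apply_inl]
    simp [octEvalC, h4]
    ring
  · simp only [octOp_apply_inr]
    simp [pauli]
    ring

theorem octOp_one : octOp.{u} ![1, 0, 0, 0] = 1 := by
  ext v ⟨i | i⟩
  · rw [octOp_apply_inl]; simp [octEvalC]
  · rw [octOp_apply_inr]; fin_cases i <;> simp [pauli]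

/-- The operator system of affine functions on the octahedron. -/
noncomputable def octSystem : OpCat.{u} .system ℂ ℂ where
  H := EightSpace.{u}
  X := LinearMap.range octOp.{u}
  one_mem _ := ⟨_, octOp_one⟩
  star_mem := by
    rintro - _ ⟨z, rfl⟩
    exact ⟨_, (star_octOp z).symm⟩

theorem octOp_injective : Function.Injective octOp.{u} := by
  rw [injective_iff_map_eq_zero]
  intro z hz
  have h : ∀ a, pauli z a 0 = 0 ∧ pauli z a 1 = 0 := by
    intro a
    have h0 : octOp.{u} z (EuclideanSpace.single ⟨.inr 0⟩ 1) ⟨.inr a⟩ = 0 := by rw [hz]; rfl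
    have h1 : octOp.{u} z (EuclideanSpace.single ⟨.inr 1⟩ 1) ⟨.inr a⟩ = 0 := by rw [hz]; rfl
    rw [octOp_apply_inr] at h0 h1
    exact ⟨by simpa using h0, by simpa using h1⟩
  obtain ⟨h1, h2⟩ := h 0
  obtain ⟨h3, h4⟩ := h 1
  simp [pauli] at h1 h2 h3 h4
  ext i
  fin_cases i
  · simp; linear_combination (h1 + h4) / 2
  · simp; linear_combination (h2 + h3) / 2
  · simp; linear_combination (-Complex.I / 2) * (h3 - h2) + z 2 * Complex.I_mul_I
  · simp; linear_combination (h1 - h4) / 2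

/-- An affine function is positive on the ball if it is positive on the octahedron. -/
theorem sq_le_of_octEval_nonneg {y : Fin 4 → ℝ} (h : ∀ i, 0 ≤ octEval i y) :
    0 ≤ y 0 ∧ y 1 ^ 2 + y 2 ^ 2 + y 3 ^ 2 ≤ y 0 ^ 2 := by
  have h0 := h 0
  have h1 := h 1
  have h2 := h 2
  have h3 := h 3
  have h4 := h 4
  have h5 := h 5
  simp [octEval_apply, octVertex] at h0 h1 h2 h3 h4 h5
  have hy : 0 ≤ y 0 := by linarith
  -- This bounds `|yₖ|` by `4/7` of `y₀`, and `3 · 16/49 < 1`. Equivalently, all vertices lie at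
  -- distance at least `7/4 > √3`, so the octahedron contains the unit ball.
  have key : ∀ t, 0 ≤ y 0 + 7 * t / 4 → 0 ≤ y 0 - 7 * t / 4 → 49 * t ^ 2 ≤ 16 * y 0 ^ 2 := by
    intro t ha hb
    nlinarith [mul_nonneg ha hb]
  have k1 : 0 ≤ y 0 - 7 * y 1 / 4 := by
    rcases le_total 0 (y 1) with h | h <;> linarith
  have k2 : 0 ≤ y 0 - 7 * y 2 / 4 := by
    rcases le_total 0 (y 2) with h | h <;> linarith
  have k3 : 0 ≤ y 0 - 7 * y 3 / 4 := by
    rcases le_total 0 (y 3) with h | h <;> linarith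
  have m1 := key _ h0 k1
  have m2 := key _ h2 k2
  have m3 := key _ h4 k3
  exact ⟨hy, by nlinarith⟩

/-- This is the form of a Pauli matrix at `(p, q)`, with `A = |p|²`, `B = |q|²` and `R + iS = p̄ q`.
Cauchy–Schwarz bounds the mixed term by twice the geometric mean of the two diagonal terms. -/
theorem pauli_form_nonneg {t a b c A B R S : ℝ} (ht : 0 ≤ t) (h : a ^ 2 + b ^ 2 + c ^ 2 ≤ t ^ 2)
    (hA : 0 ≤ A) (hB : 0 ≤ B) (hRS : R ^ 2 + S ^ 2 = A * B) :
    0 ≤ (t + c) * A + (t - c) * B + 2 * (a * R + b * S) := by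
  have hc : |c| ≤ t := abs_le_of_sq_le_sq (by nlinarith [sq_nonneg a, sq_nonneg b]) ht
  have hc := abs_le.1 hc
  have hp : 0 ≤ (t + c) * A := mul_nonneg (by linarith) hA
  have hq : 0 ≤ (t - c) * B := mul_nonneg (by linarith) hB
  have h1 : (a * R + b * S) ^ 2 ≤ (a ^ 2 + b ^ 2) * (R ^ 2 + S ^ 2) := by
    nlinarith [sq_nonneg (a * S - b * R)]
  have h2 : (a ^ 2 + b ^ 2) * (R ^ 2 + S ^ 2) ≤ ((t + c) * A) * ((t - c) * B) := by
    rw [hRS]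
    nlinarith [mul_nonneg hA hB]
  have h3 : (2 * (a * R + b * S)) ^ 2 ≤ ((t + c) * A + (t - c) * B) ^ 2 := by
    nlinarith [sq_nonneg ((t + c) * A - (t - c) * B)]
  have := abs_le.1 (abs_le_of_sq_le_sq h3 (by linarith))
  linarith

theorem octEvalC_ofReal (i : Fin 6) (y : Fin 4 → ℝ) :
    octEvalC i (fun k => (y k : ℂ)) = octEval i y := by
  simp [octEvalC, octEval_apply]

/-- Nonnegativity at the vertices implies it on the ball inside, which makes the Pauli block
positive as well. -/
theorem octOp_isPositive {y : Fin 4 → ℝ} (h : ∀ i, 0 ≤ octEval i y) :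
    (octOp.{u} fun k => (y k : ℂ)).IsPositive := by
  rw [isPositive_iff_re]
  constructor
  · intro v w
    congr 1
    have hs : ContinuousLinearMap.adjoint (octOp.{u} fun k => (y k : ℂ)) = octOp fun k => (y k : ℂ) := by
      rw [← ContinuousLinearMap.star_eq_adjoint, star_octOp]; simp
    conv_rhs => rw [← hs]
    rw [ContinuousLinearMap.adjoint_inner_right]
  · intro v
    rw [inner_eightSpace, map_add, map_sum]
    apply add_nonneg
    · refine Finset.sum_nonneg fun i _ => ?_
      rw [octOp_apply_inl, octEvalC_ofReal]
      have : RCLike.re (v ⟨.inl i⟩ * (starRingEnd ℂ) ((octEval i y : ℂ) * v ⟨.inl i⟩)) =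
          octEval i y * Complex.normSq (v ⟨.inl i⟩) := by
        simp [Complex.normSq_apply]; ring
      rw [this]
      exact mul_nonneg (h i) (Complex.normSq_nonneg _)
    · obtain ⟨h0, h1⟩ := sq_le_of_octEval_nonneg h
      set p := v ⟨.inr 0⟩ with hp
      set q := v ⟨.inr 1⟩ with hq
      have hRS : (p.re * q.re + p.im * q.im) ^ 2 + (p.re * q.im - p.im * q.re) ^ 2 =
          Complex.normSq p * Complex.normSq q := by
        simp [Complex.normSq_apply]; ring
      have := pauli_form_nonneg h0 h1 (Complex.normSq_nonneg p) (Complex.normSq_nonneg q) hRS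
      refine this.trans_eq ?_
      simp only [octOp_apply_inr, ← hp, ← hq]
      simp [pauli, Complex.normSq_apply]
      ring

theorem octEvalC_nonneg_of_isPositive {z : Fin 4 → ℂ} (h : (octOp.{u} z).IsPositive) (i : Fin 6) :
    (octEvalC i z).im = 0 ∧ 0 ≤ (octEvalC i z).re := by
  have h1 := (ContinuousLinearMap.isPositive_iff_complex _).1 h (EuclideanSpace.single ⟨.inl i⟩ 1)
  have h2 : ⟪octOp.{u} z (EuclideanSpace.single ⟨.inl i⟩ 1), EuclideanSpace.single ⟨.inl i⟩ 1⟫_ℂ =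
      (starRingEnd ℂ) (octEvalC i z) := by
    rw [EuclideanSpace.inner_single_right, octOp_apply_inl]
    simp
  rw [h2] at h1
  have h3 := congrArg Complex.im h1.1
  exact ⟨by simpa using h3.symm, by simpa using h1.2⟩

/-- The imaginary part is an affine function vanishing at the vertices 0, 1, 2, 4, which are
affinely independent. -/
theorem exists_ofReal_of_isPositive {z : Fin 4 → ℂ} (h : (octOp.{u} z).IsPositive) :
    ∃ y : Fin 4 → ℝ, (z = fun k => (y k : ℂ)) ∧ ∀ i, 0 ≤ octEval i y := by
  have hi := octEvalC_nonneg_of_isPositive h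
  have hz : z = fun k => ((z k).re : ℂ) := by
    have e0 := (hi 0).1
    have e1 := (hi 1).1
    have e2 := (hi 2).1
    have e4 := (hi 4).1
    simp [octEvalC, octVertex] at e0 e1 e2 e4
    ext k
    apply Complex.ext
    · simp
    · fin_cases k <;> simp <;> linarith
  refine ⟨fun k => (z k).re, hz, fun i => ?_⟩
  have h1 := (hi i).2
  rw [hz, octEvalC_ofReal] at h1
  exact h1

/-- A unital positive conjugate linear involution is the conjugation. -/
theorem eq_conj_of_positive_involution {T : (Fin 4 → ℂ) →+ (Fin 4 → ℂ)}
    (hT : ∀ (c : ℂ) z, T (c • z) = (starRingEnd ℂ) c • T z) (hTT : ∀ z, T (T z) = z)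
    (h1 : T ![1, 0, 0, 0] = ![1, 0, 0, 0])
    (hpos : ∀ z, (octOp.{u} z).IsPositive → (octOp.{u} (T z)).IsPositive) (z : Fin 4 → ℂ) :
    T z = fun k => (starRingEnd ℂ) (z k) := by
  let ι : (Fin 4 → ℝ) →ₗ[ℝ] (Fin 4 → ℂ) :=
    { toFun := fun y k => (y k : ℂ)
      map_add' := fun x y => by ext k; simp
      map_smul' := fun c y => by ext k; simp }
  have hι1 : ι octOne = ![1, 0, 0, 0] := by
    ext k; fin_cases k <;> simp [ι, octOne]
  have hTr : ∀ (r : ℝ) z, T (r • z) = r • T z := by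
    intro r z
    have := hT r z
    rw [Complex.conj_ofReal] at this
    exact this
  have hpos' : ∀ y, (∀ i, 0 ≤ octEval i y) → ∃ x, T (ι y) = ι x ∧ ∀ i, 0 ≤ octEval i x :=
    fun y hy => exists_ofReal_of_isPositive (hpos _ (octOp_isPositive hy))
  have hreal : ∀ y, ∃ x, T (ι y) = ι x := by
    intro y
    -- Adding `s` makes `y` positive, so `T` preserves real points; there it is a positive unital
    -- involution and hence the identity by rigidity.
    let s : ℝ := ∑ i, |octEval i y|
    obtain ⟨x, hx, -⟩ := hpos' (y + s • octOne) fun i => by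
      rw [map_add, map_smul, octEval_octOne, smul_eq_mul, mul_one]
      have : |octEval i y| ≤ s :=
        Finset.single_le_sum (f := fun i => |octEval i y|) (fun i _ => abs_nonneg _)
          (Finset.mem_univ i)
      linarith [neg_abs_le (octEval i y)]
    refine ⟨x - s • octOne, ?_⟩
    rw [map_add, map_smul, map_add, hTr, hι1, h1] at hx
    rw [map_sub, map_smul, hι1, ← hx, add_sub_cancel_right]
  let S : (Fin 4 → ℝ) →ₗ[ℝ] (Fin 4 → ℝ) :=
    { toFun := fun y k => (T (ι y) k).re
      map_add' := fun x y => by ext k; simp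
      map_smul' := fun c y => by ext k; simp [hTr] }
  have hS : ∀ y, T (ι y) = ι (S y) := by
    intro y
    obtain ⟨x, hx⟩ := hreal y
    have : S y = x := by
      ext k
      change (T (ι y) k).re = x k
      rw [hx]; rfl
    rw [this, hx]
  have hinj : Function.Injective ι := fun x y h => by
    ext k
    exact Complex.ofReal_injective (congrFun h k)
  have hSid := octahedron_rigid (S := S) (fun y hy i => by
      obtain ⟨x, hx, hx'⟩ := hpos' y hy
      rw [hS] at hx
      rw [hinj hx]
      exact hx' i)
    (hinj (by rw [← hS, hι1, h1])) (fun y => hinj (by rw [← hS, ← hS, hTT]))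
  have hz : z = ι (fun k => (z k).re) + Complex.I • ι (fun k => (z k).im) := by
    ext k
    simp [ι, mul_comm Complex.I]
  conv_lhs => rw [hz]
  rw [map_add, hT, hS, hS, hSid, hSid]
  ext k
  apply Complex.ext <;> simp [ι]

/-- An element of the operator system. -/
noncomputable def octElem (z : Fin 4 → ℂ) : LinearMap.range octOp.{u} := ⟨octOp z, z, rfl⟩

/-- The matrix `5 + 2 ∑ σᵢᵀ ⊗ hᵢ`. -/
noncomputable def octMatrix : Matrix (Fin 2) (Fin 2) (LinearMap.range octOp.{u}) :=
  !![octElem ![5, 0, 0, 2], octElem ![0, 2, 2 * Complex.I, 0];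
    octElem ![0, 2, -(2 * Complex.I), 0], octElem ![5, 0, 0, -2]]

/-- The matrix `5 + 2 ∑ σᵢ ⊗ hᵢ`. -/
noncomputable def octMatrixConj : Matrix (Fin 2) (Fin 2) (LinearMap.range octOp.{u}) :=
  !![octElem ![5, 0, 0, 2], octElem ![0, 2, -(2 * Complex.I), 0];
    octElem ![0, 2, 2 * Complex.I, 0], octElem ![5, 0, 0, -2]]

/-- On the antisymmetric vector `∑ σᵢ ⊗ σᵢ` is `-3`, so the matrix acts there as `5 - 6 = -1`. -/
theorem not_matPos_octMatrixConj : ¬ MatPos octMatrixConj.{u} := by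
  intro h
  have h1 := h.re_inner_nonneg_left (WithLp.toLp 2 ![EuclideanSpace.single ⟨.inr 1⟩ 1,
    EuclideanSpace.single ⟨.inr 0⟩ (-1)])
  rw [PiLp.inner_apply, Fin.sum_univ_two, matOp_apply, matOp_apply, inner_eightSpace,
    inner_eightSpace] at h1
  simp [octMatrixConj, octElem, octOp_apply_inl, octOp_apply_inr, pauli] at h1
  norm_num at h1

theorem matOp_octMatrix_apply (v : PiLp 2 fun _ : Fin 2 => EightSpace.{u}) (i) :
    (matOp octMatrix.{u} v) 0 i =
        octOp ![5, 0, 0, 2] (v 0) i + octOp ![0, 2, 2 * Complex.I, 0] (v 1) i ∧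
      (matOp octMatrix.{u} v) 1 i =
        octOp ![0, 2, -(2 * Complex.I), 0] (v 0) i + octOp ![5, 0, 0, -2] (v 1) i := by
  rw [matOp_apply, matOp_apply, Fin.sum_univ_two, Fin.sum_univ_two]
  exact ⟨rfl, rfl⟩

/-- At a vertex `r` the matrix is `5 + 2 ∑ rᵢ σᵢᵀ`, with eigenvalues `5 ± 2|r|`; the farthest vertex
has `|r| = 5/2`. -/
theorem octMatrix_form_inl_nonneg (i : Fin 6) (x y : ℂ) :
    0 ≤ (x * (starRingEnd ℂ) (octEvalC i ![5, 0, 0, 2] * x +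
          octEvalC i ![0, 2, 2 * Complex.I, 0] * y) +
        y * (starRingEnd ℂ) (octEvalC i ![0, 2, -(2 * Complex.I), 0] * x +
          octEvalC i ![5, 0, 0, -2] * y)).re ∧
      (x * (starRingEnd ℂ) (octEvalC i ![5, 0, 0, 2] * x +
          octEvalC i ![0, 2, 2 * Complex.I, 0] * y) +
        y * (starRingEnd ℂ) (octEvalC i ![0, 2, -(2 * Complex.I), 0] * x +
          octEvalC i ![5, 0, 0, -2] * y)).im = 0 := by
  have h (n : ℕ) [n.AtLeastTwo] : (starRingEnd ℂ) (OfNat.ofNat n) = OfNat.ofNat n := map_ofNat _ n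
  constructor
  · fin_cases i <;> simp [octEvalC, octVertex, h] <;>
      nlinarith [sq_nonneg (x.re + y.re), sq_nonneg (x.re - y.re), sq_nonneg (x.im + y.im),
        sq_nonneg (x.im - y.im), sq_nonneg (x.re + y.im), sq_nonneg (x.re - y.im),
        sq_nonneg (x.im + y.re), sq_nonneg (x.im - y.re), sq_nonneg x.re, sq_nonneg x.im,
        sq_nonneg y.re, sq_nonneg y.im]
  · fin_cases i <;> simp [octEvalC, octVertex, h] <;> ring

/-- The Pauli block splits into `[7, 4; 4, 7]` on `(x₀, y₁)` and `3` on each of `x₁`, `y₀`; its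
eigenvalues are 11, 3, 3, 3. -/
theorem octMatrix_form_inr_nonneg (x₀ x₁ y₀ y₁ : ℂ) :
    0 ≤ (x₀ * (starRingEnd ℂ) (7 * x₀ + 4 * y₁) + x₁ * (starRingEnd ℂ) (3 * x₁) +
        (y₀ * (starRingEnd ℂ) (3 * y₀) + y₁ * (starRingEnd ℂ) (4 * x₀ + 7 * y₁))).re ∧
      (x₀ * (starRingEnd ℂ) (7 * x₀ + 4 * y₁) + x₁ * (starRingEnd ℂ) (3 * x₁) +
        (y₀ * (starRingEnd ℂ) (3 * y₀) + y₁ * (starRingEnd ℂ) (4 * x₀ + 7 * y₁))).im = 0 := by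
  have h (n : ℕ) [n.AtLeastTwo] : (starRingEnd ℂ) (OfNat.ofNat n) = OfNat.ofNat n := map_ofNat _ n
  constructor
  · simp [h]
    nlinarith [sq_nonneg (x₀.re + y₁.re), sq_nonneg (x₀.im + y₁.im), sq_nonneg x₀.re,
      sq_nonneg x₀.im, sq_nonneg x₁.re, sq_nonneg x₁.im, sq_nonneg y₀.re, sq_nonneg y₀.im,
      sq_nonneg y₁.re, sq_nonneg y₁.im]
  · simp [h]
    ring

theorem matPos_octMatrix : MatPos octMatrix.{u} := by
  unfold MatPos
  rw [ContinuousLinearMap.isPositive_iff_complex]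
  intro v
  have key : ⟪matOp octMatrix.{u} v, v⟫_ℂ =
      ∑ i : Fin 6, (v 0 ⟨.inl i⟩ * (starRingEnd ℂ) (octEvalC i ![5, 0, 0, 2] * v 0 ⟨.inl i⟩ +
          octEvalC i ![0, 2, 2 * Complex.I, 0] * v 1 ⟨.inl i⟩) +
        v 1 ⟨.inl i⟩ * (starRingEnd ℂ) (octEvalC i ![0, 2, -(2 * Complex.I), 0] * v 0 ⟨.inl i⟩ +
          octEvalC i ![5, 0, 0, -2] * v 1 ⟨.inl i⟩)) +
      (v 0 ⟨.inr 0⟩ * (starRingEnd ℂ) (7 * v 0 ⟨.inr 0⟩ + 4 * v 1 ⟨.inr 1⟩) +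
        v 0 ⟨.inr 1⟩ * (starRingEnd ℂ) (3 * v 0 ⟨.inr 1⟩) +
        (v 1 ⟨.inr 0⟩ * (starRingEnd ℂ) (3 * v 1 ⟨.inr 0⟩) +
          v 1 ⟨.inr 1⟩ * (starRingEnd ℂ) (4 * v 0 ⟨.inr 0⟩ + 7 * v 1 ⟨.inr 1⟩))) := by
    have h0 := fun i => (matOp_octMatrix_apply v i).1
    have h1 := fun i => (matOp_octMatrix_apply v i).2
    rw [PiLp.inner_apply, Fin.sum_univ_two, inner_eightSpace, inner_eightSpace,
      add_add_add_comm, ← Finset.sum_add_distrib]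
    congr 1
    · refine Finset.sum_congr rfl fun i _ => ?_
      rw [h0, h1]
      rfl
    · rw [h0, h0, h1, h1]
      have e0 : pauli ![5, 0, 0, 2] = !![7, 0; 0, 3] := by
        ext i j; fin_cases i <;> fin_cases j <;> simp [pauli] <;> norm_num
      have e1 : pauli ![0, 2, 2 * Complex.I, 0] = !![0, 4; 0, 0] := by
        ext i j; fin_cases i <;> fin_cases j <;> simp [pauli] <;>
          first
          | linear_combination 2 * Complex.I_mul_I
          | linear_combination -2 * Complex.I_mul_I
      have e2 : pauli ![0, 2, -(2 * Complex.I), 0] = !![0, 0; 4, 0] := by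
        ext i j; fin_cases i <;> fin_cases j <;> simp [pauli] <;>
          first
          | linear_combination 2 * Complex.I_mul_I
          | linear_combination -2 * Complex.I_mul_I
      have e3 : pauli ![5, 0, 0, -2] = !![3, 0; 0, 7] := by
        ext i j; fin_cases i <;> fin_cases j <;> simp [pauli] <;> norm_num
      simp only [octOp_apply_inr, e0, e1, e2, e3]
      simp
  have hr := octMatrix_form_inr_nonneg (v 0 ⟨.inr 0⟩) (v 0 ⟨.inr 1⟩) (v 1 ⟨.inr 0⟩) (v 1 ⟨.inr 1⟩)
  have hl := fun i => octMatrix_form_inl_nonneg i (v 0 ⟨.inl i⟩) (v 1 ⟨.inl i⟩)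
  rw [key]
  refine ⟨Complex.ext rfl ?_, ?_⟩
  · rw [Complex.add_im, Complex.im_sum, Finset.sum_eq_zero fun i _ => (hl i).2, hr.2]
    simp
  · rw [RCLike.re_eq_complex_re, Complex.add_re, Complex.re_sum]
    exact add_nonneg (Finset.sum_nonneg fun i _ => (hl i).1) hr.1

/-- Positivity of single elements already forces `θ` to be the adjoint, and then positivity of 2 × 2
matrices fails. -/
theorem isEmpty_iso_octSystem (A : OpCat.{u} .system ℝ ℝ) :
    IsEmpty (A.complexify ≅ octSystem) := by
  refine ⟨fun φ => ?_⟩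
  obtain ⟨θ, h1, h2, -, h4⟩ : ∃ θ : LinearMap.range octOp.{u} →+ LinearMap.range octOp.{u},
    (∀ (c : ℂ) x, θ (c • x) = (starRingEnd ℂ) c • θ x) ∧ (∀ x, θ (θ x) = x) ∧
      (∀ x, ‖(θ x).1‖ = ‖x.1‖) ∧ (OpKind.system = .system → PreservesOne θ ∧
        CompletelyPositive θ) := exists_conjugation φ
  obtain ⟨hone, hcp⟩ := h4 rfl
  let e := LinearEquiv.ofInjective octOp.{u} octOp_injective
  have he : ∀ z, (e z).1 = octOp z := fun _ => rfl
  have he' : ∀ x, octOp (e.symm x) = x.1 := fun x => by rw [← he, e.apply_symm_apply]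
  have hθ : ∀ z, θ (octElem z) = octElem fun k => (starRingEnd ℂ) (z k) := by
    intro z
    have := eq_conj_of_positive_involution
      (T := (e.symm.toLinearMap.toAddMonoidHom.comp θ).comp e.toLinearMap.toAddMonoidHom)
      (fun c p => ?_) (fun p => ?_) ?_ (fun p hp => ?_) z
    · have h : e.symm (θ (e z)) = _ := this
      rw [LinearEquiv.symm_apply_eq] at h
      exact h
    · change e.symm (θ (e (c • p))) = _ • e.symm (θ (e p))
      rw [map_smul, h1, map_smul]
    · change e.symm (θ (e (e.symm (θ (e p))))) = p
      rw [e.apply_symm_apply, h2, e.symm_apply_apply]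
    · change e.symm (θ (e _)) = _
      rw [LinearEquiv.symm_apply_eq]
      exact Subtype.ext ((hone _ octOp_one).trans octOp_one.symm)
    · change (octOp (e.symm (θ (e p)))).IsPositive
      rw [he']
      exact (matOp_one_by_one _).2.1 (hcp 1 _ ((matOp_one_by_one (e p)).2.2 hp))
  refine not_matPos_octMatrixConj.{u} ?_
  have hmap : octMatrix.map θ = octMatrixConj := by
    have h (n : ℕ) [n.AtLeastTwo] : (starRingEnd ℂ) (OfNat.ofNat n) = OfNat.ofNat n :=
      map_ofNat _ n
    have hconj : ∀ z w : Fin 4 → ℂ, (∀ k, (starRingEnd ℂ) (z k) = w k) →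
        θ (octElem z) = octElem w := fun z w hzw => by rw [hθ, funext hzw]
    refine Matrix.ext fun i j => ?_
    fin_cases i <;> fin_cases j <;> refine hconj _ _ fun k => ?_ <;> fin_cases k <;> simp [h]
  rw [← hmap]
  exact hcp 2 _ matPos_octMatrix

end Octahedron

/-! ### Complexification is not essentially surjective. -/

theorem exists_not_complexification (k : OpKind) :
    ∃ Z : OpCat.{u} k ℂ ℂ, ∀ A : OpCat.{u} k ℝ ℝ, IsEmpty (A.complexify ≅ Z) := by
  by_cases hk : k = .system
  · subst hk
    exact ⟨octSystem, isEmpty_iso_octSystem⟩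
  · exact ⟨affineSpace k hk, isEmpty_iso_affineSpace k hk⟩

theorem not_essSurj_complexification (k : OpKind) : ¬ (complexification.{u} k).EssSurj := by
  intro h
  obtain ⟨Z, hZ⟩ := exists_not_complexification.{u} k
  exact (hZ _).false ((complexification.{u} k).objObjPreimageIso Z)

/-- Every value of the intermediate functor is the complexification of a real object, so the same
example is missed. -/
theorem not_essSurj_intermediateComplexification (k : OpKind) :
    ¬ (intermediateComplexification.{u} k).EssSurj := by
  intro h
  obtain ⟨Z, hZ⟩ := exists_not_complexification.{u} k
  exact (hZ ((intermediateComplexification.{u} k).objPreimage Z).toReal).false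
    ((intermediateComplexification.{u} k).objObjPreimageIso Z)

theorem not_essSurj_complexificationG (G : Type v) [Group G] (k : OpKind) :
    ¬ (complexificationG.{u} G k).EssSurj := by
  intro h
  obtain ⟨Z, hZ⟩ := exists_not_complexification.{u} k
  exact (hZ ((complexificationG.{u} G k).objPreimage (Z.trivialAction G)).toOpCat).false
    (underlyingIso ((complexificationG.{u} G k).objObjPreimageIso (Z.trivialAction G)))

theorem not_essSurj_intermediateComplexificationG (G : Type v) [Group G] (k : OpKind) :
    ¬ (intermediateComplexificationG.{u} G k).EssSurj := by
  intro h
  obtain ⟨Z, hZ⟩ := exists_not_complexification.{u} k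
  exact (hZ ((intermediateComplexificationG.{u} G k).objPreimage
      (Z.trivialAction G)).toReal.toOpCat).false
    (underlyingIso ((intermediateComplexificationG.{u} G k).objObjPreimageIso
      (Z.trivialAction G)))

end OpSp

theorem mainTheorem12 (G : Type v) [Group G] :
    -- the twelve complexification functors: three kinds, from the real and from the intermediate
    -- category, without and with a group action
    (∀ k : OpSp.OpKind,
      ((OpSp.complexification.{u} k).Faithful ∧
        ¬ (OpSp.complexification.{u} k).Full ∧
        ¬ (OpSp.complexification.{u} k).EssSurj) ∧
      ((OpSp.intermediateComplexification.{u} k).Faithful ∧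
        ¬ (OpSp.intermediateComplexification.{u} k).Full ∧
        ¬ (OpSp.intermediateComplexification.{u} k).EssSurj) ∧
      ((OpSp.complexificationG.{u} G k).Faithful ∧
        ¬ (OpSp.complexificationG.{u} G k).Full ∧
        ¬ (OpSp.complexificationG.{u} G k).EssSurj) ∧
      ((OpSp.intermediateComplexificationG.{u} G k).Faithful ∧
        ¬ (OpSp.intermediateComplexificationG.{u} G k).Full ∧
        ¬ (OpSp.intermediateComplexificationG.{u} G k).EssSurj)) ∧
    -- the six forgetful functors from the complex to the real categories
    (∀ k : OpSp.OpKind,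
      ¬ (OpSp.forgetToReal.{u} k ℂ).EssSurj ∧
      ¬ (OpSp.forgetToRealG.{u} G k ℂ).EssSurj) ∧
    -- the quaternions are not in their essential images
    (∀ k : OpSp.OpKind,
      (∀ Z : OpSp.OpCat.{u} k ℂ ℂ,
        IsEmpty ((OpSp.forgetToReal.{u} k ℂ).obj Z ≅ OpSp.quaternionSpace.{u} k)) ∧
      (∀ Z : OpSp.GOpCat.{u} G k ℂ ℂ,
        IsEmpty ((OpSp.forgetToRealG.{u} G k ℂ).obj Z ≅
          (OpSp.quaternionSpace.{u} k).trivialAction G))) ∧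
    -- the six forgetful functors from unital operator spaces to operator spaces
    (¬ (OpSp.forgetUnit.{u} ℝ ℝ).EssSurj ∧
      ¬ (OpSp.forgetUnit.{u} ℂ ℂ).EssSurj ∧
      ¬ (OpSp.forgetUnit.{u} ℂ ℝ).EssSurj ∧
      ¬ (OpSp.forgetUnitG.{u} ℝ ℝ G).EssSurj ∧
      ¬ (OpSp.forgetUnitG.{u} ℂ ℂ G).EssSurj ∧
      ¬ (OpSp.forgetUnitG.{u} ℂ ℝ G).EssSurj) :=
  ⟨fun k => ⟨⟨inferInstance, OpSp.not_full_complexification k,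
      OpSp.not_essSurj_complexification k⟩,
    ⟨inferInstance, OpSp.not_full_intermediateComplexification k,
      OpSp.not_essSurj_intermediateComplexification k⟩,
    ⟨inferInstance, OpSp.not_full_complexificationG G k,
      OpSp.not_essSurj_complexificationG G k⟩,
    ⟨inferInstance, OpSp.not_full_intermediateComplexificationG G k,
      OpSp.not_essSurj_intermediateComplexificationG G k⟩⟩,
  fun k => ⟨OpSp.not_essSurj_forgetToReal k, OpSp.not_essSurj_forgetToRealG G k⟩,
  fun k => ⟨OpSp.isEmpty_iso_quaternionSpace k, OpSp.isEmpty_iso_quaternionSpaceG G k⟩,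
  OpSp.not_essSurj_forgetUnit ℝ ℝ, OpSp.not_essSurj_forgetUnit ℂ ℂ,
  OpSp.not_essSurj_forgetUnit ℂ ℝ, OpSp.not_essSurj_forgetUnitG ℝ ℝ G,
  OpSp.not_essSurj_forgetUnitG ℂ ℂ G, OpSp.not_essSurj_forgetUnitG ℂ ℝ G⟩
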